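/- Let $\mathcal J=\{j_n\colon S^{n-1}\to D^n\mid n\ge 0\}$ (with $S^{-1}=\emptyset$), regarded as a discrete category over the arrow category $\mathbf{Top}^{\mathbf 2}$. An algebraic weak factorisation system (awfs) on a category $\mathcal C$ is a functorial factorisation $f=Rf\circ Lf$ through $Mf$, together with a comultiplication $(1,\delta_f)\colon Lf\to LLf$ making $L$ (with counit $(1,Rf)$) a comonad on $\mathcal C^{\mathbf 2}$ and a multiplication $(\mu_f,1)\colon RRf\to Rf$ making $R$ (with unit $(Lf,1)$) a monad on $\mathcal C^{\mathbf 2}$, such that $(\delta_f,\mu_f)\colon LRf\to RLf$ is a distributive law. $L\text{-}\mathbf{Map}$ is the category of $L$-coalgebras. A morphism of awfs $(L,R)\to(L',R')$ is a natural transformation $\chi\colon M\to M'$ such that $(1,\chi)\colon L\to L'$ is a morphism of comonads and $(\chi,1)\colon R\to R'$ is a morphism of monads; it induces a functor $\chi_*\colon L\text{-}\mathbf{Map}\to L'\text{-}\mathbf{Map}$ over $\mathcal C^{\mathbf 2}$. A stratum on a space $X$ is a set of cells, each with a shape $j_k\in\mathcal J$ and an attaching map $S^{k-1}\to X$; its body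 is the space obtained from $X$ by attaching all these cells. A relative cell complex is a sequence of strata, each on the body of the previous one, such that no attaching map of a cell factors through the base of a lower stratum; its body is the colimit of the sequence. With the sequences of maps of base spaces and of cells that preserve shapes and attaching maps and are compatible with the bodies, relative cell complexes form a category $\mathbf{CellCx}$ with a forgetful functor $U\colon\mathbf{CellCx}\to\mathbf{Top}^{\mathbf 2}$ sending a complex to the map from its base to its body. $U$ has a right adjoint $K$: $Kf$ has base the domain of $f\colon A\to B$, and its $n$-th stratum ($n\ge 0$), on $A_n$ (where $A_0=A$, and $A_{n+1}$ is the body of the $n$-th stratum), has one cell for each commutative square from some $j_k$ to the canonical map $A_n\to B$ whose attaching map $S^{k-1}\to A_n$ does not, if $n\ge 1$, factor through $A_{n-1}$. The counit is $(1,Ef)\colon UKf\to f$, where $Ef\colon\overline{Kf}\to B$ is the induced map. Given cell complexes $C$, $D$ such that the body of $C$ is the base of $D$, the composite $D*C$ is the cell complex on $UD\circ UC$ whose cells are those of $C$ and those of $D$, with the same characteristic maps. Then the factorisation $f=Ef\circ UKf$ is an awfs $(UK,E)$, where $UK$ is the comonad of the adjunction $U\dashv K$ and $\mu_f$ is the body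 of the morphism of cell complexes $KEf*Kf\to Kf$ corresponding to $(1,EEf)\colon U(KEf*Kf)\to f$. It is free on $\mathcal J$: each $j_k$ is a left map of $(UK,E)$, with structure map $D^k\to\overline{Kj_k}$ the characteristic map of the cell given by the identity square, and for the resulting functor $\eta\colon\mathcal J\to UK\text{-}\mathbf{Map}$, every awfs $(L',R')$ on $\mathbf{Top}$ and every functor $F\colon\mathcal J\to L'\text{-}\mathbf{Map}$ over $\mathbf{Top}^{\mathbf 2}$ there is a unique morphism of awfs $\chi\colon(UK,E)\to(L',R')$ with $F=\chi_*\circ\eta$. Moreover $(UK,E)$ is isomorphic, as an awfs, to the awfs $(\mathbb L,\mathbb R)$ produced from $\mathcal J$ by Garner's small object argument. That is the following. Let $T$ be the one-step factorisation, which attaches to the domain of $f$ one cell for each square from some $j_k$ to $f$, with its comonad structure. For functorial factorisations $F,G$ let $F\odot G$ factorise $f$ by $G$ and then its right part by $F$. Put $X_0=1$ (the factorisation $f=f\circ 1$) and $X_1=T$, and let $X_{n+2}$ be the coequaliser of the two canonical maps $T\odot X_n\rightrightarrows T\odot X_{n+1}$, one induced by $X_n\to X_{n+1}$ and the other being $T\odot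 X_n\to X_{n+1}\to T\odot X_{n+1}$. The factorisation of $(\mathbb L,\mathbb R)$ is $\operatorname{colim}_n X_n$; its awfs structure is the one for which $T\to\operatorname{colim}_n X_n$ is a morphism of comonads and the multiplication extends the actions $T\odot X_n\to X_{n+1}$. -/

import Mathlib

open CategoryTheory Limits

universe v u w

/-! ### Algebraic weak factorisation systems -/

/-- A functorial factorisation `f = Rf ∘ Lf` through the central functor `M`. -/
structure FunctorialFactorization (C : Type u) [Category.{v} C] where
  M : Arrow C ⥤ C
  L : ∀ f : Arrow C, f.left ⟶ M.obj f
  R : ∀ f : Arrow C, M.obj f ⟶ f.right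
  L_naturality : ∀ {f g : Arrow C} (φ : f ⟶ g), φ.left ≫ L g = L f ≫ M.map φ
  R_naturality : ∀ {f g : Arrow C} (φ : f ⟶ g), M.map φ ≫ R g = R f ≫ φ.right
  fac : ∀ f : Arrow C, L f ≫ R f = f.hom

namespace FunctorialFactorization

variable {C : Type u} [Category.{v} C]

/-- The domain-preserving endofunctor `L` of `C²`. -/
abbrev left (F : FunctorialFactorization C) : Arrow C ⥤ Arrow C where
  obj f := Arrow.mk (F.L f)
  map φ := Arrow.homMk φ.left (F.M.map φ) (F.L_naturality φ)

/-- The codomain-preserving endofunctor `R` of `C²`. -/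
abbrev right (F : FunctorialFactorization C) : Arrow C ⥤ Arrow C where
  obj f := Arrow.mk (F.R f)
  map φ := Arrow.homMk (F.M.map φ) φ.right (F.R_naturality φ)

/-- The copoint `(1, Rf) : Lf ⟶ f`. -/
def counit (F : FunctorialFactorization C) : F.left ⟶ 𝟭 (Arrow C) where
  app f := Arrow.homMk (𝟙 f.left) (F.R f) ((Category.id_comp _).trans (F.fac f).symm)
  naturality f g φ := by
    apply Arrow.hom_ext
    · exact (Category.comp_id _).trans (Category.id_comp _).symm
    · exact F.R_naturality φ

/-- The point `(Lf, 1) : f ⟶ Rf`. -/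
def unit (F : FunctorialFactorization C) : 𝟭 (Arrow C) ⟶ F.right where
  app f := Arrow.homMk (F.L f) (𝟙 f.right) ((F.fac f).trans (Category.comp_id _).symm)
  naturality f g φ := by
    apply Arrow.hom_ext
    · exact F.L_naturality φ
    · exact (Category.comp_id _).trans (Category.id_comp _).symm

/-- A morphism of functorial factorisations: a natural transformation of the central functors
that commutes with the left and the right parts. -/
@[ext]
structure Hom (F G : FunctorialFactorization C) where
  χ : F.M ⟶ G.M
  left_comp : ∀ f, F.L f ≫ χ.app f = G.L f
  comp_right : ∀ f, χ.app f ≫ G.R f = F.R f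

namespace Hom

variable {F G H : FunctorialFactorization C}

def id (F : FunctorialFactorization C) : Hom F F where
  χ := 𝟙 _
  left_comp f := by simp
  comp_right f := by simp

def comp (a : Hom F G) (b : Hom G H) : Hom F H where
  χ := a.χ ≫ b.χ
  left_comp f := by
    rw [NatTrans.comp_app, ← Category.assoc, a.left_comp, b.left_comp]
  comp_right f := by
    rw [NatTrans.comp_app, Category.assoc, b.comp_right, a.comp_right]

/-- The induced transformation `(1, χ) : L ⟶ L'`. -/
def leftTrans (a : Hom F G) : F.left ⟶ G.left where
  app f := Arrow.homMk (𝟙 f.left) (a.χ.app f) ((Category.id_comp _).trans (a.left_comp f).symm)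
  naturality f g φ := by
    apply Arrow.hom_ext
    · exact (Category.comp_id _).trans (Category.id_comp _).symm
    · exact a.χ.naturality φ

/-- The induced transformation `(χ, 1) : R ⟶ R'`. -/
def rightTrans (a : Hom F G) : F.right ⟶ G.right where
  app f := Arrow.homMk (a.χ.app f) (𝟙 f.right) ((a.comp_right f).trans (Category.comp_id _).symm)
  naturality f g φ := by
    apply Arrow.hom_ext
    · exact a.χ.naturality φ
    · exact (Category.comp_id _).trans (Category.id_comp _).symm

end Hom

end FunctorialFactorization

/-- Comultiplication and multiplication making the left part of a functorial factorisation a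
comonad and its right part a monad. -/
structure ComonadMonadStructure {C : Type u} [Category.{v} C]
    (F : FunctorialFactorization C) where
  δ : F.left ⟶ F.left ⋙ F.left
  left_counit : ∀ f, δ.app f ≫ F.counit.app (F.left.obj f) = 𝟙 (F.left.obj f)
  right_counit : ∀ f, δ.app f ≫ F.left.map (F.counit.app f) = 𝟙 (F.left.obj f)
  coassoc : ∀ f, δ.app f ≫ F.left.map (δ.app f) = δ.app f ≫ δ.app (F.left.obj f)
  μ : F.right ⋙ F.right ⟶ F.right
  left_unit : ∀ f, F.unit.app (F.right.obj f) ≫ μ.app f = 𝟙 (F.right.obj f)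
  right_unit : ∀ f, F.right.map (F.unit.app f) ≫ μ.app f = 𝟙 (F.right.obj f)
  assoc : ∀ f, F.right.map (μ.app f) ≫ μ.app f = μ.app (F.right.obj f) ≫ μ.app f

namespace ComonadMonadStructure

variable {C : Type u} [Category.{v} C] {F : FunctorialFactorization C}

/-- The comonad `𝕃` on `C²`. -/
def comonad (A : ComonadMonadStructure F) : Comonad (Arrow C) where
  toFunctor := F.left
  ε := F.counit
  δ := A.δ
  coassoc := A.coassoc
  left_counit := A.left_counit
  right_counit := A.right_counit

/-- The monad `ℝ` on `C²`. -/
def monad (A : ComonadMonadStructure F) : CategoryTheory.Monad (Arrow C) where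
  toFunctor := F.right
  η := F.unit
  μ := A.μ
  assoc := A.assoc
  left_unit := A.left_unit
  right_unit := A.right_unit

/-- The codomain part `δ_f : Mf ⟶ MLf` of the comultiplication. -/
def δMap (A : ComonadMonadStructure F) (f : Arrow C) :
    F.M.obj f ⟶ F.M.obj (Arrow.mk (F.L f)) :=
  (A.δ.app f).right

/-- The domain part `μ_f : MRf ⟶ Mf` of the multiplication. -/
def μMap (A : ComonadMonadStructure F) (f : Arrow C) :
    F.M.obj (Arrow.mk (F.R f)) ⟶ F.M.obj f :=
  (A.μ.app f).left

/-- The transformation `Δ_f = (δ_f, μ_f) : LRf ⟶ RLf`. -/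
def distrib (A : ComonadMonadStructure F) (f : Arrow C) :
    F.left.obj (F.right.obj f) ⟶ F.right.obj (F.left.obj f) :=
  Arrow.homMk (A.δMap f) (A.μMap f) (by
    have h₁ := congrArg Arrow.Hom.right (A.left_counit f)
    have h₂ := congrArg Arrow.Hom.left (A.left_unit f)
    exact h₁.trans h₂.symm)

end ComonadMonadStructure

/-- An algebraic weak factorisation system with underlying functorial factorisation `F`: a
comonad and a monad structure such that `Δ = (δ, μ)` is a distributive law, that is, commutes
with the unit, the counit, the multiplication and the comultiplication. -/
structure AWFSStructure {C : Type u} [Category.{v} C] (F : FunctorialFactorization C) extends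
    ComonadMonadStructure F where
  distrib_unit : ∀ f, F.left.map (F.unit.app f) ≫ toComonadMonadStructure.distrib f =
    F.unit.app (F.left.obj f)
  distrib_counit : ∀ f, toComonadMonadStructure.distrib f ≫ F.right.map (F.counit.app f) =
    F.counit.app (F.right.obj f)
  distrib_mul : ∀ f, F.left.map (μ.app f) ≫ toComonadMonadStructure.distrib f =
    toComonadMonadStructure.distrib (F.right.obj f) ≫
      F.right.map (toComonadMonadStructure.distrib f) ≫ μ.app (F.left.obj f)
  distrib_comul : ∀ f, toComonadMonadStructure.distrib f ≫ F.right.map (δ.app f) =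
    δ.app (F.right.obj f) ≫ F.left.map (toComonadMonadStructure.distrib f) ≫
      toComonadMonadStructure.distrib (F.left.obj f)

/-- An algebraic weak factorisation system on `C`. -/
structure AWFS (C : Type u) [Category.{v} C] where
  fact : FunctorialFactorization C
  str : AWFSStructure fact

namespace AWFS

variable {C : Type u} [Category.{v} C]

/-- A morphism of awfs: a morphism of functorial factorisations `χ` such that `(1, χ)` is a
comonad morphism and `(χ, 1)` is a monad morphism. -/
@[ext]
structure Hom (W W' : AWFS C) extends FunctorialFactorization.Hom W.fact W'.fact where
  comul : ∀ f, toHom.leftTrans.app f ≫ W'.str.δ.app f =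
    W.str.δ.app f ≫ toHom.leftTrans.app (W.fact.left.obj f) ≫
      W'.fact.left.map (toHom.leftTrans.app f)
  mul : ∀ f, W.str.μ.app f ≫ toHom.rightTrans.app f =
    (W.fact.right.map (toHom.rightTrans.app f) ≫
      toHom.rightTrans.app (W'.fact.right.obj f)) ≫ W'.str.μ.app f

/-- The comonad morphism `(1, χ)`. -/
def Hom.comonadHom {W W' : AWFS C} (χ : Hom W W') :
    ComonadHom W.str.comonad W'.str.comonad where
  app := χ.leftTrans.app
  naturality _ _ φ := χ.leftTrans.naturality φ
  app_ε f := by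
    apply Arrow.hom_ext
    · exact Category.id_comp _
    · exact χ.comp_right f
  app_δ := χ.comul

/-- The monad morphism `(χ, 1)`. -/
def Hom.monadHom {W W' : AWFS C} (χ : Hom W W') :
    MonadHom W.str.monad W'.str.monad where
  app := χ.rightTrans.app
  naturality _ _ φ := χ.rightTrans.naturality φ
  app_η f := by
    apply Arrow.hom_ext
    · exact χ.left_comp f
    · exact Category.id_comp _
  app_μ := χ.mul

def Hom.id (W : AWFS C) : Hom W W where
  toHom := FunctorialFactorization.Hom.id W.fact
  comul f := (ComonadHom.app_δ (𝟙 W.str.comonad) f)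
  mul f := (MonadHom.app_μ (𝟙 W.str.monad) f)

def Hom.comp {W W' W'' : AWFS C} (a : Hom W W') (b : Hom W' W'') : Hom W W'' where
  toHom := a.toHom.comp b.toHom
  comul f := by
    have h := ComonadHom.app_δ ((show W.str.comonad ⟶ W'.str.comonad from a.comonadHom) ≫
      (show W'.str.comonad ⟶ W''.str.comonad from b.comonadHom)) f
    have e : ∀ g, (a.toHom.comp b.toHom).leftTrans.app g =
        a.leftTrans.app g ≫ b.leftTrans.app g := fun g => by
      apply Arrow.hom_ext
      · exact (Category.id_comp _).symm
      · rfl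
    rw [e, e]
    exact h
  mul f := by
    have h := MonadHom.app_μ ((show W.str.monad ⟶ W'.str.monad from a.monadHom) ≫
      (show W'.str.monad ⟶ W''.str.monad from b.monadHom)) f
    have e : ∀ g, (a.toHom.comp b.toHom).rightTrans.app g =
        a.rightTrans.app g ≫ b.rightTrans.app g := fun g => by
      apply Arrow.hom_ext
      · rfl
      · exact (Category.id_comp _).symm
    rw [e, e]
    exact h

instance : Category (AWFS C) where
  Hom := Hom
  id := Hom.id
  comp := Hom.comp
  id_comp f := Hom.ext (Category.id_comp f.χ)
  comp_id f := Hom.ext (Category.comp_id f.χ)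
  assoc f g h := Hom.ext (Category.assoc f.χ g.χ h.χ)

/-- The category of left maps: coalgebras for the comonad. -/
abbrev LMap (W : AWFS C) := W.str.comonad.Coalgebra

/-- The functor `α_*` on left maps over `C²` induced by a morphism of awfs. -/
def mapLMap {W W' : AWFS C} (χ : W ⟶ W') : W.LMap ⥤ W'.LMap where
  obj X :=
    { A := X.A
      a := X.a ≫ (Hom.comonadHom χ).app X.A
      counit := by rw [Category.assoc, ComonadHom.app_ε, X.counit]
      coassoc := by
        rw [Category.assoc, ComonadHom.app_δ, X.coassoc_assoc, Functor.map_comp, Category.assoc,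
          ← NatTrans.naturality_assoc] }
  map h :=
    { f := h.f
      h := by
        have := (Hom.comonadHom χ).naturality h.f
        have h' := h.h
        dsimp only
        rw [Category.assoc, ← this, ← Category.assoc, h', Category.assoc] }

/-- An awfs `W` is free on a category `I` over `C²`, via a functor `η` from `I` to the left maps
over `C²`. -/
def IsFreeVia (W : AWFS C) {I : Type w} [Category.{w} I] (P : I ⥤ Arrow C)
    (η : I ⥤ W.LMap) : Prop :=
  η ⋙ W.str.comonad.forget = P ∧
    ∀ (W' : AWFS C) (F : I ⥤ W'.LMap), F ⋙ W'.str.comonad.forget = P →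
      ∃! χ : W ⟶ W', η ⋙ mapLMap χ = F

end AWFS

/-! ### Strata -/

open TopCat

/-- The set `{S^{n-1} ⟶ D^n}` of generating maps, as a discrete category over `Top²`. -/
noncomputable def cellInclusions : Discrete ℕ ⥤ Arrow TopCat.{u} :=
  Discrete.functor fun k => Arrow.mk (diskBoundaryInclusion.{u} k)

/-- A stratum on a space `X`: for each `k` a set of cells of shape `S^{k-1} ⟶ D^k`, each with an
attaching map to `X`. -/
structure Stratum where
  X : TopCat.{u}
  cells : ℕ → Type u
  attach : ∀ k : ℕ, cells k → (diskBoundary.{u} k ⟶ X)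

namespace Stratum

/-- A morphism of strata. -/
@[ext]
structure Hom (P Q : Stratum.{u}) where
  base : P.X ⟶ Q.X
  cells : ∀ k : ℕ, P.cells k → Q.cells k
  attach_comp : ∀ (k : ℕ) (s : P.cells k), P.attach k s ≫ base = Q.attach k (cells k s)

instance : Category Stratum.{u} where
  Hom := Hom
  id P := ⟨𝟙 _, fun _ s => s, fun _ _ => Category.comp_id _⟩
  comp a b := ⟨a.base ≫ b.base, fun k s => b.cells k (a.cells k s), fun k s => by
    rw [← Category.assoc, a.attach_comp, b.attach_comp]⟩
  id_comp a := Hom.ext (Category.id_comp a.base) rfl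
  comp_id a := Hom.ext (Category.comp_id a.base) rfl
  assoc a b c := Hom.ext (Category.assoc a.base b.base c.base) rfl

/-- The body of a stratum: the pushout of the coproduct of its cells along the attaching maps. -/
noncomputable def body (P : Stratum.{u}) : TopCat.{u} :=
  pushout
    (Sigma.desc fun s : (Σ k, P.cells k) => P.attach s.1 s.2)
    (Limits.Sigma.map fun s : (Σ k, P.cells k) => diskBoundaryInclusion.{u} s.1)

/-- The underlying map `X ⟶ body` of a stratum. -/
noncomputable def incl (P : Stratum.{u}) : P.X ⟶ P.body :=
  pushout.inl _ _

/-- The map from the coproduct of the cells to the body. -/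
noncomputable def allChar (P : Stratum.{u}) :
    (∐ fun s : (Σ k, P.cells k) => disk.{u} s.1) ⟶ P.body :=
  pushout.inr _ _

/-- The characteristic map of a cell. -/
noncomputable def char (P : Stratum.{u}) (k : ℕ) (s : P.cells k) : disk.{u} k ⟶ P.body :=
  Sigma.ι (fun s : (Σ k, P.cells k) => disk.{u} s.1) ⟨k, s⟩ ≫ P.allChar

theorem attach_incl (P : Stratum.{u}) (k : ℕ) (s : P.cells k) :
    P.attach k s ≫ P.incl = diskBoundaryInclusion.{u} k ≫ P.char k s := by
  have h := congrArg
    (fun t => Sigma.ι (fun s : (Σ k, P.cells k) => diskBoundary.{u} s.1) ⟨k, s⟩ ≫ t)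
    (pushout.condition
      (f := Sigma.desc fun s : (Σ k, P.cells k) => P.attach s.1 s.2)
      (g := Limits.Sigma.map fun s : (Σ k, P.cells k) => diskBoundaryInclusion.{u} s.1))
  dsimp only at h
  rw [← Category.assoc, ← Category.assoc, Sigma.ι_desc, Limits.Sigma.ι_map,
    Category.assoc] at h
  exact h

/-- The map out of the body determined by maps out of the boundary and out of each cell. -/
noncomputable def desc (P : Stratum.{u}) {Z : TopCat.{u}} (a : P.X ⟶ Z)
    (c : ∀ k : ℕ, P.cells k → (disk.{u} k ⟶ Z))
    (h : ∀ (k : ℕ) (s : P.cells k),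
      P.attach k s ≫ a = diskBoundaryInclusion.{u} k ≫ c k s) :
    P.body ⟶ Z :=
  pushout.desc a (Sigma.desc fun s : (Σ k, P.cells k) => c s.1 s.2) (by
    apply Sigma.hom_ext
    intro s
    rw [← Category.assoc, ← Category.assoc, Sigma.ι_desc, Limits.Sigma.ι_map,
      Category.assoc, Sigma.ι_desc]
    exact h s.1 s.2)

section

variable (P : Stratum.{u}) {Z : TopCat.{u}} (a : P.X ⟶ Z)
    (c : ∀ k : ℕ, P.cells k → (disk.{u} k ⟶ Z))
    (h : ∀ (k : ℕ) (s : P.cells k), P.attach k s ≫ a = diskBoundaryInclusion.{u} k ≫ c k s)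

theorem incl_desc : P.incl ≫ P.desc a c h = a :=
  pushout.inl_desc _ _ _

theorem allChar_desc :
    P.allChar ≫ P.desc a c h = Sigma.desc fun s : (Σ k, P.cells k) => c s.1 s.2 :=
  pushout.inr_desc _ _ _

theorem char_desc (k : ℕ) (s : P.cells k) : P.char k s ≫ P.desc a c h = c k s := by
  unfold char
  rw [Category.assoc, allChar_desc]
  exact Sigma.ι_desc _ _

variable {P} in
theorem body_hom_ext {a b : P.body ⟶ Z} (h₀ : P.incl ≫ a = P.incl ≫ b)
    (h₁ : ∀ (k : ℕ) (s : P.cells k), P.char k s ≫ a = P.char k s ≫ b) : a = b := by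
  refine pushout.hom_ext h₀ (?_ : P.allChar ≫ a = P.allChar ≫ b)
  apply Sigma.hom_ext
  intro s
  have := h₁ s.1 s.2
  unfold char at this
  rwa [Category.assoc, Category.assoc] at this

end

/-- The map of bodies induced by a morphism of strata. -/
noncomputable def bodyMap {P Q : Stratum.{u}} (a : P ⟶ Q) : P.body ⟶ Q.body :=
  P.desc (a.base ≫ Q.incl) (fun k s => Q.char k (a.cells k s)) (fun k s => by
    rw [← Category.assoc, a.attach_comp, Q.attach_incl])

theorem incl_bodyMap {P Q : Stratum.{u}} (a : P ⟶ Q) : P.incl ≫ bodyMap a = a.base ≫ Q.incl :=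
  incl_desc _ _ _ _

theorem char_bodyMap {P Q : Stratum.{u}} (a : P ⟶ Q) (k : ℕ) (s : P.cells k) :
    P.char k s ≫ bodyMap a = Q.char k (a.cells k s) :=
  char_desc _ _ _ _ k s

theorem bodyMap_id (P : Stratum.{u}) : bodyMap (𝟙 P) = 𝟙 P.body := by
  apply body_hom_ext
  · rw [incl_bodyMap, Category.comp_id]; exact Category.id_comp _
  · intro k s
    rw [char_bodyMap, Category.comp_id]; rfl

theorem bodyMap_comp {P Q T : Stratum.{u}} (a : P ⟶ Q) (b : Q ⟶ T) :
    bodyMap (a ≫ b) = bodyMap a ≫ bodyMap b := by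
  apply body_hom_ext
  · rw [incl_bodyMap, ← Category.assoc, incl_bodyMap, Category.assoc, incl_bodyMap]
    exact Category.assoc _ _ _
  · intro k s
    rw [char_bodyMap, ← Category.assoc, char_bodyMap, char_bodyMap]; rfl

theorem isInducing_diskBoundaryInclusion (k : ℕ) :
    Topology.IsInducing (diskBoundaryInclusion.{u} k) := by
  have : T2Space (disk.{u} k) := by
    unfold disk
    exact inferInstanceAs
      (T2Space (ULift.{u} (Metric.closedBall (0 : EuclideanSpace ℝ (Fin k)) 1)))
  exact ((diskBoundaryInclusion.{u} k).hom.continuous.isClosedEmbedding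
    ((TopCat.mono_iff_injective _).mp inferInstance)).isInducing

/-- The boundary of a stratum carries the topology induced from the body. -/
theorem isInducing_incl (P : Stratum.{u}) : Topology.IsInducing P.incl := by
  let S : TopCat.{u} := TopCat.of (ULift.{u} Prop)
  let mkS : ∀ {Y : TopCat.{u}} (t : Y → Prop), Continuous t → (Y ⟶ S) :=
    fun {Y} t ht => TopCat.ofHom ⟨fun y => ULift.up (t y), continuous_uliftUp.comp ht⟩
  have key : ∀ U : Set P.X, IsOpen U → ∃ V : Set P.body, IsOpen V ∧ P.incl ⁻¹' V = U := by
    intro U hU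
    have ext : ∀ (k : ℕ) (s : P.cells k), ∃ W : Set (disk.{u} k), IsOpen W ∧
        diskBoundaryInclusion.{u} k ⁻¹' W = P.attach k s ⁻¹' U := fun k s =>
      (isInducing_diskBoundaryInclusion k).isOpen_iff.mp
        (hU.preimage (P.attach k s).hom.continuous)
    choose W hW hWU using ext
    let m : P.body ⟶ S := P.desc
      (mkS (fun x => x ∈ U) (isOpen_iff_continuous_mem.mp hU))
      (fun k s => mkS (fun d => d ∈ W k s) (isOpen_iff_continuous_mem.mp (hW k s)))
      (fun k s => by
        ext x
        have := congrArg (fun A : Set (diskBoundary.{u} k) => x ∈ A) (hWU k s)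
        exact Iff.of_eq this.symm)
    refine ⟨{y | (m y : ULift Prop).down}, ?_, ?_⟩
    · exact isOpen_iff_continuous_mem.mpr (continuous_uliftDown.comp m.hom.continuous)
    · ext x
      have := congrArg (fun n : P.X ⟶ S => (n x : ULift Prop).down) (P.incl_desc
        (mkS (fun x => x ∈ U) (isOpen_iff_continuous_mem.mp hU)) _ _ : P.incl ≫ m = _)
      exact Iff.of_eq this
  refine ⟨le_antisymm (continuous_iff_le_induced.mp P.incl.hom.continuous) ?_⟩
  intro U hU
  obtain ⟨V, hV, rfl⟩ := key U hU
  exact ⟨V, hV, rfl⟩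

/-- If `b` becomes a map into the boundary after a morphism of strata, then it already is a map
into the boundary. -/
theorem factors_of_bodyMap_factors {P Q : Stratum.{u}} (a : P ⟶ Q) {Z : TopCat.{u}}
    (b : Z ⟶ P.body) (c : Z ⟶ Q.X) (h : b ≫ bodyMap a = c ≫ Q.incl) :
    ∃ c' : Z ⟶ P.X, c' ≫ P.incl = b := by
  -- maps to an indiscrete space
  let I : TopCat.{u} := @TopCat.of (ULift.{u} Prop) ⊤
  let mkI : ∀ {Y : TopCat.{u}} (t : Y → Prop), (Y ⟶ I) :=
    fun {Y} t => @TopCat.ofHom Y (ULift Prop) _ ⊤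
      (@ContinuousMap.mk _ _ _ ⊤ (fun y => ULift.up (t y)) continuous_top)
  have mkI_down : ∀ {Y : TopCat.{u}} (t : Y → Prop) (y : Y), (mkI t y : ULift Prop).down = t y :=
    fun t y => rfl
  have mkI_comp : ∀ {Y Y' : TopCat.{u}} (g : Y' ⟶ Y) (t : Y → Prop),
      g ≫ mkI t = mkI (fun y => t (g y)) := fun g t => rfl
  have mkI_inj : ∀ {Y : TopCat.{u}} {t t' : Y → Prop}, mkI t = mkI t' → ∀ y, t y = t' y :=
    fun {Y t t'} e y => by
      have := congrArg (fun m : Y ⟶ I => (m y : ULift Prop).down) e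
      exact this
  -- every point of a body lies in the boundary or in a cell
  have cover : ∀ (T : Stratum.{u}) (y : T.body),
      (∃ x, T.incl x = y) ∨ ∃ (k : ℕ) (s : T.cells k) (d : disk.{u} k), T.char k s d = y := by
    intro T y
    have e : mkI (fun y : T.body => (∃ x, T.incl x = y) ∨
        ∃ (k : ℕ) (s : T.cells k) (d : disk.{u} k), T.char k s d = y) = mkI (fun _ => True) := by
      apply body_hom_ext
      · rw [mkI_comp, mkI_comp]
        congr 1
        funext x
        exact eq_true (Or.inl ⟨x, rfl⟩)
      · intro k s
        rw [mkI_comp, mkI_comp]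
        congr 1
        funext d
        exact eq_true (Or.inr ⟨k, s, d, rfl⟩)
    exact of_eq_true (mkI_inj e y)
  -- the indicator of the open cells
  let ind : ∀ T : Stratum.{u}, T.body ⟶ I := fun T =>
    T.desc (mkI fun _ => False)
      (fun k _ => mkI fun d => d ∉ Set.range (diskBoundaryInclusion.{u} k)) (fun k s => by
        rw [mkI_comp, mkI_comp]
        congr 1
        funext x
        exact (eq_false (not_not_intro ⟨x, rfl⟩)).symm)
  have ind_nat : bodyMap a ≫ ind Q = ind P := by
    apply body_hom_ext
    · rw [← Category.assoc, incl_bodyMap, Category.assoc, incl_desc, incl_desc, mkI_comp]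
    · intro k s
      rw [← Category.assoc, char_bodyMap, char_desc, char_desc]
  have hb : b ≫ ind P = mkI fun _ => False := by
    rw [← ind_nat, ← Category.assoc, h, Category.assoc, incl_desc, mkI_comp]
  have hr : ∀ z, ∃ x, P.incl x = b z := by
    intro z
    rcases cover P (b z) with hx | ⟨k, s, d, hd⟩
    · exact hx
    · have h₁ : (ind P (b z) : ULift Prop).down = False :=
        congrArg (fun m : Z ⟶ I => (m z : ULift Prop).down) hb
      have h₂ : (ind P (P.char k s d) : ULift Prop).down =
          (d ∉ Set.range (diskBoundaryInclusion.{u} k)) :=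
        congrArg (fun m : disk.{u} k ⟶ I => (m d : ULift Prop).down) (char_desc P _ _ _ k s)
      rw [hd, h₁] at h₂
      obtain ⟨d', rfl⟩ := not_not.mp (of_eq_false h₂.symm)
      refine ⟨P.attach k s d', ?_⟩
      rw [← hd]
      exact congrArg (fun m : diskBoundary.{u} k ⟶ P.body => m d') (P.attach_incl k s)
  choose c' hc' using hr
  have hcont : Continuous c' := by
    rw [P.isInducing_incl.continuous_iff]
    have : (P.incl ∘ c' : Z → P.body) = b := funext hc'
    rw [this]
    exact b.hom.continuous
  exact ⟨TopCat.ofHom ⟨c', hcont⟩, by ext z; exact hc' z⟩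

end Stratum

/-! ### Cell complexes -/

/-- A relative cell complex: a sequence of strata which is connected (the boundary of each stratum
is identified with the body of the previous one) and proper (no attaching map of a cell factors
through the boundary of a lower stratum; it is enough to exclude the previous stratum). -/
structure CellCx where
  stratum : ℕ → Stratum.{u}
  link : ∀ n : ℕ, (stratum n).body ≅ (stratum (n + 1)).X
  proper : ∀ (n k : ℕ) (s : (stratum (n + 1)).cells k),
    ¬ ∃ c : diskBoundary.{u} k ⟶ (stratum n).X,
      c ≫ (stratum n).incl ≫ (link n).hom = (stratum (n + 1)).attach k s

namespace CellCx

/-- A morphism of cell complexes: a coherent sequence of morphisms of strata. -/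
@[ext]
structure Hom (A B : CellCx.{u}) where
  strat : ∀ n : ℕ, A.stratum n ⟶ B.stratum n
  coherent : ∀ n : ℕ, (A.link n).hom ≫ (strat (n + 1)).base =
    Stratum.bodyMap (strat n) ≫ (B.link n).hom

instance : Category CellCx.{u} where
  Hom := Hom
  id A := ⟨fun n => 𝟙 (A.stratum n), fun n => by
    rw [Stratum.bodyMap_id, Category.id_comp]; exact Category.comp_id _⟩
  comp a b := ⟨fun n => a.strat n ≫ b.strat n, fun n => by
    rw [Stratum.bodyMap_comp, Category.assoc, ← b.coherent, ← Category.assoc, ← a.coherent,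
      Category.assoc]
    rfl⟩
  id_comp a := Hom.ext (funext fun n => Category.id_comp (a.strat n))
  comp_id a := Hom.ext (funext fun n => Category.comp_id (a.strat n))
  assoc a b c := Hom.ext (funext fun n => Category.assoc (a.strat n) (b.strat n) (c.strat n))

/-- The base space of a cell complex. -/
abbrev base (A : CellCx.{u}) : TopCat.{u} := (A.stratum 0).X

/-- The map `X_n ⟶ X_{n+1}`. -/
noncomputable def step (A : CellCx.{u}) (n : ℕ) : (A.stratum n).X ⟶ (A.stratum (n + 1)).X :=
  (A.stratum n).incl ≫ (A.link n).hom

/-- The sequence `X_0 ⟶ X_1 ⟶ X_2 ⟶ ⋯`. -/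
noncomputable def sequence (A : CellCx.{u}) : ℕ ⥤ TopCat.{u} :=
  Functor.ofSequence (X := fun n => (A.stratum n).X) A.step

/-- The body of a cell complex: the colimit of the spaces `X_n`. -/
noncomputable def body (A : CellCx.{u}) : TopCat.{u} := colimit A.sequence

/-- The map from `X_n` to the body. -/
noncomputable def toBody (A : CellCx.{u}) (n : ℕ) : (A.stratum n).X ⟶ A.body :=
  colimit.ι A.sequence n

theorem step_toBody (A : CellCx.{u}) (n : ℕ) : A.step n ≫ A.toBody (n + 1) = A.toBody n := by
  have h := colimit.w A.sequence (homOfLE (Nat.le_add_right n 1))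
  rwa [show A.sequence.map (homOfLE (Nat.le_add_right n 1)) = A.step n from
    Functor.ofSequence_map_homOfLE_succ (X := fun n => (A.stratum n).X) A.step n] at h

/-- The map out of the body determined by compatible maps out of the `X_n`. -/
noncomputable def desc (A : CellCx.{u}) {Z : TopCat.{u}} (h : ∀ n, (A.stratum n).X ⟶ Z)
    (w : ∀ n, A.step n ≫ h (n + 1) = h n) : A.body ⟶ Z :=
  colimit.desc A.sequence
    { pt := Z
      ι := NatTrans.ofSequence (G := (Functor.const ℕ).obj Z) h (fun n => by
        rw [show A.sequence.map (homOfLE (Nat.le_add_right n 1)) = A.step n from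
          Functor.ofSequence_map_homOfLE_succ (X := fun n => (A.stratum n).X) A.step n]
        exact (w n).trans (Category.comp_id _).symm) }

theorem toBody_desc (A : CellCx.{u}) {Z : TopCat.{u}} (h : ∀ n, (A.stratum n).X ⟶ Z)
    (w : ∀ n, A.step n ≫ h (n + 1) = h n) (n : ℕ) : A.toBody n ≫ A.desc h w = h n :=
  colimit.ι_desc _ n

theorem body_hom_ext {A : CellCx.{u}} {Z : TopCat.{u}} {a b : A.body ⟶ Z}
    (h : ∀ n, A.toBody n ≫ a = A.toBody n ≫ b) : a = b :=
  colimit.hom_ext h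

theorem step_comp_base {A B : CellCx.{u}} (φ : A ⟶ B) (n : ℕ) :
    A.step n ≫ (φ.strat (n + 1)).base = (φ.strat n).base ≫ B.step n := by
  unfold step
  rw [Category.assoc, φ.coherent, ← Category.assoc, Stratum.incl_bodyMap, Category.assoc]

/-- The map of bodies induced by a morphism of cell complexes. -/
noncomputable def bodyMap {A B : CellCx.{u}} (φ : A ⟶ B) : A.body ⟶ B.body :=
  A.desc (fun n => (φ.strat n).base ≫ B.toBody n) (fun n => by
    rw [← Category.assoc, step_comp_base, Category.assoc, step_toBody])

theorem toBody_bodyMap {A B : CellCx.{u}} (φ : A ⟶ B) (n : ℕ) :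
    A.toBody n ≫ bodyMap φ = (φ.strat n).base ≫ B.toBody n :=
  toBody_desc _ _ _ n

/-- The underlying map of a cell complex: the transfinite composite of its strata. -/
noncomputable def map (A : CellCx.{u}) : A.base ⟶ A.body := A.toBody 0

/-- The forgetful functor from cell complexes to `Top²`. -/
noncomputable def U : CellCx.{u} ⥤ Arrow TopCat.{u} where
  obj A := Arrow.mk A.map
  map φ := Arrow.homMk (φ.strat 0).base (bodyMap φ) (toBody_bodyMap φ 0).symm
  map_id A := by
    apply Arrow.hom_ext
    · rfl
    · apply body_hom_ext
      intro n
      exact (toBody_bodyMap (𝟙 A) n).trans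
        ((Category.id_comp _).trans (Category.comp_id _).symm)
  map_comp {A B D} φ ψ := by
    apply Arrow.hom_ext
    · rfl
    · refine body_hom_ext (A := A) (Z := D.body) (a := bodyMap (φ ≫ ψ))
        (b := bodyMap φ ≫ bodyMap ψ) fun n => ?_
      rw [toBody_bodyMap, ← Category.assoc, toBody_bodyMap, Category.assoc, toBody_bodyMap]
      exact Category.assoc _ _ _

/-- The cells of dimension `k` of a cell complex, in all strata. -/
def Cell (A : CellCx.{u}) (k : ℕ) : Type u := Σ n : ℕ, (A.stratum n).cells k

/-- The characteristic map of a cell, as a map to the body of the cell complex. -/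
noncomputable def char (A : CellCx.{u}) {k : ℕ} (s : A.Cell k) : disk.{u} k ⟶ A.body :=
  (A.stratum s.1).char k s.2 ≫ (A.link s.1).hom ≫ A.toBody (s.1 + 1)

/-! ### The right adjoint `K` -/

/-- A space over `B`, with a condition on attaching maps: one stage in the construction of the
free cell complex. -/
structure FreeStage (B : TopCat.{u}) where
  X : TopCat.{u}
  e : X ⟶ B
  ok : ∀ k : ℕ, (diskBoundary.{u} k ⟶ X) → Prop

namespace FreeStage

variable {B : TopCat.{u}}

/-- One cell for each commutative square from a generating map to `e` whose attaching map
satisfies the condition. -/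
noncomputable abbrev stratum (T : FreeStage B) : Stratum.{u} where
  X := T.X
  cells k := {s : Arrow.mk (diskBoundaryInclusion.{u} k) ⟶ Arrow.mk T.e // T.ok k s.left}
  attach _ s := s.1.left

/-- The map from the body to `B`. -/
noncomputable def ext (T : FreeStage B) : T.stratum.body ⟶ B :=
  T.stratum.desc T.e (fun _ s => s.1.right) (fun _ s => s.1.w)

theorem incl_ext (T : FreeStage B) : T.stratum.incl ≫ T.ext = T.e :=
  Stratum.incl_desc _ _ _ _

theorem char_ext (T : FreeStage B) (k : ℕ) (s : T.stratum.cells k) :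
    T.stratum.char k s ≫ T.ext = s.1.right :=
  Stratum.char_desc T.stratum _ _ _ k s

/-- The next stage: only attaching maps that do not factor through the previous space are
allowed. -/
noncomputable abbrev next (T : FreeStage B) : FreeStage B where
  X := T.stratum.body
  e := T.ext
  ok k b := ¬ ∃ c : diskBoundary.{u} k ⟶ T.X, c ≫ T.stratum.incl = b

end FreeStage

/-- The stages of the free cell complex on `f`, starting from `f` itself, where all attaching maps
are allowed. -/
noncomputable def freeStage (f : Arrow TopCat.{u}) : ℕ → FreeStage f.right
  | 0 => ⟨f.left, f.hom, fun _ _ => True⟩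
  | n + 1 => (freeStage f n).next

/-- The free cell complex on `f`. -/
noncomputable abbrev free (f : Arrow TopCat.{u}) : CellCx.{u} where
  stratum n := (freeStage f n).stratum
  link _ := Iso.refl _
  proper n k s h := s.2 (by
    obtain ⟨c, hc⟩ := h
    exact ⟨c, (Category.comp_id _).symm.trans ((Category.assoc _ _ _).trans hc)⟩)

theorem free_step_e (f : Arrow TopCat.{u}) (n : ℕ) :
    (free f).step n ≫ (freeStage f (n + 1)).e = (freeStage f n).e := by
  have h : (free f).step n = (freeStage f n).stratum.incl := Category.comp_id _
  rw [h]
  exact Stratum.incl_desc _ _ _ _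

/-- The map `Ef` from the body of the free cell complex on `f : A ⟶ B` to `B`. -/
noncomputable def E (f : Arrow TopCat.{u}) : (free f).body ⟶ f.right :=
  (free f).desc (fun n => (freeStage f n).e) (free_step_e f)

theorem toBody_E (f : Arrow TopCat.{u}) (n : ℕ) :
    (free f).toBody n ≫ E f = (freeStage f n).e :=
  toBody_desc (free f) (fun n => (freeStage f n).e) (free_step_e f) n

/-- The morphism `(1, Ef) : U(Kf) ⟶ f`. -/
noncomputable def freeCounit (f : Arrow TopCat.{u}) : U.obj (free f) ⟶ f :=
  Arrow.homMk (𝟙 f.left) (E f) ((Category.id_comp f.hom).trans (toBody_E f 0).symm)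

theorem map_freeCounit_left {A : CellCx.{u}} {f : Arrow TopCat.{u}} (φ : A ⟶ free f) :
    (U.map φ ≫ freeCounit f).left = (φ.strat 0).base :=
  (Arrow.comp_left (U.map φ) (freeCounit f)).trans (Category.comp_id (φ.strat 0).base)

theorem map_freeCounit_right {A : CellCx.{u}} {f : Arrow TopCat.{u}} (φ : A ⟶ free f) :
    (U.map φ ≫ freeCounit f).right = bodyMap φ ≫ E f :=
  Arrow.comp_right (U.map φ) (freeCounit f)

theorem toBody_bodyMap_E {A : CellCx.{u}} {f : Arrow TopCat.{u}} (φ : A ⟶ free f) (n : ℕ) :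
    A.toBody n ≫ bodyMap φ ≫ E f = (φ.strat n).base ≫ (freeStage f n).e := by
  rw [← Category.assoc, toBody_bodyMap, Category.assoc, toBody_E]

theorem cells_right {A : CellCx.{u}} {f : Arrow TopCat.{u}} (φ : A ⟶ free f) (n k : ℕ)
    (s : (A.stratum n).cells k) :
    (show (freeStage f n).stratum.cells k from (φ.strat n).cells k s).1.right =
      (A.stratum n).char k s ≫ (A.link n).hom ≫ A.toBody (n + 1) ≫ bodyMap φ ≫ E f := by
  have e₁ : (A.link n).hom ≫ (φ.strat (n + 1)).base = Stratum.bodyMap (φ.strat n) :=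
    (φ.coherent n).trans (Category.comp_id _)
  have e₂ : (A.link n).hom ≫ A.toBody (n + 1) ≫ bodyMap φ ≫ E f =
      Stratum.bodyMap (φ.strat n) ≫ (freeStage f n).ext :=
    (congrArg ((A.link n).hom ≫ ·) (toBody_bodyMap_E φ (n + 1))).trans
      ((Category.assoc _ _ _).symm.trans (congrArg (· ≫ (freeStage f n).ext) e₁))
  rw [e₂, ← Category.assoc, Stratum.char_bodyMap]
  exact ((freeStage f n).char_ext k _).symm

theorem freeCounit_injective (A : CellCx.{u}) (f : Arrow TopCat.{u}) :
    Function.Injective fun φ : A ⟶ free f => U.map φ ≫ freeCounit f := by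
  intro φ ψ h
  have hl : (φ.strat 0).base = (ψ.strat 0).base :=
    (map_freeCounit_left φ).symm.trans
      ((congrArg Arrow.Hom.left h).trans (map_freeCounit_left ψ))
  have hr : bodyMap φ ≫ E f = bodyMap ψ ≫ E f :=
    (map_freeCounit_right φ).symm.trans
      ((congrArg Arrow.Hom.right h).trans (map_freeCounit_right ψ))
  have hbase : ∀ n, (φ.strat n).base = (ψ.strat n).base → φ.strat n = ψ.strat n := by
    intro n hn
    refine Stratum.Hom.ext hn (funext fun k => funext fun s => ?_)
    apply Subtype.ext
    apply Arrow.hom_ext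
    · have h₁ := (φ.strat n).attach_comp k s
      have h₂ := (ψ.strat n).attach_comp k s
      rw [hn] at h₁
      exact h₁.symm.trans h₂
    · refine (cells_right φ n k s).trans (Eq.trans ?_ (cells_right ψ n k s).symm)
      rw [hr]
  have hall : ∀ n, φ.strat n = ψ.strat n := by
    intro n
    induction n with
    | zero => exact hbase 0 hl
    | succ n ih =>
      apply hbase
      rw [← cancel_epi (A.link n).hom, φ.coherent, ψ.coherent, ih]
  exact Hom.ext (funext hall)

/-- A map from `X_n` to a stage of the free cell complex over the given map, for which the images
of the cells are allowed. -/
structure LiftStage (A : CellCx.{u}) {f : Arrow TopCat.{u}} (h : A.body ⟶ f.right) (n : ℕ) where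
  g : (A.stratum n).X ⟶ (freeStage f n).X
  w : g ≫ (freeStage f n).e = A.toBody n ≫ h
  ok : ∀ (k : ℕ) (s : (A.stratum n).cells k), (freeStage f n).ok k ((A.stratum n).attach k s ≫ g)

namespace LiftStage

variable {A : CellCx.{u}} {f : Arrow TopCat.{u}} {h : A.body ⟶ f.right} {n : ℕ}

theorem incl_link (A : CellCx.{u}) {Z : TopCat.{u}} (h : A.body ⟶ Z) (n : ℕ) :
    (A.stratum n).incl ≫ (A.link n).hom ≫ A.toBody (n + 1) ≫ h = A.toBody n ≫ h := by
  rw [← A.step_toBody n, step, Category.assoc, Category.assoc]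

noncomputable def strat (T : LiftStage A h n) : A.stratum n ⟶ (freeStage f n).stratum :=
  Stratum.Hom.mk (Q := (freeStage f n).stratum) T.g
    (fun k s => ⟨Arrow.homMk ((A.stratum n).attach k s ≫ T.g)
      ((A.stratum n).char k s ≫ (A.link n).hom ≫ A.toBody (n + 1) ≫ h) (by
        change ((A.stratum n).attach k s ≫ T.g) ≫ (freeStage f n).e =
          diskBoundaryInclusion k ≫ (A.stratum n).char k s ≫ (A.link n).hom ≫
            A.toBody (n + 1) ≫ h
        rw [Category.assoc, T.w, ← incl_link, ← Category.assoc (diskBoundaryInclusion k),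
          ← Stratum.attach_incl, Category.assoc]), T.ok k s⟩)
    (fun _ _ => rfl)

theorem bodyMap_strat (T : LiftStage A h n) :
    Stratum.bodyMap T.strat ≫ (freeStage f n).ext = (A.link n).hom ≫ A.toBody (n + 1) ≫ h := by
  apply Stratum.body_hom_ext
  · rw [← Category.assoc, Stratum.incl_bodyMap, Category.assoc, FreeStage.incl_ext, incl_link]
    exact T.w
  · intro k s
    rw [← Category.assoc, Stratum.char_bodyMap, FreeStage.char_ext]
    rfl

noncomputable def next (T : LiftStage A h n) : LiftStage A h (n + 1) where
  g := (A.link n).inv ≫ Stratum.bodyMap T.strat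
  w := (Category.assoc _ _ _).trans ((Iso.inv_comp_eq _).mpr T.bodyMap_strat)
  ok k s := by
    rintro ⟨c, hc⟩
    obtain ⟨c', hc'⟩ := Stratum.factors_of_bodyMap_factors T.strat
      ((A.stratum (n + 1)).attach k s ≫ (A.link n).inv) c
      ((Category.assoc _ _ _).trans hc.symm)
    exact A.proper n k s ⟨c', by
      rw [← Category.assoc, hc', Category.assoc, Iso.inv_hom_id, Category.comp_id]⟩

end LiftStage

noncomputable def liftStage (A : CellCx.{u}) {f : Arrow TopCat.{u}} (h : U.obj A ⟶ f) :
    ∀ n, LiftStage A (f := f) h.right n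
  | 0 => ⟨h.left, h.w, fun _ _ => trivial⟩
  | n + 1 => (liftStage A h n).next

noncomputable def lift (A : CellCx.{u}) {f : Arrow TopCat.{u}} (h : U.obj A ⟶ f) :
    A ⟶ free f :=
  Hom.mk (B := free f) (fun n => (liftStage A h n).strat) (fun n =>
    (Iso.hom_inv_id_assoc (A.link n) (Stratum.bodyMap (liftStage A h n).strat)).trans
      (Category.comp_id (Stratum.bodyMap (liftStage A h n).strat)).symm)

theorem freeCounit_surjective (A : CellCx.{u}) (f : Arrow TopCat.{u}) :
    Function.Surjective fun φ : A ⟶ free f => U.map φ ≫ freeCounit f := by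
  intro h
  refine ⟨lift A h, ?_⟩
  apply Arrow.hom_ext
  · exact map_freeCounit_left (lift A h)
  · refine (map_freeCounit_right (lift A h)).trans (body_hom_ext (A := A) fun n => ?_)
    exact (toBody_bodyMap_E (lift A h) n).trans (liftStage A h n).w

/-- The bijection between maps `UA ⟶ f` and morphisms of cell complexes `A ⟶ Kf`. -/
noncomputable def freeEquiv (A : CellCx.{u}) (f : Arrow TopCat.{u}) :
    (U.obj A ⟶ f) ≃ (A ⟶ free f) :=
  (Equiv.ofBijective _ ⟨freeCounit_injective A f, freeCounit_surjective A f⟩).symm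

theorem freeEquiv_naturality (A' A : CellCx.{u}) (f : Arrow TopCat.{u}) (φ : A' ⟶ A)
    (h : U.obj A ⟶ f) : freeEquiv A' f (U.map φ ≫ h) = φ ≫ freeEquiv A f h := by
  rw [← Equiv.eq_symm_apply]
  have e : U.map (freeEquiv A f h) ≫ freeCounit f = h := (freeEquiv A f).symm_apply_apply h
  have e' : (freeEquiv A' f).symm (φ ≫ freeEquiv A f h) =
      U.map (φ ≫ freeEquiv A f h) ≫ freeCounit f := rfl
  rw [e', U.map_comp, Category.assoc, e]

/-- The functor `K`, sending `f` to the free cell complex on `f`. -/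
noncomputable def K : Arrow TopCat.{u} ⥤ CellCx.{u} :=
  Adjunction.rightAdjointOfEquiv freeEquiv freeEquiv_naturality

/-- The adjunction between `U` and `K`, with counit `(1, Ef)`. -/
noncomputable def adj : U.{u} ⊣ K.{u} :=
  Adjunction.adjunctionOfEquivRight freeEquiv freeEquiv_naturality

theorem map_K_freeCounit {f g : Arrow TopCat.{u}} (φ : f ⟶ g) :
    U.map (K.map φ) ≫ freeCounit g = freeCounit f ≫ φ := by
  have e : (freeEquiv (free f) f).symm (𝟙 (free f)) = freeCounit f := by
    change U.map (𝟙 (free f)) ≫ freeCounit f = freeCounit f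
    rw [U.map_id, Category.id_comp]
  have h : (freeEquiv (free f) g).symm (K.map φ) =
      (freeEquiv (free f) f).symm (𝟙 (free f)) ≫ φ :=
    (freeEquiv (free f) g).symm_apply_apply _
  rw [e] at h
  exact h

/-- The functorial factorisation of `f` as `Ef ∘ UKf`. -/
noncomputable def factorization : FunctorialFactorization TopCat.{u} where
  M :=
    { obj := fun f => (free f).body
      map := fun φ => bodyMap (K.map φ)
      map_id := fun f => by
        have h := congrArg Arrow.Hom.right ((K ⋙ U).map_id f)
        exact h
      map_comp := fun φ ψ => by
        have h := congrArg Arrow.Hom.right ((K ⋙ U).map_comp φ ψ)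
        exact h }
  L f := (free f).map
  R f := E f
  L_naturality {f g} φ := by
    have h := congrArg Arrow.Hom.left (map_K_freeCounit φ)
    have h' : ((K.map φ).strat 0).base = φ.left :=
      (map_freeCounit_left (K.map φ)).symm.trans (h.trans (Category.id_comp φ.left))
    exact (congrArg (· ≫ (free g).map) h'.symm).trans (toBody_bodyMap (K.map φ) 0).symm
  R_naturality {f g} φ :=
    (map_freeCounit_right (K.map φ)).symm.trans
      (congrArg Arrow.Hom.right (map_K_freeCounit φ))
  fac f := toBody_E f 0

/-! ### Composition of cell complexes and the awfs `(UK, E)` -/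

/-- A composite `B * A` of cell complexes, where the body of `A` is identified with the base space
of `B` by `e`: a cell complex over the composite of the underlying maps, whose cells are the cells
of `A` and the cells of `B`, with the same characteristic maps. Since a cell of a cell complex lies
in the lowest stratum into which it can be attached, this determines the cell complex up to unique
isomorphism: each cell of `B` is moved down to the lowest possible stratum. -/
structure Composite (A B : CellCx.{u}) (e : A.body ≅ B.base) where
  cx : CellCx.{u}
  baseIso : cx.base ≅ A.base
  bodyIso : cx.body ≅ B.body
  w : cx.map ≫ bodyIso.hom = baseIso.hom ≫ A.map ≫ e.hom ≫ B.map
  cells : ∀ k : ℕ, A.Cell k ⊕ B.Cell k ≃ cx.Cell k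
  char_inl : ∀ (k : ℕ) (s : A.Cell k),
    cx.char (cells k (Sum.inl s)) ≫ bodyIso.hom = A.char s ≫ e.hom ≫ B.map
  char_inr : ∀ (k : ℕ) (t : B.Cell k),
    cx.char (cells k (Sum.inr t)) ≫ bodyIso.hom = B.char t

/-- The base space of `KEf` is the body of `Kf`. -/
noncomputable def baseEIso (f : Arrow TopCat.{u}) : (free f).body ≅ (free (Arrow.mk (E f))).base :=
  Iso.refl (free f).body

theorem comp_EE {f : Arrow TopCat.{u}}
    (c : Composite (free f) (free (Arrow.mk (E f))) (baseEIso f)) :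
    c.baseIso.hom ≫ f.hom = c.cx.map ≫ c.bodyIso.hom ≫ E (Arrow.mk (E f)) := by
  have h₁ : (free f).map ≫ E f = f.hom := toBody_E f 0
  have h₂ : (baseEIso f).hom ≫ (free (Arrow.mk (E f))).map ≫ E (Arrow.mk (E f)) = E f :=
    (Category.id_comp _).trans (toBody_E (Arrow.mk (E f)) 0)
  rw [← Category.assoc c.cx.map, c.w, ← h₁]
  simp only [Category.assoc]
  exact congrArg (fun t => c.baseIso.hom ≫ (free f).map ≫ t) h₂.symm

/-- For a composite `C` of `Kf` and `KEf`, the body of the morphism of cell complexes `C ⟶ Kf` that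
corresponds under the adjunction to `(1, EEf) : UC ⟶ f`. -/
noncomputable def Composite.mul {f : Arrow TopCat.{u}}
    (c : Composite (free f) (free (Arrow.mk (E f))) (baseEIso f)) :
    (free (Arrow.mk (E f))).body ⟶ (free f).body :=
  c.bodyIso.inv ≫ bodyMap ((adj.homEquiv c.cx f)
    (Arrow.homMk c.baseIso.hom (c.bodyIso.hom ≫ E (Arrow.mk (E f))) (comp_EE c)))

/-- The awfs structure of `(UK, E)`: the comultiplication is the one of the comonad of the
adjunction, and the multiplication is `Composite.mul` for the composite of `Kf` and `KEf`. -/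
structure IsCellStructure (A : AWFSStructure factorization.{u}) : Prop where
  comul : ∀ f, A.δMap f = (adj.toComonad.δ.app f).right
  mul : ∀ f, ∃ c : Composite (free f) (free (Arrow.mk (E f))) (baseEIso f), A.μMap f = c.mul

/-- The structure map of the generating map `S^{k-1} ⟶ D^k` as a left map: the characteristic map
of the cell given by the identity square. -/
noncomputable def genStructure (k : ℕ) :
    Arrow.mk (diskBoundaryInclusion.{u} k) ⟶
      factorization.left.obj (Arrow.mk (diskBoundaryInclusion.{u} k)) :=
  Arrow.homMk (𝟙 _)
    ((free (Arrow.mk (diskBoundaryInclusion.{u} k))).char (k := k) ⟨0, ⟨𝟙 _, trivial⟩⟩) (by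
      let f := Arrow.mk (diskBoundaryInclusion.{u} k)
      let s : ((free f).stratum 0).cells k := ⟨𝟙 f, trivial⟩
      have h : ((free f).stratum 0).attach k s ≫ (free f).step 0 =
          diskBoundaryInclusion k ≫ ((free f).stratum 0).char k s ≫ ((free f).link 0).hom := by
        rw [step, ← Category.assoc, Stratum.attach_incl, Category.assoc]
      change 𝟙 _ ≫ (free f).toBody 0 =
        diskBoundaryInclusion k ≫ ((free f).stratum 0).char k s ≫ ((free f).link 0).hom ≫
          (free f).toBody 1
      have h' := congrArg (· ≫ (free f).toBody 1) h
      simp only [Category.assoc] at h'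
      rw [← h', step_toBody]
      rfl)

end CellCx

/-! ### The small object argument of Garner -/

namespace FunctorialFactorization

variable {C : Type u} [Category.{v} C]

/-- The right parts, as a natural transformation. -/
def trans (F : FunctorialFactorization C) : F.M ⟶ Arrow.rightFunc where
  app := F.R
  naturality _ _ φ := F.R_naturality φ

/-- The trivial factorisation `f = f ∘ 1`. -/
def trivial (C : Type u) [Category.{v} C] : FunctorialFactorization C where
  M := Arrow.leftFunc
  L f := 𝟙 f.left
  R f := f.hom
  L_naturality _ := (Category.comp_id _).trans (Category.id_comp _).symm
  R_naturality φ := φ.w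
  fac _ := Category.id_comp _

/-- The composite `F ⊙ G`: factorise `f` by `G`, and then `R_G f` by `F`. -/
def comp (F G : FunctorialFactorization C) : FunctorialFactorization C where
  M := G.right ⋙ F.M
  L f := G.L f ≫ F.L (Arrow.mk (G.R f))
  R f := F.R (Arrow.mk (G.R f))
  L_naturality {f g} φ :=
    (Category.assoc _ _ _).symm.trans
      ((congrArg (· ≫ F.L (Arrow.mk (G.R g))) (G.L_naturality φ)).trans
        ((Category.assoc _ _ _).trans
          ((congrArg (G.L f ≫ ·) (F.L_naturality (G.right.map φ))).trans
            (Category.assoc _ _ _).symm)))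
  R_naturality φ := F.R_naturality (G.right.map φ)
  fac f := (Category.assoc _ _ _).trans
    ((congrArg (G.L f ≫ ·) (F.fac (Arrow.mk (G.R f)))).trans (G.fac f))

/-- The canonical morphism `G ⟶ F ⊙ G`. -/
def point (F G : FunctorialFactorization C) : Hom G (F.comp G) where
  χ :=
    { app := fun f => F.L (Arrow.mk (G.R f))
      naturality := fun _ _ φ => F.L_naturality (G.right.map φ) }
  left_comp _ := rfl
  comp_right f := F.fac (Arrow.mk (G.R f))

/-- The morphism `F ⊙ G ⟶ F ⊙ H` induced by `G ⟶ H`. -/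
def compMap (F : FunctorialFactorization C) {G H : FunctorialFactorization C} (a : Hom G H) :
    Hom (F.comp G) (F.comp H) where
  χ := Functor.whiskerRight a.rightTrans F.M
  left_comp f :=
    (Category.assoc _ _ _).trans
      ((congrArg (G.L f ≫ ·) (F.L_naturality (a.rightTrans.app f)).symm).trans
        ((Category.assoc _ _ _).symm.trans
          (congrArg (· ≫ F.L (Arrow.mk (H.R f))) (a.left_comp f))))
  comp_right f :=
    (F.R_naturality (a.rightTrans.app f)).trans (Category.comp_id _)

section

variable [HasCoequalizers C]

/-- The coequaliser of two morphisms of functorial factorisations, formed on the central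
functors. -/
noncomputable def coeq {F G : FunctorialFactorization C} (a b : Hom F G) :
    FunctorialFactorization C where
  M := coequalizer a.χ b.χ
  L f := G.L f ≫ (coequalizer.π a.χ b.χ).app f
  R f := (coequalizer.desc (f := a.χ) (g := b.χ) G.trans (by
      ext f
      exact (a.comp_right f).trans (b.comp_right f).symm)).app f
  L_naturality {f g} φ := by
    rw [← Category.assoc, G.L_naturality, Category.assoc, Category.assoc, NatTrans.naturality]
  R_naturality φ := NatTrans.naturality _ φ
  fac f := (Category.assoc _ _ _).trans
    ((congrArg (G.L f ≫ ·) (NatTrans.congr_app (coequalizer.π_desc _ _) f)).trans (G.fac f))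

/-- The projection to the coequaliser. -/
noncomputable def coeqProj {F G : FunctorialFactorization C} (a b : Hom F G) :
    Hom G (coeq a b) where
  χ := coequalizer.π a.χ b.χ
  left_comp _ := rfl
  comp_right f := NatTrans.congr_app (coequalizer.π_desc _ _) f

/-- Two consecutive terms `X ⟶ Y` of the free monoid sequence of the pointed object `T`, with the
action `T ⊙ X ⟶ Y`. -/
structure MonoidStage (T : FunctorialFactorization C) where
  X : FunctorialFactorization C
  Y : FunctorialFactorization C
  x : Hom X Y
  σ : Hom (T.comp X) Y

/-- The free monoid sequence: it starts with `1 ⟶ T`, and the term after `X ⟶ Y` is the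
coequaliser of the two maps `T ⊙ X ⟶ T ⊙ Y` given by `T ⊙ x` and by `T ⊙ X ⟶ Y ⟶ T ⊙ Y`. -/
noncomputable def monoidStage (T : FunctorialFactorization C) : ℕ → MonoidStage T
  | 0 =>
    { X := trivial C
      Y := T
      x :=
        { χ := { app := T.L, naturality := fun _ _ φ => T.L_naturality φ }
          left_comp := fun _ => Category.id_comp _
          comp_right := T.fac }
      σ :=
        { χ := { app := fun f => 𝟙 (T.M.obj f)
                 naturality := fun _ _ _ => (Category.comp_id _).trans (Category.id_comp _).symm }
          left_comp := fun _ => (Category.comp_id _).trans (Category.id_comp _)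
          comp_right := fun _ => Category.id_comp _ } }
  | n + 1 =>
    let S := monoidStage T n
    { X := S.Y
      Y := coeq (T.compMap S.x) (S.σ.comp (T.point S.Y))
      x := (T.point S.Y).comp (coeqProj (T.compMap S.x) (S.σ.comp (T.point S.Y)))
      σ := coeqProj (T.compMap S.x) (S.σ.comp (T.point S.Y)) }

/-- The `n`-th term of the free monoid sequence. -/
noncomputable abbrev term (T : FunctorialFactorization C) (n : ℕ) : FunctorialFactorization C :=
  (monoidStage T n).X

/-- The connecting map of the free monoid sequence. -/
noncomputable def termMap (T : FunctorialFactorization C) (n : ℕ) :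
    Hom (T.term n) (T.term (n + 1)) :=
  (monoidStage T n).x

/-- The action `T ⊙ X_n ⟶ X_{n+1}`. -/
noncomputable def termAct (T : FunctorialFactorization C) (n : ℕ) :
    Hom (T.comp (T.term n)) (T.term (n + 1)) :=
  (monoidStage T n).σ

/-- The sequence of the central functors. -/
noncomputable def termSeq (T : FunctorialFactorization C) : ℕ ⥤ Arrow C ⥤ C :=
  Functor.ofSequence (X := fun n => (T.term n).M) fun n => (T.termMap n).χ

theorem termSeq_map (T : FunctorialFactorization C) (n : ℕ) :
    T.termSeq.map (homOfLE (Nat.le_add_right n 1)) = (T.termMap n).χ :=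
  Functor.ofSequence_map_homOfLE_succ (X := fun n => (T.term n).M) (fun n => (T.termMap n).χ) n

variable [HasColimitsOfShape ℕ C]

/-- The map from a term to the colimit. -/
noncomputable def toColim (T : FunctorialFactorization C) (n : ℕ) :
    (T.term n).M ⟶ colimit T.termSeq :=
  colimit.ι T.termSeq n

theorem termMap_toColim (T : FunctorialFactorization C) (n : ℕ) :
    (T.termMap n).χ ≫ T.toColim (n + 1) = T.toColim n :=
  (congrArg (· ≫ T.toColim (n + 1)) (T.termSeq_map n).symm).trans
    (colimit.w T.termSeq (homOfLE (Nat.le_add_right n 1)))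

/-- The right part of the colimit. -/
noncomputable def colimTrans (T : FunctorialFactorization C) :
    colimit T.termSeq ⟶ Arrow.rightFunc :=
  colimit.desc T.termSeq
    { pt := Arrow.rightFunc
      ι := NatTrans.ofSequence (G := (Functor.const ℕ).obj Arrow.rightFunc)
        (fun n => (T.term n).trans) (fun n => by
          rw [termSeq_map]
          refine Eq.trans ?_ (Category.comp_id _).symm
          ext f
          exact (T.termMap n).comp_right f) }

theorem toColim_colimTrans (T : FunctorialFactorization C) (n : ℕ) :
    T.toColim n ≫ T.colimTrans = (T.term n).trans :=
  colimit.ι_desc _ n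

/-- The colimit of the free monoid sequence at stage `ω`. -/
noncomputable def colim (T : FunctorialFactorization C) : FunctorialFactorization C where
  M := colimit T.termSeq
  L f := (T.toColim 0).app f
  R f := T.colimTrans.app f
  L_naturality φ := (T.toColim 0).naturality φ
  R_naturality φ := T.colimTrans.naturality φ
  fac f := NatTrans.congr_app (T.toColim_colimTrans 0) f

/-- The morphism from a term to the colimit. -/
noncomputable def ι (T : FunctorialFactorization C) (n : ℕ) : Hom (T.term n) T.colim where
  χ := T.toColim n
  left_comp f := by
    induction n with
    | zero => exact Category.id_comp _
    | succ n ih =>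
      rw [← ih, ← termMap_toColim T n, ← (T.termMap n).left_comp, NatTrans.comp_app,
        Category.assoc]
      rfl
  comp_right f := NatTrans.congr_app (T.toColim_colimTrans n) f

/-- The morphism from `T`, the first term, to the colimit. -/
noncomputable def ιOne (T : FunctorialFactorization C) : Hom T T.colim :=
  T.ι 1

end

end FunctorialFactorization

namespace Garner

/-- The stratum with one cell for each commutative square from a generating map to `f`. -/
noncomputable abbrev oneStratum (f : Arrow TopCat.{u}) : Stratum.{u} where
  X := f.left
  cells k := Arrow.mk (diskBoundaryInclusion.{u} k) ⟶ f
  attach _ s := s.left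

/-- The morphism of strata induced by a morphism of `Top²`. -/
noncomputable def oneStratumMap {f g : Arrow TopCat.{u}} (φ : f ⟶ g) :
    oneStratum f ⟶ oneStratum g :=
  Stratum.Hom.mk (P := oneStratum f) (Q := oneStratum g) φ.left (fun _ s => s ≫ φ)
    (fun _ s => (Arrow.comp_left s φ).symm)

/-- The map from the body to the codomain of `f`. -/
noncomputable def oneExt (f : Arrow TopCat.{u}) : (oneStratum f).body ⟶ f.right :=
  (oneStratum f).desc f.hom (fun _ s => s.right) (fun _ s => s.w)

/-- The one-step factorisation: all cells that fit into a square over `f` are attached. -/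
noncomputable def oneStep : FunctorialFactorization TopCat.{u} where
  M :=
    { obj := fun f => (oneStratum f).body
      map := fun φ => Stratum.bodyMap (oneStratumMap φ)
      map_id := fun f => by
        have h : oneStratumMap (𝟙 f) = 𝟙 (oneStratum f) :=
          Stratum.Hom.ext rfl (funext fun _ => funext fun s => Category.comp_id s)
        rw [h, Stratum.bodyMap_id]
      map_comp := fun φ ψ => by
        have h : oneStratumMap (φ ≫ ψ) = oneStratumMap φ ≫ oneStratumMap ψ :=
          Stratum.Hom.ext rfl (funext fun _ => funext fun s => (Category.assoc s φ ψ).symm)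
        rw [h, Stratum.bodyMap_comp] }
  L f := (oneStratum f).incl
  R f := oneExt f
  L_naturality φ := (Stratum.incl_bodyMap (oneStratumMap φ)).symm
  R_naturality {f g} φ := by
    apply Stratum.body_hom_ext
    · rw [← Category.assoc, Stratum.incl_bodyMap, Category.assoc, oneExt, oneExt,
        Stratum.incl_desc, ← Category.assoc, Stratum.incl_desc]
      exact φ.w
    · intro k s
      rw [← Category.assoc, Stratum.char_bodyMap, oneExt, oneExt, Stratum.char_desc,
        ← Category.assoc, Stratum.char_desc]
      exact Arrow.comp_right s φ
  fac f := Stratum.incl_desc _ _ _ _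

/-- The comultiplication of the one-step comonad: the cell of a square `s` goes to the cell of the
square formed by the attaching map and the characteristic map of `s`. -/
noncomputable def oneComul (f : Arrow TopCat.{u}) :
    (oneStratum f).body ⟶ (oneStratum (Arrow.mk (oneStratum f).incl)).body :=
  Stratum.bodyMap (Stratum.Hom.mk (P := oneStratum f)
    (Q := oneStratum (Arrow.mk (oneStratum f).incl)) (𝟙 f.left)
    (fun k s => Arrow.homMk s.left ((oneStratum f).char k s) ((oneStratum f).attach_incl k s))
    (fun _ _ => Category.comp_id _))

/-- The functorial factorisation produced by the small object argument, which for the generating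
maps `S^{n-1} ⟶ D^n` stops at stage `ω`. -/
noncomputable def factorization : FunctorialFactorization TopCat.{u} := oneStep.{u}.colim

/-- The awfs structure produced by the small object argument: the free monoid on the one-step
comonad. The inclusion of the one-step comonad is a morphism of comonads, and the multiplication
restricts to the actions of the free monoid sequence. -/
structure IsFreeMonoidStructure (G : AWFSStructure factorization.{u}) : Prop where
  comul : ∀ f : Arrow TopCat.{u},
    oneStep.{u}.ιOne.χ.app f ≫ G.δMap f =
      oneComul f ≫ oneStep.{u}.ιOne.χ.app (oneStep.{u}.left.obj f) ≫
        factorization.{u}.M.map (oneStep.{u}.ιOne.leftTrans.app f)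
  mul : ∀ (n : ℕ) (f : Arrow TopCat.{u}),
    (oneStep.{u}.ιOne.χ.app ((oneStep.{u}.term n).right.obj f) ≫
      factorization.{u}.M.map ((oneStep.{u}.ι n).rightTrans.app f)) ≫ G.μMap f =
        (oneStep.{u}.termAct n).χ.app f ≫ (oneStep.{u}.ι (n + 1)).χ.app f

end Garner

/-! ### Free lifting structures -/

section LiftingStructures

universe t

variable {C : Type u} [Category.{v} C] {ι : Type t}

/-! Everything rests on one notion. A free lifting structure on a functorial factorisation chooses,
naturally in `f`, fillers for all squares from generating maps to `Rf`, and makes `Mf` free with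
respect to them. A square from `f` to a map with chosen fillers extends along `Lf` to a
filler-preserving map on `Mf` (`exists_desc`). Two maps out of `Mf` are equal once they agree on the
domain of `f` and on every filler on whose boundary they agree (`hom_ext`); this is induction over
cells.

Such a structure determines an awfs. The multiplication extends the identity of `Mf`; the
comultiplication extends `LLf` with respect to the composite lifting structure on `Rf ∘ RLf`. Each
axiom compares two maps that agree on the base and send fillers to fillers (`fill_mul`,
`fill_comul`), so it is an instance of `hom_ext`. For freeness, coalgebra structures on the
generating maps in an awfs `W` induce fillers against all right parts of `W`: apply `M` to the
square and multiply. Hence there is a filler-preserving comparison map into `W`. It is a morphism of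
awfs, and the only one with the prescribed values on the generators, because every filler is the
generator followed by `M` of the square and by `μ` (`fill_eq_generator`). By this uniqueness, two
free lifting structures for the same maps give isomorphic awfs (`nonempty_iso`).

It remains to put free lifting structures on both factorisations. For `(UK, E)` the fillers are
characteristic maps. Spheres are compact, compact subsets of a body lie in a finite stage, and the
stages are closed subspaces; so an attaching map into the body comes from exactly one stage in which
it is new (`exists_isNew`, `IsNew.unique`), and each square is filled by exactly one cell. Recursion
and induction over cells (`exists_lift`, `body_hom_ext_cells`) give freeness. The body of a morphism
into a free complex is characterised by sending characteristic maps to fillers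
(`bodyMap_homEquiv_eq`). This identifies `δ` with the comultiplication of the adjunction, and `μ`
with the multiplication obtained from any composite of `Kf` and `KEf`.

In the small object argument a square is attached again at every later stage, and the coequaliser
glues the new copy to the old one (`actCell_termMap`); in the free complex the second copy is never
attached. So the `n`-th terms of the two sequences agree (`exists_stage_inverse`), hence so do the
colimits, and the free lifting structure is transported. -/

/-- A lifting structure on `g`: a choice of diagonal fillers for all commutative squares from a
member of the family `j` to `g`. -/
structure Lifting (j : ι → Arrow C) {X Y : C} (g : X ⟶ Y) where
  fill : ∀ (k : ι) (u : (j k).left ⟶ X) (v : (j k).right ⟶ Y),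
    u ≫ g = (j k).hom ≫ v → ((j k).right ⟶ X)
  hom_fill : ∀ k u v w, (j k).hom ≫ fill k u v w = u
  fill_hom : ∀ k u v w, fill k u v w ≫ g = v

namespace Lifting

variable {j : ι → Arrow C}

theorem fill_congr {X Y : C} {g : X ⟶ Y} (Γ : Lifting j g) {k : ι} {u u' : (j k).left ⟶ X}
    {v v' : (j k).right ⟶ Y} (hu : u = u') (hv : v = v') (w : u ≫ g = (j k).hom ≫ v)
    (w' : u' ≫ g = (j k).hom ≫ v') : Γ.fill k u v w = Γ.fill k u' v' w' := by
  subst hu hv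
  rfl

/-- The composite of lifting structures: fill first over the second map, then over the first. -/
def comp {X Y Z : C} {f : X ⟶ Y} {g : Y ⟶ Z} (Φ : Lifting j f) (Γ : Lifting j g) :
    Lifting j (f ≫ g) where
  fill k u v w := Φ.fill k u
    (Γ.fill k (u ≫ f) v ((Category.assoc _ _ _).trans w)) (Γ.hom_fill _ _ _ _).symm
  hom_fill _ _ _ _ := Φ.hom_fill _ _ _ _
  fill_hom _ _ _ _ := by rw [← Category.assoc, Φ.fill_hom, Γ.fill_hom]

end Lifting

/-- A free lifting structure on a functorial factorisation `F`: the right part of every map carries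
a lifting structure, natural and free on that map, and its central object is generated by the
domain of the map under the fillers. -/
structure FreeLifting (j : ι → Arrow C) (F : FunctorialFactorization C) where
  lifting : ∀ f : Arrow C, Lifting j (F.R f)
  fill_map : ∀ {f g : Arrow C} (φ : f ⟶ g) k u v w w',
    (lifting f).fill k u v w ≫ F.M.map φ = (lifting g).fill k (u ≫ F.M.map φ) (v ≫ φ.right) w'
  exists_desc : ∀ {f : Arrow C} {X Y : C} {g : X ⟶ Y} (Γ : Lifting j g) (a : f.left ⟶ X)
    (b : f.right ⟶ Y), a ≫ g = f.hom ≫ b → ∃ h : F.M.obj f ⟶ X, F.L f ≫ h = a ∧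
      h ≫ g = F.R f ≫ b ∧
      ∀ k u v w w', (lifting f).fill k u v w ≫ h = Γ.fill k (u ≫ h) (v ≫ b) w'
  hom_ext : ∀ {f : Arrow C} {X : C} {h h' : F.M.obj f ⟶ X}, F.L f ≫ h = F.L f ≫ h' →
    (∀ k u v w, u ≫ h = u ≫ h' →
      (lifting f).fill k u v w ≫ h = (lifting f).fill k u v w ≫ h') → h = h'

/-! ### From a free lifting structure to an awfs. -/

namespace FreeLifting

variable {j : ι → Arrow C} {F : FunctorialFactorization C} (Ψ : FreeLifting j F)

theorem fill_w {f : Arrow C} (k : ι) (u : (j k).left ⟶ F.M.obj f) (v : (j k).right ⟶ f.right)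
    (w : u ≫ F.R f = (j k).hom ≫ v) {X Y : C} {g : X ⟶ Y} {h : F.M.obj f ⟶ X} {b : f.right ⟶ Y}
    (hw : h ≫ g = F.R f ≫ b) : (u ≫ h) ≫ g = (j k).hom ≫ v ≫ b := by
  rw [Category.assoc, hw, ← Category.assoc, w, Category.assoc]

section

variable {f : Arrow C} {X Y : C} {g : X ⟶ Y} (Γ : Lifting j g) (a : f.left ⟶ X)
  (b : f.right ⟶ Y) (w : a ≫ g = f.hom ≫ b)

/-- The extension of a square to a map that preserves fillers. -/
noncomputable def desc : F.M.obj f ⟶ X := (Ψ.exists_desc Γ a b w).choose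

theorem L_desc : F.L f ≫ Ψ.desc Γ a b w = a := (Ψ.exists_desc Γ a b w).choose_spec.1

theorem desc_hom : Ψ.desc Γ a b w ≫ g = F.R f ≫ b := (Ψ.exists_desc Γ a b w).choose_spec.2.1

theorem fill_desc (k u v w₁ w₂) : (Ψ.lifting f).fill k u v w₁ ≫ Ψ.desc Γ a b w =
    Γ.fill k (u ≫ Ψ.desc Γ a b w) (v ≫ b) w₂ :=
  (Ψ.exists_desc Γ a b w).choose_spec.2.2 k u v w₁ w₂

end

/-- The multiplication. -/
noncomputable def mul (f : Arrow C) : F.M.obj (Arrow.mk (F.R f)) ⟶ F.M.obj f :=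
  Ψ.desc (f := Arrow.mk (F.R f)) (Ψ.lifting f) (𝟙 _) (𝟙 _)
    ((Category.id_comp _).trans (Category.comp_id _).symm)

theorem L_mul (f : Arrow C) : F.L (Arrow.mk (F.R f)) ≫ Ψ.mul f = 𝟙 _ := Ψ.L_desc _ _ _ _

theorem mul_R (f : Arrow C) : Ψ.mul f ≫ F.R f = F.R (Arrow.mk (F.R f)) :=
  (Ψ.desc_hom _ _ _ _).trans (Category.comp_id _)

theorem fill_mul (f : Arrow C) (k u v w w') :
    (Ψ.lifting (Arrow.mk (F.R f))).fill k u v w ≫ Ψ.mul f =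
      (Ψ.lifting f).fill k (u ≫ Ψ.mul f) v w' :=
  (Ψ.fill_desc (f := Arrow.mk (F.R f)) _ _ _ _ k u v w
    (w'.trans (congrArg _ (Category.comp_id v).symm))).trans
    ((Ψ.lifting f).fill_congr rfl (Category.comp_id v) _ _)

/-- The comultiplication. -/
noncomputable def comul (f : Arrow C) : F.M.obj f ⟶ F.M.obj (Arrow.mk (F.L f)) :=
  Ψ.desc (f := f) ((Ψ.lifting (Arrow.mk (F.L f))).comp (Ψ.lifting f)) (F.L (Arrow.mk (F.L f)))
    (𝟙 _) (by
      rw [← Category.assoc, F.fac, Category.comp_id]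
      exact F.fac f)

theorem L_comul (f : Arrow C) : F.L f ≫ Ψ.comul f = F.L (Arrow.mk (F.L f)) := Ψ.L_desc _ _ _ _

theorem comul_R_R (f : Arrow C) : Ψ.comul f ≫ F.R (Arrow.mk (F.L f)) ≫ F.R f = F.R f :=
  (Ψ.desc_hom _ _ _ _).trans (Category.comp_id _)

/-- Raw form, read off from the composite lifting structure: the lower edge is an inner filler whose
boundary still passes through `comul` and back. After `comul_R` this detour is the identity, and
`fill_comul` replaces the raw form. -/
theorem fill_comul' (f : Arrow C) (k u v w w' w'') :
    (Ψ.lifting f).fill k u v w ≫ Ψ.comul f =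
      (Ψ.lifting (Arrow.mk (F.L f))).fill k (u ≫ Ψ.comul f)
        ((Ψ.lifting f).fill k ((u ≫ Ψ.comul f) ≫ F.R (Arrow.mk (F.L f))) v w') w'' :=
  (Ψ.fill_desc (f := f) ((Ψ.lifting (Arrow.mk (F.L f))).comp (Ψ.lifting f)) _ _ _ k u v w
    (((Category.assoc _ _ _).symm.trans w').trans (congrArg _ (Category.comp_id v).symm))).trans
    ((Ψ.lifting (Arrow.mk (F.L f))).fill_congr rfl
      ((Ψ.lifting f).fill_congr rfl (Category.comp_id v) _ _) _ _)

theorem comul_w (f : Arrow C) {k : ι} {u : (j k).left ⟶ F.M.obj f} {v : (j k).right ⟶ f.right}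
    (w : u ≫ F.R f = (j k).hom ≫ v) :
    ((u ≫ Ψ.comul f) ≫ F.R (Arrow.mk (F.L f))) ≫ F.R f = (j k).hom ≫ v := by
  simpa only [Category.assoc, Ψ.comul_R_R] using w

/-- Projecting a filler over `Lf` returns its lower edge, which by `fill_comul'` is the inner
filler; the inductive hypothesis identifies its boundary with `u`. -/
theorem comul_R (f : Arrow C) : Ψ.comul f ≫ F.R (Arrow.mk (F.L f)) = 𝟙 _ := by
  refine Ψ.hom_ext ?_ fun k u v w h => ?_
  · rw [← Category.assoc, L_comul, F.fac, Category.comp_id]; rfl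
  · rw [← Category.assoc, Ψ.fill_comul' f k u v w (Ψ.comul_w f w)
      ((Ψ.lifting f).hom_fill _ _ _ _).symm, Lifting.fill_hom, Category.comp_id]
    exact (Ψ.lifting f).fill_congr
      ((Category.assoc _ _ _).trans (h.trans (Category.comp_id u))) rfl _ _

theorem fill_comul (f : Arrow C) (k u v w w') :
    (Ψ.lifting f).fill k u v w ≫ Ψ.comul f =
      (Ψ.lifting (Arrow.mk (F.L f))).fill k (u ≫ Ψ.comul f) ((Ψ.lifting f).fill k u v w) w' :=
  (Ψ.fill_comul' f k u v w (Ψ.comul_w f w) ((Ψ.lifting f).hom_fill _ _ _ _).symm).trans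
    ((Ψ.lifting (Arrow.mk (F.L f))).fill_congr rfl ((Ψ.lifting f).fill_congr (by
      rw [Category.assoc, comul_R, Category.comp_id]) rfl _ _) _ _)

theorem fill_comul_w (f : Arrow C) (k u v w) :
    (u ≫ Ψ.comul f) ≫ F.R (Arrow.mk (F.L f)) = (j k).hom ≫ (Ψ.lifting f).fill k u v w := by
  rw [Category.assoc, comul_R, Category.comp_id, Lifting.hom_fill]

theorem fill_mul_w (f : Arrow C) {k : ι} {u : (j k).left ⟶ F.M.obj (Arrow.mk (F.R f))}
    {v : (j k).right ⟶ f.right} (w : u ≫ F.R (Arrow.mk (F.R f)) = (j k).hom ≫ v) :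
    (u ≫ Ψ.mul f) ≫ F.R f = (j k).hom ≫ v := by
  rw [Category.assoc, mul_R, w]

theorem fill_map_w {f g : Arrow C} (φ : f ⟶ g) {k : ι} {u : (j k).left ⟶ F.M.obj f}
    {v : (j k).right ⟶ f.right} (w : u ≫ F.R f = (j k).hom ≫ v) :
    (u ≫ F.M.map φ) ≫ F.R g = (j k).hom ≫ v ≫ φ.right :=
  fill_w k u v w (F.R_naturality φ)

/-- The pattern of all the identities below: both sides agree on the base, and both turn a filler
into a filler over the same map. It remains to compare boundaries, which is the inductive hypothesis
`h`, and lower edges. -/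
theorem comul_naturality {f g : Arrow C} (φ : f ⟶ g) :
    F.M.map φ ≫ Ψ.comul g = Ψ.comul f ≫ F.M.map (F.left.map φ) := by
  refine Ψ.hom_ext ?_ fun k u v w h => ?_
  · rw [← Category.assoc, ← F.L_naturality, Category.assoc, L_comul, ← Category.assoc, L_comul]
    exact F.L_naturality (F.left.map φ)
  · have w₁ := fill_map_w φ w
    have w₂ := Ψ.fill_comul_w f k u v w
    rw [← Category.assoc, Ψ.fill_map φ k u v w w₁,
      Ψ.fill_comul g k _ _ _ (Ψ.fill_comul_w g k _ _ _), ← Category.assoc,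
      Ψ.fill_comul f k u v w w₂, Ψ.fill_map (F.left.map φ) k _ _ _ (fill_map_w _ w₂)]
    refine (Ψ.lifting _).fill_congr ?_ ?_ _ _
    · simpa only [Category.assoc] using h
    · exact (Ψ.fill_map φ k u v w w₁).symm

theorem mul_naturality {f g : Arrow C} (φ : f ⟶ g) :
    F.M.map (F.right.map φ) ≫ Ψ.mul g = Ψ.mul f ≫ F.M.map φ := by
  refine Ψ.hom_ext ?_ fun k u v w h => ?_
  · rw [← Category.assoc, ← F.L_naturality (F.right.map φ), Category.assoc, L_mul,
      ← Category.assoc, L_mul, Category.id_comp]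
    exact Category.comp_id _
  · have w₁ := fill_map_w (F.right.map φ) w
    have w₂ := Ψ.fill_mul_w f w
    rw [← Category.assoc, Ψ.fill_map (F.right.map φ) k u v w w₁,
      Ψ.fill_mul g k _ _ _ (Ψ.fill_mul_w g w₁), ← Category.assoc,
      Ψ.fill_mul f k u v w w₂, Ψ.fill_map φ k _ _ _ (fill_map_w _ w₂)]
    refine (Ψ.lifting _).fill_congr ?_ rfl _ _
    simpa only [Category.assoc] using h

theorem comul_map_counit (f : Arrow C) : Ψ.comul f ≫ F.M.map (F.counit.app f) = 𝟙 _ := by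
  refine Ψ.hom_ext ?_ fun k u v w h => ?_
  · rw [← Category.assoc, L_comul, Category.comp_id]
    exact (F.L_naturality (F.counit.app f)).symm.trans (Category.id_comp _)
  · have w₂ := Ψ.fill_comul_w f k u v w
    rw [← Category.assoc, Ψ.fill_comul f k u v w w₂,
      Ψ.fill_map (F.counit.app f) k _ _ _ (fill_map_w _ w₂), Category.comp_id]
    refine (Ψ.lifting _).fill_congr ?_ ((Ψ.lifting f).fill_hom _ _ _ _) _ _
    simpa only [Category.assoc, Category.comp_id] using h

/-- `φ` stands for `(1, δ_f)`, known only through its components, so that the identity can serve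
both the coassociativity law, before the comonad exists, and one component of `distrib_comul`. The
same device is used for `mul_assoc` and `mul_comul`. -/
theorem comul_coassoc (f : Arrow C) (φ : F.left.obj f ⟶ F.left.obj (F.left.obj f))
    (hφ : φ.left = 𝟙 _) (hφ' : φ.right = Ψ.comul f) :
    Ψ.comul f ≫ F.M.map φ = Ψ.comul f ≫ Ψ.comul (Arrow.mk (F.L f)) := by
  refine Ψ.hom_ext ?_ fun k u v w h => ?_
  · rw [← Category.assoc, ← Category.assoc, L_comul, L_comul]
    refine (F.L_naturality φ).symm.trans ?_
    rw [hφ]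
    exact Category.id_comp _
  · have w₂ := Ψ.fill_comul_w f k u v w
    rw [← Category.assoc, ← Category.assoc, Ψ.fill_comul f k u v w w₂,
      Ψ.fill_map φ k _ _ _ (fill_map_w _ w₂),
      Ψ.fill_comul _ k _ _ w₂ (Ψ.fill_comul_w _ k _ _ w₂)]
    refine (Ψ.lifting _).fill_congr ?_ ?_ _ _
    · simpa only [Category.assoc] using h
    · rw [hφ']
      exact Ψ.fill_comul f k u v w w₂

theorem map_unit_mul (f : Arrow C) : F.M.map (F.unit.app f) ≫ Ψ.mul f = 𝟙 _ := by
  refine Ψ.hom_ext ?_ fun k u v w h => ?_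
  · rw [← Category.assoc, ← F.L_naturality (F.unit.app f), Category.assoc, Category.comp_id]
    exact (congrArg (F.L f ≫ ·) (Ψ.L_mul f)).trans (Category.comp_id _)
  · have w₁ := fill_map_w (F.unit.app f) w
    rw [← Category.assoc, Ψ.fill_map (F.unit.app f) k u v w w₁,
      Ψ.fill_mul f k _ _ _ (Ψ.fill_mul_w f w₁), Category.comp_id]
    refine (Ψ.lifting _).fill_congr ?_ (Category.comp_id v) _ _
    simpa only [Category.assoc, Category.comp_id] using h

theorem mul_assoc (f : Arrow C) (φ : F.right.obj (F.right.obj f) ⟶ F.right.obj f)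
    (hφ : φ.left = Ψ.mul f) (hφ' : φ.right = 𝟙 _) :
    F.M.map φ ≫ Ψ.mul f = Ψ.mul (Arrow.mk (F.R f)) ≫ Ψ.mul f := by
  refine Ψ.hom_ext ?_ fun k u v w h => ?_
  · rw [← Category.assoc, ← F.L_naturality φ, hφ, Category.assoc,
      ← Category.assoc (F.L (F.right.obj (F.right.obj f)))]
    exact ((congrArg (Ψ.mul f ≫ ·) (Ψ.L_mul f)).trans (Category.comp_id _)).trans
      ((congrArg (· ≫ Ψ.mul f) (Ψ.L_mul (Arrow.mk (F.R f)))).trans (Category.id_comp _)).symm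
  · have w₁ := fill_map_w φ w
    rw [← Category.assoc, Ψ.fill_map φ k u v w w₁, Ψ.fill_mul f k _ _ _ (Ψ.fill_mul_w f w₁),
      ← Category.assoc, Ψ.fill_mul (Arrow.mk (F.R f)) k _ _ _ (Ψ.fill_mul_w _ w),
      Ψ.fill_mul f k _ _ _ (Ψ.fill_mul_w f (Ψ.fill_mul_w _ w))]
    refine (Ψ.lifting _).fill_congr ?_ ?_ _ _
    · simpa only [Category.assoc] using h
    · rw [hφ']
      exact Category.comp_id v

/-- The substance of the distributive law: it is one component of each of the axioms `distrib_mul`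
and `distrib_comul`, whose other components are associativity of `μ` and coassociativity of `δ`. -/
theorem mul_comul (f : Arrow C) (φ : F.left.obj (F.right.obj f) ⟶ F.right.obj (F.left.obj f))
    (hφ : φ.left = Ψ.comul f) (hφ' : φ.right = Ψ.mul f) :
    Ψ.mul f ≫ Ψ.comul f =
      Ψ.comul (Arrow.mk (F.R f)) ≫ F.M.map φ ≫ Ψ.mul (Arrow.mk (F.L f)) := by
  refine Ψ.hom_ext ?_ fun k u v w h => ?_
  · rw [← Category.assoc, L_mul, Category.id_comp, ← Category.assoc, L_comul, ← Category.assoc]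
    refine Eq.trans ?_ (congrArg (· ≫ Ψ.mul (Arrow.mk (F.L f))) (F.L_naturality φ))
    rw [hφ, Category.assoc]
    exact (Category.comp_id _).symm.trans (congrArg (Ψ.comul f ≫ ·) (Ψ.L_mul _).symm)
  · have w₁ := Ψ.fill_mul_w f w
    have w₂ := Ψ.fill_comul_w (Arrow.mk (F.R f)) k u v w
    have w₃ := fill_map_w φ w₂
    rw [← Category.assoc, Ψ.fill_mul f k u v w w₁,
      Ψ.fill_comul f k _ _ _ (Ψ.fill_comul_w f k _ _ _),
      ← Category.assoc, Ψ.fill_comul _ k u v w w₂, ← Category.assoc, Ψ.fill_map φ k _ _ _ w₃,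
      Ψ.fill_mul (Arrow.mk (F.L f)) k _ _ _ (Ψ.fill_mul_w _ w₃)]
    refine (Ψ.lifting _).fill_congr ?_ ?_ _ _
    · simpa only [Category.assoc] using h
    -- On the left the lower edge is the filler of the multiplied square; on the right it is the
    -- original filler followed by `μ`.
    · rw [hφ']
      exact (Ψ.fill_mul f k u v w w₁).symm

/-- The comonad and the monad of a free lifting structure. -/
noncomputable def comonadMonad : ComonadMonadStructure F where
  δ :=
    { app := fun f => Arrow.homMk (𝟙 _) (Ψ.comul f)
        ((Category.id_comp _).trans (Ψ.L_comul f).symm)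
      naturality := fun f g φ => by
        apply Arrow.hom_ext
        · exact (Category.comp_id _).trans (Category.id_comp _).symm
        · exact Ψ.comul_naturality φ }
  left_counit f := by
    apply Arrow.hom_ext
    · exact Category.id_comp _
    · exact Ψ.comul_R f
  right_counit f := by
    apply Arrow.hom_ext
    · exact Category.id_comp _
    · exact Ψ.comul_map_counit f
  coassoc f := by
    apply Arrow.hom_ext
    · rfl
    · exact Ψ.comul_coassoc f _ rfl rfl
  μ :=
    { app := fun f => Arrow.homMk (Ψ.mul f) (𝟙 _)
        ((Ψ.mul_R f).trans (Category.comp_id _).symm)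
      naturality := fun f g φ => by
        apply Arrow.hom_ext
        · exact Ψ.mul_naturality φ
        · exact (Category.comp_id _).trans (Category.id_comp _).symm }
  left_unit f := by
    apply Arrow.hom_ext
    · exact Ψ.L_mul f
    · exact Category.id_comp _
  right_unit f := by
    apply Arrow.hom_ext
    · exact Ψ.map_unit_mul f
    · exact Category.id_comp _
  assoc f := by
    apply Arrow.hom_ext
    · exact Ψ.mul_assoc f _ rfl rfl
    · rfl

/-- The algebraic weak factorisation system of a free lifting structure. -/
noncomputable def awfsStructure : AWFSStructure F where
  toComonadMonadStructure := Ψ.comonadMonad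
  distrib_unit f := by
    apply Arrow.hom_ext
    · exact Ψ.L_comul f
    · exact Ψ.map_unit_mul f
  distrib_counit f := by
    apply Arrow.hom_ext
    · exact Ψ.comul_map_counit f
    · exact Ψ.mul_R f
  distrib_mul f := by
    apply Arrow.hom_ext
    · exact Ψ.mul_comul f (Ψ.comonadMonad.distrib f) rfl rfl
    · exact (Ψ.mul_assoc f (Ψ.comonadMonad.μ.app f) rfl rfl).trans
        (congrArg (Ψ.mul (Arrow.mk (F.R f)) ≫ ·) (Category.comp_id _).symm)
  distrib_comul f := by
    apply Arrow.hom_ext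
    · exact (Ψ.comul_coassoc f (Ψ.comonadMonad.δ.app f) rfl rfl).trans (Category.id_comp _).symm
    · exact Ψ.mul_comul f (Ψ.comonadMonad.distrib f) rfl rfl

/-- The algebraic weak factorisation system of a free lifting structure. -/
noncomputable abbrev awfs : AWFS C := ⟨F, Ψ.awfsStructure⟩

end FreeLifting

end LiftingStructures

/-! ### Coalgebra structures on generating maps and the fillers they induce. -/

namespace AWFS

variable {C : Type u} [Category.{v} C] (W : AWFS C)

/-- The unit `(Lf, 1)` is the identity on codomains, so a unit law leaves no choice for the codomain
part of `μ`. Dually for `δ_app_left`. -/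
theorem μ_app_right (f : Arrow C) : (W.str.μ.app f).right = 𝟙 _ :=
  (Category.id_comp _).symm.trans (congrArg Arrow.Hom.right (W.str.left_unit f))

theorem δ_app_left (f : Arrow C) : (W.str.δ.app f).left = 𝟙 _ :=
  (Category.comp_id _).symm.trans (congrArg Arrow.Hom.left (W.str.left_counit f))

theorem L_μMap (f : Arrow C) : W.fact.L (Arrow.mk (W.fact.R f)) ≫ W.str.μMap f = 𝟙 _ :=
  congrArg Arrow.Hom.left (W.str.left_unit f)

theorem μMap_R (f : Arrow C) :
    W.str.μMap f ≫ W.fact.R f = W.fact.R (Arrow.mk (W.fact.R f)) := by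
  refine (W.str.μ.app f).w.trans ?_
  rw [μ_app_right]
  exact Category.comp_id _

theorem μMap_naturality {f g : Arrow C} (φ : f ⟶ g) :
    W.fact.M.map (W.fact.right.map φ) ≫ W.str.μMap g = W.str.μMap f ≫ W.fact.M.map φ :=
  congrArg Arrow.Hom.left (W.str.μ.naturality φ)

theorem μMap_assoc (f : Arrow C) : W.fact.M.map (W.str.μ.app f) ≫ W.str.μMap f =
    W.str.μMap (Arrow.mk (W.fact.R f)) ≫ W.str.μMap f :=
  congrArg Arrow.Hom.left (W.str.assoc f)

theorem L_δMap (f : Arrow C) :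
    W.fact.L f ≫ W.str.δMap f = W.fact.L (Arrow.mk (W.fact.L f)) := by
  refine (W.str.δ.app f).w.symm.trans ?_
  rw [δ_app_left]
  exact Category.id_comp _

theorem δMap_R (f : Arrow C) : W.str.δMap f ≫ W.fact.R (Arrow.mk (W.fact.L f)) = 𝟙 _ :=
  congrArg Arrow.Hom.right (W.str.left_counit f)

theorem δMap_naturality {f g : Arrow C} (φ : f ⟶ g) :
    W.fact.M.map φ ≫ W.str.δMap g = W.str.δMap f ≫ W.fact.M.map (W.fact.left.map φ) :=
  congrArg Arrow.Hom.right (W.str.δ.naturality φ)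

/-- The form in which the distributive law of `W` enters the proof of freeness, through `fill_δMap`.
-/
theorem μMap_δMap (f : Arrow C) : W.str.μMap f ≫ W.str.δMap f =
    W.str.δMap (Arrow.mk (W.fact.R f)) ≫ W.fact.M.map (W.str.distrib f) ≫
      W.str.μMap (Arrow.mk (W.fact.L f)) :=
  congrArg Arrow.Hom.right (W.str.distrib_comul f)

universe t

variable {W} {ι : Type t} {j : ι → Arrow C}

/-- Coalgebra structures on the members of a family of maps. -/
structure CoalgebraFamily (W : AWFS C) (j : ι → Arrow C) where
  a : ∀ k, j k ⟶ W.fact.left.obj (j k)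
  counit : ∀ k, a k ≫ W.fact.counit.app (j k) = 𝟙 (j k)
  coassoc : ∀ k, a k ≫ W.str.δ.app (j k) = a k ≫ W.fact.left.map (a k)

namespace CoalgebraFamily

variable (c : CoalgebraFamily W j)

theorem a_left (k : ι) : (c.a k).left = 𝟙 _ :=
  (Category.comp_id _).symm.trans (congrArg Arrow.Hom.left (c.counit k))

theorem hom_a_right (k : ι) : (j k).hom ≫ (c.a k).right = W.fact.L (j k) := by
  refine (c.a k).w.symm.trans ?_
  rw [a_left]
  exact Category.id_comp _

theorem a_right_R (k : ι) : (c.a k).right ≫ W.fact.R (j k) = 𝟙 _ :=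
  congrArg Arrow.Hom.right (c.counit k)

theorem a_right_δMap (k : ι) :
    (c.a k).right ≫ W.str.δMap (j k) = (c.a k).right ≫ W.fact.M.map (c.a k) :=
  congrArg Arrow.Hom.right (c.coassoc k)

/-- The functor from the discrete category on the family to the left maps. -/
def functor : Discrete ι ⥤ W.LMap :=
  Discrete.functor fun k =>
    { A := j k
      a := c.a k
      counit := c.counit k
      coassoc := c.coassoc k }

/-- The lifting structure on a right part given by coalgebra structures on the generating
maps. -/
def lifting (f : Arrow C) : Lifting j (W.fact.R f) where
  fill k u v w := (c.a k).right ≫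
    W.fact.M.map (Arrow.homMk u v w : j k ⟶ Arrow.mk (W.fact.R f)) ≫ W.str.μMap f
  hom_fill k u v w := by
    rw [← Category.assoc, hom_a_right, ← Category.assoc, ← W.fact.L_naturality, Category.assoc,
      L_μMap]
    exact Category.comp_id u
  fill_hom k u v w := by
    rw [Category.assoc, Category.assoc, μMap_R, W.fact.R_naturality, ← Category.assoc, a_right_R]
    exact Category.id_comp v

theorem fill_map {f g : Arrow C} (φ : f ⟶ g) (k u v w w') :
    (c.lifting f).fill k u v w ≫ W.fact.M.map φ =
      (c.lifting g).fill k (u ≫ W.fact.M.map φ) (v ≫ φ.right) w' := by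
  dsimp only [lifting]
  rw [Category.assoc, Category.assoc, ← μMap_naturality, ← Category.assoc (W.fact.M.map _),
    ← W.fact.M.map_comp]
  rfl

/-- Associativity of `μ`: multiplying twice after `M` of the square is the same as first multiplying
the boundary of the square. -/
theorem fill_μMap (f : Arrow C) (k u v w w') :
    (c.lifting (Arrow.mk (W.fact.R f))).fill k u v w ≫ W.str.μMap f =
      (c.lifting f).fill k (u ≫ W.str.μMap f) v w' := by
  dsimp only [lifting]
  rw [Category.assoc, Category.assoc, ← μMap_assoc, ← Category.assoc (W.fact.M.map _),
    ← W.fact.M.map_comp]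
  congr 3
  apply Arrow.hom_ext
  · rfl
  · refine (Arrow.comp_right _ _).trans ?_
    rw [μ_app_right]
    exact Category.comp_id v

/-- Says that `δ_f` preserves fillers into the composite lifting structure on `Rf ∘ RLf`, as needed
for the comparison map to respect comultiplications. Three facts combine: the distributive law moves
`δ` past `μ`, naturality moves it past the square, and coassociativity of the coalgebra on `j k`
turns it into `M` of the structure map, whose codomain part builds the new lower edge. -/
theorem fill_δMap (f : Arrow C) (k u v w w') :
    (c.lifting f).fill k u v w ≫ W.str.δMap f =
      (c.lifting (Arrow.mk (W.fact.L f))).fill k (u ≫ W.str.δMap f)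
        ((c.lifting f).fill k u v w) w' := by
  dsimp only [lifting]
  have h := W.δMap_naturality (Arrow.homMk u v w : j k ⟶ Arrow.mk (W.fact.R f))
  rw [Category.assoc, Category.assoc, μMap_δMap, ← Category.assoc (W.fact.M.map _), h,
    Category.assoc, ← Category.assoc, a_right_δMap, Category.assoc,
    ← Category.assoc (W.fact.M.map (W.fact.left.map _)), ← W.fact.M.map_comp,
    ← Category.assoc (W.fact.M.map (c.a k)), ← W.fact.M.map_comp]
  congr 3
  apply Arrow.hom_ext
  · change (c.a k).left ≫ u ≫ W.str.δMap f = u ≫ W.str.δMap f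
    rw [a_left]
    exact Category.id_comp _
  · rfl

end CoalgebraFamily

theorem discrete_functor_ext {D : Type*} [Category D] {F G : Discrete ι ⥤ D}
    (h : ∀ k, F.obj ⟨k⟩ = G.obj ⟨k⟩) : F = G := by
  refine CategoryTheory.Functor.ext (fun X => h X.as) fun X Y f => ?_
  · obtain ⟨X⟩ := X
    obtain ⟨Y⟩ := Y
    obtain rfl : X = Y := Discrete.eq_of_hom f
    obtain rfl : f = 𝟙 _ := Subsingleton.elim _ _
    simp

theorem LMap_mk_inj {A : Arrow C} {a b : A ⟶ W.str.comonad.toFunctor.obj A} {h₁ h₂ h₃ h₄}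
    (h : (⟨A, a, h₁, h₂⟩ : W.LMap) = ⟨A, b, h₃, h₄⟩) : a = b := by
  injection h

/-- A functor over `C²` yields only a propositional equality of underlying arrows; eliminating it
here once avoids transports in all later statements. -/
theorem exists_coalgebra_eq (X : W.LMap) {A : Arrow C} (h : X.A = A) :
    ∃ a h₁ h₂, X = (⟨A, a, h₁, h₂⟩ : W.LMap) := by
  subst h
  exact ⟨X.a, X.counit, X.coassoc, rfl⟩

/-- A functor from a discrete category to the left maps is given by coalgebra structures. -/
theorem exists_coalgebraFamily (F : Discrete ι ⥤ W.LMap)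
    (hF : F ⋙ W.str.comonad.forget = Discrete.functor j) :
    ∃ c : CoalgebraFamily W j, F = c.functor := by
  have h : ∀ k, ∃ a h₁ h₂, F.obj ⟨k⟩ = (⟨j k, a, h₁, h₂⟩ : W.LMap) := fun k =>
    exists_coalgebra_eq _ (Functor.congr_obj hF ⟨k⟩)
  choose a h₁ h₂ h using h
  exact ⟨⟨a, h₁, h₂⟩, discrete_functor_ext h⟩

/-- Structure maps of coalgebras are the identity on domains by the counit law, so they can be
compared on codomains alone. -/
theorem functor_comp_mapLMap_eq_iff {W' : AWFS C} (χ : W ⟶ W') (c : CoalgebraFamily W j)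
    (d : CoalgebraFamily W' j) : c.functor ⋙ mapLMap χ = d.functor ↔
      ∀ k, (c.a k).right ≫ (Hom.toHom χ).χ.app (j k) = (d.a k).right := by
  have e : ∀ k, c.a k ≫ (Hom.comonadHom χ).app (j k) = d.a k ↔
      (c.a k).right ≫ (Hom.toHom χ).χ.app (j k) = (d.a k).right := fun k =>
    ⟨fun h => congrArg Arrow.Hom.right h, fun h => Arrow.hom_ext _ _
      (((Category.comp_id _).trans (c.a_left k)).trans (d.a_left k).symm) h⟩
  constructor
  · intro h k
    exact (e k).mp (LMap_mk_inj (Functor.congr_obj h ⟨k⟩))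
  · intro h
    refine discrete_functor_ext fun k => ?_
    change (⟨j k, c.a k ≫ (Hom.comonadHom χ).app (j k), _, _⟩ : W'.LMap) = ⟨j k, d.a k, _, _⟩
    have := (e k).mpr (h k)
    congr 1

end AWFS

/-! ### Freeness of the awfs on the generating maps. -/

namespace FreeLifting

universe t

variable {C : Type u} [Category.{v} C] {ι : Type t} {j : ι → Arrow C}
  {F : FunctorialFactorization C} (Ψ : FreeLifting j F)

/-- The generating maps are left maps: the structure map is the filler of the identity square. -/
noncomputable def generator (k : ι) : (j k).right ⟶ F.M.obj (j k) :=
  (Ψ.lifting (j k)).fill k (F.L (j k)) (𝟙 _) ((F.fac _).trans (Category.comp_id _).symm)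

theorem hom_generator (k : ι) : (j k).hom ≫ Ψ.generator k = F.L (j k) :=
  Lifting.hom_fill _ _ _ _ _

theorem generator_map {f : Arrow C} (k : ι) (φ : j k ⟶ f) (w) :
    Ψ.generator k ≫ F.M.map φ = (Ψ.lifting f).fill k (φ.left ≫ F.L f) φ.right w := by
  have w₁ := fill_map_w φ (k := k) ((F.fac (j k)).trans (Category.comp_id _).symm)
  exact (Ψ.fill_map φ k _ _ _ w₁).trans
    ((Ψ.lifting f).fill_congr (F.L_naturality φ).symm (Category.id_comp _) _ _)

/-- `M` of the square carries the generator to a filler over `R(Rf)` with boundary `u ≫ L(Rf)`;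
multiplication preserves fillers, and the unit law returns the boundary to `u`. Consequently
anything compatible with `M` and `μ` is determined by the generators. -/
theorem fill_eq_generator (f : Arrow C) (k : ι) (u v w) : (Ψ.lifting f).fill k u v w =
    Ψ.generator k ≫ F.M.map (Arrow.homMk u v w : j k ⟶ Arrow.mk (F.R f)) ≫ Ψ.mul f := by
  have w₁ : (u ≫ F.L (Arrow.mk (F.R f))) ≫ F.R (Arrow.mk (F.R f)) = (j k).hom ≫ v := by
    rw [Category.assoc, F.fac]
    exact w
  have h := Ψ.generator_map k (Arrow.homMk u v w : j k ⟶ Arrow.mk (F.R f)) w₁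
  rw [← Category.assoc, h]
  refine Eq.trans ?_ (Ψ.fill_mul f k _ _ w₁ (Ψ.fill_mul_w f w₁)).symm
  refine (Ψ.lifting f).fill_congr ?_ rfl _ _
  rw [Category.assoc]
  exact (Category.comp_id u).symm.trans (congrArg (u ≫ ·) (Ψ.L_mul f).symm)

/-- The coalgebra structures on the generating maps. -/
noncomputable def generatorFamily : Ψ.awfs.CoalgebraFamily j where
  a k := Arrow.homMk (𝟙 _) (Ψ.generator k) ((Category.id_comp _).trans (Ψ.hom_generator k).symm)
  counit k := by
    apply Arrow.hom_ext
    · exact Category.id_comp _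
    · exact Lifting.fill_hom _ _ _ _ _
  coassoc k := by
    apply Arrow.hom_ext
    · rfl
    · have w := Ψ.fill_comul_w (j k) k (F.L (j k)) (𝟙 _)
        ((F.fac _).trans (Category.comp_id _).symm)
      refine (Ψ.fill_comul (j k) k _ _ _ w).trans ?_
      -- Comultiplying the generator gives a filler whose lower edge is the generator itself. This
      -- is the filler that `generator_map` assigns to the square `φ = (1, generator)`.
      let φ : j k ⟶ F.left.obj (j k) := Arrow.homMk (𝟙 _) (Ψ.generator k)
        ((Category.id_comp _).trans (Ψ.hom_generator k).symm)
      have e : F.L (j k) ≫ Ψ.comul (j k) = φ.left ≫ F.L (F.left.obj (j k)) :=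
        (Ψ.L_comul (j k)).trans (Category.id_comp _).symm
      have w' : (φ.left ≫ F.L (F.left.obj (j k))) ≫ F.R (F.left.obj (j k)) =
          (j k).hom ≫ φ.right := by
        rw [← e]
        exact w
      exact ((Ψ.lifting _).fill_congr e rfl _ _).trans (Ψ.generator_map k φ w').symm

section

variable {W : AWFS C} (c : W.CoalgebraFamily j)

/-- The comparison map from a free lifting structure. -/
noncomputable def compare (f : Arrow C) : F.M.obj f ⟶ W.fact.M.obj f :=
  Ψ.desc (c.lifting f) (W.fact.L f) (𝟙 _) ((W.fact.fac f).trans (Category.comp_id _).symm)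

theorem L_compare (f : Arrow C) : F.L f ≫ Ψ.compare c f = W.fact.L f := Ψ.L_desc _ _ _ _

theorem compare_R (f : Arrow C) : Ψ.compare c f ≫ W.fact.R f = F.R f :=
  (Ψ.desc_hom _ _ _ _).trans (Category.comp_id _)

theorem fill_compare (f : Arrow C) (k u v w w') :
    (Ψ.lifting f).fill k u v w ≫ Ψ.compare c f =
      (c.lifting f).fill k (u ≫ Ψ.compare c f) v w' :=
  (Ψ.fill_desc _ _ _ _ k u v w (w'.trans (congrArg _ (Category.comp_id v).symm))).trans
    ((c.lifting f).fill_congr rfl (Category.comp_id v) _ _)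

theorem fill_compare_w (f : Arrow C) {k : ι} {u : (j k).left ⟶ F.M.obj f}
    {v : (j k).right ⟶ f.right} (w : u ≫ F.R f = (j k).hom ≫ v) :
    (u ≫ Ψ.compare c f) ≫ W.fact.R f = (j k).hom ≫ v := by
  rw [Category.assoc, compare_R, w]

theorem compare_naturality {f g : Arrow C} (φ : f ⟶ g) :
    F.M.map φ ≫ Ψ.compare c g = Ψ.compare c f ≫ W.fact.M.map φ := by
  refine Ψ.hom_ext ?_ fun k u v w h => ?_
  · rw [← Category.assoc, ← F.L_naturality, Category.assoc, L_compare, ← Category.assoc,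
      L_compare, W.fact.L_naturality]
  · have w₁ := fill_map_w φ w
    have w₂ := Ψ.fill_compare_w c f w
    rw [← Category.assoc, Ψ.fill_map φ k u v w w₁,
      Ψ.fill_compare c g k _ _ _ (Ψ.fill_compare_w c g w₁), ← Category.assoc,
      Ψ.fill_compare c f k u v w w₂,
      c.fill_map φ k _ _ _ (fill_w k _ v w₂ (W.fact.R_naturality φ))]
    refine (c.lifting g).fill_congr ?_ rfl _ _
    simpa only [Category.assoc] using h

/-- The comparison map as a morphism of functorial factorisations. -/
noncomputable def compareHom : FunctorialFactorization.Hom F W.fact where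
  χ :=
    { app := Ψ.compare c
      naturality := fun _ _ φ => Ψ.compare_naturality c φ }
  left_comp := Ψ.L_compare c
  comp_right := Ψ.compare_R c

/-- Induction over fillers: `mul`, `M` and the comparison map preserve fillers on the side of `F`,
and `fill_μMap` does the same for the multiplication of `W`. -/
theorem mul_compare (f : Arrow C) (φ : F.right.obj f ⟶ W.fact.right.obj f)
    (hφ : φ.left = Ψ.compare c f) (hφ' : φ.right = 𝟙 _) :
    Ψ.mul f ≫ Ψ.compare c f =
      (F.M.map φ ≫ Ψ.compare c (W.fact.right.obj f)) ≫ W.str.μMap f := by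
  refine Ψ.hom_ext ?_ fun k u v w h => ?_
  · rw [← Category.assoc, L_mul, Category.assoc, ← Category.assoc, ← F.L_naturality φ,
      Category.assoc, ← Category.assoc (F.L _), L_compare, hφ]
    exact (Category.id_comp _).trans ((Category.comp_id _).symm.trans
      (congrArg (Ψ.compare c f ≫ ·) (W.L_μMap f).symm))
  · have w₁ := Ψ.fill_mul_w f w
    have w₂ := fill_map_w φ w
    have w₃ := Ψ.fill_compare_w c _ w₂
    have w₄ : ((((u ≫ F.M.map φ) ≫ Ψ.compare c (W.fact.right.obj f))) ≫ W.str.μMap f) ≫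
        W.fact.R f = (j k).hom ≫ v ≫ φ.right := by
      rw [Category.assoc, AWFS.μMap_R]
      exact w₃
    rw [← Category.assoc, Ψ.fill_mul f k u v w w₁,
      Ψ.fill_compare c f k _ _ _ (Ψ.fill_compare_w c f w₁), ← Category.assoc, ← Category.assoc,
      Ψ.fill_map φ k u v w w₂, Ψ.fill_compare c _ k _ _ _ w₃]
    refine Eq.trans ?_ (c.fill_μMap f k _ _ _ w₄).symm
    refine (c.lifting f).fill_congr ?_ ?_ _ _
    · simpa only [Category.assoc] using h
    · rw [hφ']
      exact (Category.comp_id v).symm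

/-- Induction over fillers, with `fill_δMap` on the side of `W`. The lower edges are themselves
fillers, and match because the comparison map preserves fillers. -/
theorem compare_δMap (f : Arrow C) (φ : F.left.obj f ⟶ W.fact.left.obj f)
    (hφ : φ.left = 𝟙 _) (hφ' : φ.right = Ψ.compare c f) :
    Ψ.compare c f ≫ W.str.δMap f =
      Ψ.comul f ≫ Ψ.compare c (F.left.obj f) ≫ W.fact.M.map φ := by
  refine Ψ.hom_ext ?_ fun k u v w h => ?_
  · rw [← Category.assoc, L_compare, AWFS.L_δMap, ← Category.assoc, L_comul, ← Category.assoc]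
    refine Eq.trans ?_ (congrArg (· ≫ W.fact.M.map φ) (Ψ.L_compare c (F.left.obj f)).symm)
    rw [← W.fact.L_naturality φ, hφ]
    exact (Category.id_comp _).symm
  · have w₁ := Ψ.fill_compare_w c f w
    have w₂ := Ψ.fill_comul_w f k u v w
    have w₃ := Ψ.fill_compare_w c (F.left.obj f) w₂
    have w₄ : ((u ≫ Ψ.compare c f) ≫ W.str.δMap f) ≫ W.fact.R (Arrow.mk (W.fact.L f)) =
        (j k).hom ≫ (c.lifting f).fill k (u ≫ Ψ.compare c f) v w₁ := by
      rw [Category.assoc, AWFS.δMap_R, Category.comp_id, Lifting.hom_fill]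
    rw [← Category.assoc, Ψ.fill_compare c f k u v w w₁,
      c.fill_δMap f k _ _ _ w₄, ← Category.assoc, ← Category.assoc,
      Ψ.fill_comul f k u v w w₂]
    refine Eq.trans ?_ (congrArg (· ≫ W.fact.M.map φ)
      (Ψ.fill_compare c (F.left.obj f) k _ _ w₂ w₃).symm)
    refine Eq.trans ?_ (c.fill_map φ k _ _ _
      (fill_w k _ _ w₃ (W.fact.R_naturality φ))).symm
    refine (c.lifting _).fill_congr ?_ ?_ _ _
    · simpa only [Category.assoc] using h
    · rw [hφ']
      exact (Ψ.fill_compare c f k u v w w₁).symm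

/-- The comparison map as a morphism of algebraic weak factorisation systems. -/
noncomputable def compareAWFS : Ψ.awfs ⟶ W where
  toHom := Ψ.compareHom c
  comul f := by
    apply Arrow.hom_ext
    · refine (Category.id_comp _).trans ((W.δ_app_left f).trans ?_)
      exact ((Category.id_comp _).trans (Category.id_comp _)).symm
    · exact Ψ.compare_δMap c f _ rfl rfl
  mul f := by
    apply Arrow.hom_ext
    · exact Ψ.mul_compare c f _ rfl rfl
    · change 𝟙 f.right ≫ 𝟙 f.right = (𝟙 f.right ≫ 𝟙 f.right) ≫ (W.str.μ.app f).right
      rw [W.μ_app_right f]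
      exact (Category.comp_id _).symm

theorem generator_compare (k : ι) : Ψ.generator k ≫ Ψ.compare c (j k) = (c.a k).right := by
  have w₀ := (F.fac (j k)).trans (Category.comp_id _).symm
  refine (Ψ.fill_compare c (j k) k _ _ w₀ (Ψ.fill_compare_w c _ w₀)).trans ?_
  have e : (Arrow.homMk (F.L (j k) ≫ Ψ.compare c (j k)) (𝟙 _) (Ψ.fill_compare_w c _ w₀) :
      j k ⟶ Arrow.mk (W.fact.R (j k))) = W.fact.unit.app (j k) :=
    Arrow.hom_ext _ _ (Ψ.L_compare c (j k)) rfl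
  dsimp only [AWFS.CoalgebraFamily.lifting]
  rw [e]
  exact (congrArg ((c.a k).right ≫ ·)
    (congrArg Arrow.Hom.left (W.str.right_unit (j k)))).trans (Category.comp_id _)

/-- By `fill_eq_generator` a filler is built from a generator, `M` and `μ`. Naturality and
multiplicativity carry `χ` through to the generator, where its value is prescribed; the result is
the filler that `c` induces in `W`. -/
theorem eq_compare (χ : Ψ.awfs ⟶ W)
    (h : ∀ k, Ψ.generator k ≫ (AWFS.Hom.toHom χ).χ.app (j k) = (c.a k).right) (f : Arrow C) :
    (AWFS.Hom.toHom χ).χ.app f = Ψ.compare c f := by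
  refine Ψ.hom_ext ((AWFS.Hom.toHom χ).left_comp f |>.trans (Ψ.L_compare c f).symm)
    fun k u v w hu => ?_
  have w₁ := Ψ.fill_compare_w c f w
  have m : Ψ.mul f ≫ (AWFS.Hom.toHom χ).χ.app f =
      (F.M.map ((AWFS.Hom.toHom χ).rightTrans.app f) ≫
        (AWFS.Hom.toHom χ).χ.app (W.fact.right.obj f)) ≫ W.str.μMap f :=
    congrArg Arrow.Hom.left (AWFS.Hom.mul χ f)
  rw [Ψ.fill_compare c f k u v w w₁, fill_eq_generator, Category.assoc, Category.assoc, m,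
    Category.assoc, ← Category.assoc (F.M.map _), ← F.M.map_comp]
  have n := (AWFS.Hom.toHom χ).χ.naturality ((Arrow.homMk u v w : j k ⟶ Arrow.mk (F.R f)) ≫
    (AWFS.Hom.toHom χ).rightTrans.app f)
  rw [← Category.assoc (F.M.map _)]
  refine (congrArg (fun t => Ψ.generator k ≫ t ≫ W.str.μMap f) n).trans ?_
  rw [Category.assoc, ← Category.assoc, h]
  dsimp only [AWFS.CoalgebraFamily.lifting]
  congr 3
  exact Arrow.hom_ext _ _ hu (Category.comp_id v)

end

/-- The algebraic weak factorisation system of a free lifting structure is free on the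
generating maps. -/
theorem isFreeVia : Ψ.awfs.IsFreeVia (Discrete.functor j) Ψ.generatorFamily.functor := by
  refine ⟨AWFS.discrete_functor_ext fun _ => rfl, fun W G hG => ?_⟩
  obtain ⟨c, rfl⟩ := AWFS.exists_coalgebraFamily G hG
  refine ⟨Ψ.compareAWFS c, ?_, fun χ hχ => ?_⟩
  · exact (AWFS.functor_comp_mapLMap_eq_iff _ _ _).mpr (Ψ.generator_compare c)
  · have h := (AWFS.functor_comp_mapLMap_eq_iff _ _ _).mp hχ
    exact AWFS.Hom.ext (NatTrans.ext (funext (Ψ.eq_compare c χ h)))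

/-- Two free lifting structures for the same maps give isomorphic algebraic weak factorisation
systems. -/
theorem nonempty_iso {F' : FunctorialFactorization C} (Ψ' : FreeLifting j F') :
    Nonempty (Ψ.awfs ≅ Ψ'.awfs) := by
  have key : ∀ {F F' : FunctorialFactorization C} (Ψ : FreeLifting j F) (Ψ' : FreeLifting j F'),
      Ψ.compareAWFS Ψ'.generatorFamily ≫ Ψ'.compareAWFS Ψ.generatorFamily = 𝟙 Ψ.awfs := by
    intro F F' Ψ Ψ'
    refine AWFS.Hom.ext (NatTrans.ext (funext fun f => ?_))
    -- The round trip and the identity are both endomorphisms fixing the generators, so both equal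
    -- the comparison map of `Ψ` with itself.
    refine (Ψ.eq_compare Ψ.generatorFamily _ (fun k => ?_) f).trans
      (Ψ.eq_compare Ψ.generatorFamily (𝟙 Ψ.awfs) (fun k => Category.comp_id _) f).symm
    refine (Category.assoc _ _ _).symm.trans ?_
    exact (congrArg (· ≫ Ψ'.compare Ψ.generatorFamily (j k))
      (Ψ.generator_compare Ψ'.generatorFamily k)).trans
        (Ψ'.generator_compare Ψ.generatorFamily k)
  exact ⟨⟨_, _, key Ψ Ψ', key Ψ' Ψ⟩⟩

end FreeLifting

/-! ### The topology of cell complexes -/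

instance compactSpace_diskBoundary (k : ℕ) : CompactSpace (diskBoundary.{u} k) := by
  unfold diskBoundary
  exact inferInstanceAs
    (CompactSpace (ULift.{u} (Metric.sphere (0 : EuclideanSpace ℝ (Fin k)) 1)))

instance t2Space_disk (k : ℕ) : T2Space (disk.{u} k) := by
  unfold disk
  exact inferInstanceAs
    (T2Space (ULift.{u} (Metric.closedBall (0 : EuclideanSpace ℝ (Fin k)) 1)))

theorem isClosedEmbedding_diskBoundaryInclusion (k : ℕ) :
    Topology.IsClosedEmbedding (diskBoundaryInclusion.{u} k) :=
  (diskBoundaryInclusion.{u} k).hom.continuous.isClosedEmbedding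
    ((TopCat.mono_iff_injective _).mp inferInstance)

/-- A map whose range lies in the range of an embedding factors through it. -/
theorem exists_factor_of_range_subset {X Y Z : TopCat.{u}} {i : X ⟶ Y}
    (hi : Topology.IsInducing i) (f : Z ⟶ Y) (h : Set.range f ⊆ Set.range i) :
    ∃ g : Z ⟶ X, g ≫ i = f := by
  choose g hg using fun z => h ⟨z, rfl⟩
  have hg' : (i ∘ g : Z → Y) = f := funext hg
  exact ⟨TopCat.ofHom ⟨g, hi.continuous_iff.mpr (hg' ▸ f.hom.continuous)⟩, by
    ext z; exact hg z⟩

namespace Stratum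

variable (P : Stratum.{u})

theorem incl_attach_apply (k : ℕ) (s : P.cells k) (x : diskBoundary.{u} k) :
    P.incl (P.attach k s x) = P.char k s (diskBoundaryInclusion.{u} k x) :=
  congrArg (fun m : diskBoundary.{u} k ⟶ P.body => m x) (P.attach_incl k s)

variable {P} in
/-- Functions out of the body are determined by their values on the boundary and on the cells. -/
theorem body_funext {T : Type u} {m m' : P.body → T} (h₀ : ∀ x, m (P.incl x) = m' (P.incl x))
    (h₁ : ∀ k (s : P.cells k) d, m (P.char k s d) = m' (P.char k s d)) : m = m' := by
  -- With the indiscrete topology on `T` every function is continuous, so the universal property of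
  -- the body applies to bare functions.
  let _ : TopologicalSpace T := ⊤
  have e : (TopCat.ofHom ⟨m, continuous_top⟩ : P.body ⟶ TopCat.of T) =
      TopCat.ofHom ⟨m', continuous_top⟩ := by
    apply body_hom_ext
    · ext x
      exact h₀ x
    · intro k s
      ext d
      exact h₁ k s d
  funext y
  exact congrArg (fun n : P.body ⟶ TopCat.of T => n y) e

/-- Functions out of the body can be defined on the boundary and on the cells. -/
theorem exists_body_fun {T : Type u} (a : P.X → T) (c : ∀ k, P.cells k → disk.{u} k → T)
    (h : ∀ k s x, a (P.attach k s x) = c k s (diskBoundaryInclusion.{u} k x)) :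
    ∃ m : P.body → T, (∀ x, m (P.incl x) = a x) ∧ ∀ k s d, m (P.char k s d) = c k s d := by
  let _ : TopologicalSpace T := ⊤
  let a' : P.X ⟶ TopCat.of T := TopCat.ofHom ⟨a, continuous_top⟩
  let c' : ∀ k, P.cells k → (disk.{u} k ⟶ TopCat.of T) := fun k s =>
    TopCat.ofHom ⟨c k s, continuous_top⟩
  have h' : ∀ k s, P.attach k s ≫ a' = diskBoundaryInclusion.{u} k ≫ c' k s := fun k s => by
    ext x
    exact h k s x
  exact ⟨P.desc a' c' h', fun x => congrArg (fun n : P.X ⟶ TopCat.of T => n x)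
    (P.incl_desc a' c' h'), fun k s d => congrArg (fun n : disk.{u} k ⟶ TopCat.of T => n d)
    (P.char_desc a' c' h' k s)⟩

/-- The indicator of the covered points and the constant `True` agree on the boundary and on all
cells. -/
theorem exists_incl_or_char (y : P.body) :
    (∃ x, P.incl x = y) ∨ ∃ (k : ℕ) (s : P.cells k) (d : disk.{u} k), P.char k s d = y := by
  have e : (fun y : P.body => ULift.up.{u} ((∃ x, P.incl x = y) ∨
      ∃ (k : ℕ) (s : P.cells k) (d : disk.{u} k), P.char k s d = y)) = fun _ => ULift.up True :=
    body_funext (fun x => congrArg _ (eq_true (Or.inl ⟨x, rfl⟩)))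
      (fun k s d => congrArg _ (eq_true (Or.inr ⟨k, s, d, rfl⟩)))
  exact of_eq_true (congrArg ULift.down (congrFun e y))

/-- The body has the final topology: the indicator of the complement of `V` is glued from continuous
maps to the Sierpiński space. -/
theorem isClosed_body {V : Set P.body} (h₀ : IsClosed (P.incl ⁻¹' V))
    (h₁ : ∀ k s, IsClosed (P.char k s ⁻¹' V)) : IsClosed V := by
  rw [← isOpen_compl_iff] at h₀ ⊢
  have h₁' : ∀ k s, IsOpen (P.char k s ⁻¹' V)ᶜ := fun k s => (h₁ k s).isOpen_compl
  let S : TopCat.{u} := TopCat.of (ULift.{u} Prop)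
  let a : P.X ⟶ S := TopCat.ofHom
    ⟨_, continuous_uliftUp.comp (isOpen_iff_continuous_mem.mp h₀)⟩
  let c : ∀ k, P.cells k → (disk.{u} k ⟶ S) := fun k s => TopCat.ofHom
    ⟨_, continuous_uliftUp.comp (isOpen_iff_continuous_mem.mp (h₁' k s))⟩
  have h' : ∀ k s, P.attach k s ≫ a = diskBoundaryInclusion.{u} k ≫ c k s := fun k s => by
    ext x
    change P.incl (P.attach k s x) ∉ V ↔ P.char k s (diskBoundaryInclusion.{u} k x) ∉ V
    rw [P.incl_attach_apply]
  have e : (fun y => ULift.up.{u} (y ∈ Vᶜ)) = (P.desc a c h' : P.body → ULift.{u} Prop) := by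
    apply body_funext
    · intro x
      exact (congrArg (fun n : P.X ⟶ S => n x) (P.incl_desc a c h')).symm
    · intro k s d
      exact (congrArg (fun n : disk.{u} k ⟶ S => n d) (P.char_desc a c h' k s)).symm
  rw [isOpen_iff_continuous_mem]
  have : Continuous fun y => ULift.up.{u} (y ∈ Vᶜ) := by
    rw [e]
    exact (P.desc a c h').hom.continuous
  exact continuous_uliftDown.comp this

-- A left inverse of `incl` exists at the level of sets once points in the interior of cells may be
-- sent to `none`.
open Classical in
theorem incl_injective : Function.Injective P.incl := by
  have hj := fun k => (isClosedEmbedding_diskBoundaryInclusion.{u} k).injective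
  obtain ⟨m, hm, -⟩ := P.exists_body_fun (T := Option P.X) some
    (fun k s d => if h : ∃ x, diskBoundaryInclusion.{u} k x = d then
      some (P.attach k s h.choose) else none) (fun k s x => by
        have h : ∃ y, diskBoundaryInclusion.{u} k y = diskBoundaryInclusion.{u} k x := ⟨x, rfl⟩
        rw [dif_pos h]
        exact congrArg (fun y => some (P.attach k s y)) (hj k h.choose_spec).symm)
  intro x y h
  have := congrArg m h
  rw [hm, hm] at this
  exact Option.some.inj this

-- A bookkeeping function that recovers an interior point of a cell from its image in the body and
-- marks all other points. It shows that cells meet the base only along their boundaries, and that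
-- open cells are disjoint and embedded injectively.
open Classical in
theorem exists_cell_index : ∃ m : P.body → Option (Σ k, P.cells k × disk.{u} k),
    (∀ x, m (P.incl x) = none) ∧ ∀ k s d, m (P.char k s d) =
      if d ∈ Set.range (diskBoundaryInclusion.{u} k) then none else some ⟨k, s, d⟩ :=
  P.exists_body_fun (T := Option (Σ k, P.cells k × disk.{u} k)) (fun _ => none) (fun k s d =>
    if d ∈ Set.range (diskBoundaryInclusion.{u} k) then none else some ⟨k, s, d⟩)
    (fun _ _ x => (if_pos ⟨x, rfl⟩).symm)

theorem mem_range_of_char_eq_incl {k : ℕ} {s : P.cells k} {d : disk.{u} k} {x : P.X}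
    (h : P.char k s d = P.incl x) : ∃ b, diskBoundaryInclusion.{u} k b = d ∧ P.attach k s b = x := by
  classical
  obtain ⟨m, hm, hm'⟩ := P.exists_cell_index
  have h' := hm' k s d
  rw [h, hm] at h'
  by_cases hd : d ∈ Set.range (diskBoundaryInclusion.{u} k)
  · obtain ⟨b, rfl⟩ := hd
    refine ⟨b, rfl, P.incl_injective ?_⟩
    rw [P.incl_attach_apply, h]
  · rw [if_neg hd] at h'
    exact absurd h' (by simp)

/-- For closed `F` in the base, the preimage of its image in a disk is the part of the sphere
attached to `F`, which is closed since the sphere is closed in the disk. -/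
theorem isClosedEmbedding_incl : Topology.IsClosedEmbedding P.incl := by
  refine Topology.IsClosedEmbedding.of_continuous_injective_isClosedMap
    P.incl.hom.continuous P.incl_injective fun F hF => P.isClosed_body ?_ fun k s => ?_
  · rwa [Set.preimage_image_eq F P.incl_injective]
  · have e : P.char k s ⁻¹' (P.incl '' F) =
        diskBoundaryInclusion.{u} k '' (P.attach k s ⁻¹' F) := by
      ext d
      constructor
      · rintro ⟨x, hx, h⟩
        obtain ⟨b, rfl, rfl⟩ := P.mem_range_of_char_eq_incl h.symm
        exact ⟨b, hx, rfl⟩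
      · rintro ⟨b, hb, rfl⟩
        exact ⟨_, hb, P.incl_attach_apply k s b⟩
    rw [e]
    exact (isClosedEmbedding_diskBoundaryInclusion k).isClosedMap _
      (hF.preimage (P.attach k s).hom.continuous)

/-- A point off the base lies in one open cell, so it has no preimage in the base and at most one in
each disk. -/
theorem isClosed_singleton_of_notMem_range {y : P.body} (hy : y ∉ Set.range P.incl) :
    IsClosed {y} := by
  classical
  obtain ⟨m, hm, hm'⟩ := P.exists_cell_index
  refine P.isClosed_body ?_ fun k s => ?_
  · rw [Set.preimage_singleton_eq_empty.mpr hy]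
    exact isClosed_empty
  · refine Set.Subsingleton.isClosed fun d hd d' hd' => ?_
    have key : ∀ d, P.char k s d = y → m y = some ⟨k, s, d⟩ := by
      rintro d rfl
      rw [hm', if_neg]
      rintro ⟨b, rfl⟩
      exact hy ⟨_, P.incl_attach_apply k s b⟩
    have e := (key d hd).symm.trans (key d' hd')
    simpa using e

end Stratum

namespace CellCx

variable (A : CellCx.{u})

theorem isClosedEmbedding_step (n : ℕ) : Topology.IsClosedEmbedding (A.step n) :=
  (TopCat.homeoOfIso (A.link n)).isClosedEmbedding.comp (A.stratum n).isClosedEmbedding_incl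

/-- The map between two stages. -/
noncomputable def stepMap {m n : ℕ} (h : m ≤ n) : (A.stratum m).X ⟶ (A.stratum n).X :=
  A.sequence.map (homOfLE h)

theorem stepMap_self (n : ℕ) : A.stepMap (le_refl n) = 𝟙 _ := A.sequence.map_id n

theorem stepMap_succ {m n : ℕ} (h : m ≤ n) :
    A.stepMap (Nat.le_succ_of_le h) = A.stepMap h ≫ A.step n :=
  (A.sequence.map_comp (homOfLE h) (homOfLE (Nat.le_add_right n 1))).trans
    (congrArg (A.stepMap h ≫ ·)
      (Functor.ofSequence_map_homOfLE_succ (X := fun n => (A.stratum n).X) A.step n))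

theorem isClosedEmbedding_stepMap {m n : ℕ} (h : m ≤ n) :
    Topology.IsClosedEmbedding (A.stepMap h) := by
  induction n, h using Nat.le_induction with
  | base =>
    rw [stepMap_self]
    exact Topology.IsClosedEmbedding.id
  | succ n h ih =>
    rw [stepMap_succ A h]
    exact (A.isClosedEmbedding_step n).comp ih

theorem stepMap_toBody {m n : ℕ} (h : m ≤ n) : A.stepMap h ≫ A.toBody n = A.toBody m :=
  colimit.w A.sequence (homOfLE h)

theorem toBody_stepMap_apply {m n : ℕ} (h : m ≤ n) (x : (A.stratum m).X) :
    A.toBody n (A.stepMap h x) = A.toBody m x :=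
  congrArg (fun t : (A.stratum m).X ⟶ A.body => t x) (A.stepMap_toBody h)

/-- Points identified in a sequential colimit are already identified at a finite stage, and the maps
between stages are injective. -/
theorem toBody_injective (n : ℕ) : Function.Injective (A.toBody n) := by
  intro x y h
  obtain ⟨m, f, g, e⟩ := Concrete.colimit_exists_of_rep_eq A.sequence x y h
  obtain rfl : f = g := Subsingleton.elim _ _
  exact (A.isClosedEmbedding_stepMap (leOfHom f)).injective e

theorem isClosedEmbedding_toBody (n : ℕ) : Topology.IsClosedEmbedding (A.toBody n) := by
  refine Topology.IsClosedEmbedding.of_continuous_injective_isClosedMap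
    (A.toBody n).hom.continuous (A.toBody_injective n) fun F hF => ?_
  refine (TopCat.isClosed_iff_of_isColimit _ (colimit.isColimit A.sequence) _).mpr fun m => ?_
  change IsClosed (A.toBody m ⁻¹' (A.toBody n '' F))
  -- Seen from an earlier stage, the image of `F` is a preimage under a continuous map; seen from a
  -- later stage, it is an image under a closed embedding.
  rcases le_total m n with h | h
  · have e : A.toBody m ⁻¹' (A.toBody n '' F) = A.stepMap h ⁻¹' F := by
      ext x
      constructor
      · rintro ⟨y, hy, e⟩
        rw [← A.toBody_stepMap_apply h] at e
        rw [A.toBody_injective n e] at hy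
        exact hy
      · intro hx
        exact ⟨_, hx, A.toBody_stepMap_apply h x⟩
    rw [e]
    exact hF.preimage (A.stepMap h).hom.continuous
  · have e : A.toBody m ⁻¹' (A.toBody n '' F) = A.stepMap h '' F := by
      ext x
      constructor
      · rintro ⟨y, hy, e⟩
        rw [← A.toBody_stepMap_apply h] at e
        exact ⟨y, hy, A.toBody_injective m e⟩
      · rintro ⟨y, hy, rfl⟩
        exact ⟨y, hy, (A.toBody_stepMap_apply h y).symm⟩
    rw [e]
    exact (A.isClosedEmbedding_stepMap h).isClosedMap F hF

instance mono_toBody (n : ℕ) : Mono (A.toBody n) :=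
  (TopCat.mono_iff_injective _).mpr (A.toBody_injective n)

theorem exists_toBody (y : A.body) : ∃ n, y ∈ Set.range (A.toBody n) := by
  obtain ⟨n, x, h⟩ := Concrete.colimit_exists_rep A.sequence y
  exact ⟨n, x, h⟩

theorem range_toBody_mono {m n : ℕ} (h : m ≤ n) :
    Set.range (A.toBody m) ⊆ Set.range (A.toBody n) := by
  rintro _ ⟨x, rfl⟩
  exact ⟨_, A.toBody_stepMap_apply h x⟩

/-- In the first stage that contains it, the point lies in an open cell and is closed; that stage is
closed in the body. Points of the base are excluded because the base is an arbitrary space. -/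
theorem isClosed_singleton_of_notMem_range {y : A.body} (hy : y ∉ Set.range (A.toBody 0)) :
    IsClosed {y} := by
  classical
  have hex := A.exists_toBody y
  obtain ⟨n, hn⟩ : ∃ n, Nat.find hex = n + 1 := Nat.exists_eq_succ_of_ne_zero fun h => hy (by
    have := Nat.find_spec hex
    rwa [h] at this)
  have h₁ := Nat.find_spec hex
  have h₂ : y ∉ Set.range (A.toBody n) := Nat.find_min hex (by omega)
  rw [hn] at h₁
  obtain ⟨x, rfl⟩ := h₁
  obtain ⟨z, rfl⟩ := (TopCat.homeoOfIso (A.link n)).surjective x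
  have hz : z ∉ Set.range (A.stratum n).incl := by
    rintro ⟨t, rfl⟩
    exact h₂ ⟨t, (congrArg (fun r : (A.stratum n).X ⟶ A.body => r t) (A.step_toBody n)).symm⟩
  have h := (A.isClosedEmbedding_toBody (n + 1)).isClosedMap _
    ((TopCat.homeoOfIso (A.link n)).isClosedMap _
      ((A.stratum n).isClosed_singleton_of_notMem_range hz))
  rwa [Set.image_singleton, Set.image_singleton] at h

/-- A compact subset of the body lies in a finite stage. -/
theorem exists_subset_range_toBody {S : Set A.body} (hS : IsCompact S) :
    ∃ n, S ⊆ Set.range (A.toBody n) := by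
  by_contra! hne
  -- Choose a point of `S` outside each stage. These points meet each stage in a finite set, so
  -- every set of them is closed in the body; together they form a compact discrete, hence finite,
  -- set.
  choose z hzS hz using fun n => Set.not_subset.mp (hne n)
  have hfin : ∀ T ⊆ Set.range z, ∀ n, (T ∩ Set.range (A.toBody n)).Finite := by
    intro T hT n
    refine ((Set.finite_lt_nat n).image z).subset ?_
    rintro y ⟨hyT, hyn⟩
    obtain ⟨m, rfl⟩ := hT hyT
    refine ⟨m, ?_, rfl⟩
    by_contra hm
    exact hz m (A.range_toBody_mono (not_lt.mp hm) hyn)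
  have hclosed : ∀ T ⊆ Set.range z, IsClosed T := by
    intro T hT
    refine (TopCat.isClosed_iff_of_isColimit _ (colimit.isColimit A.sequence) _).mpr fun n => ?_
    change IsClosed (A.toBody n ⁻¹' T)
    have hc : IsClosed (T ∩ Set.range (A.toBody n)) := by
      rw [← Set.biUnion_of_singleton (T ∩ Set.range (A.toBody n))]
      refine (hfin T hT n).isClosed_biUnion fun y hy => ?_
      obtain ⟨m, rfl⟩ := hT hy.1
      -- The point `z m` avoids stage `m`, hence also the base.
      exact A.isClosed_singleton_of_notMem_range fun h =>
        hz m (A.range_toBody_mono (Nat.zero_le m) h)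
    have := hc.preimage (A.toBody n).hom.continuous
    convert this using 1
    ext x
    exact ⟨fun h => ⟨h, x, rfl⟩, fun h => h.1⟩
  have hcomp : IsCompact (Set.range z) :=
    hS.of_isClosed_subset (hclosed _ subset_rfl) (by rintro _ ⟨n, rfl⟩; exact hzS n)
  have hdisc : DiscreteTopology (Set.range z) := by
    refine discreteTopology_iff_forall_isClosed.mpr fun T => ?_
    have := (hclosed (Subtype.val '' T) (by rintro _ ⟨y, -, rfl⟩; exact y.2)).preimage
      (continuous_subtype_val (p := (· ∈ Set.range z)))
    rwa [Set.preimage_image_eq T Subtype.val_injective] at this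
  have hfinite : (Set.range z).Finite := hcomp.finite ⟨hdisc⟩
  choose N hN using A.exists_toBody
  -- Finitely many points lie in a common stage `M`, yet `z M` was chosen outside it.
  obtain ⟨M, hM⟩ := (hfinite.image N).bddAbove
  exact hz M (A.range_toBody_mono (hM ⟨z M, ⟨M, rfl⟩, rfl⟩) (hN (z M)))

theorem exists_toBody_factor {Z : TopCat.{u}} [CompactSpace Z] (f : Z ⟶ A.body) :
    ∃ (n : ℕ) (c : Z ⟶ (A.stratum n).X), c ≫ A.toBody n = f := by
  obtain ⟨n, hn⟩ := A.exists_subset_range_toBody (isCompact_range f.hom.continuous)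
  exact ⟨n, exists_factor_of_range_subset (A.isClosedEmbedding_toBody n).isInducing f hn⟩

/-- A map into a stage that does not factor through the previous stage. -/
def IsNew {Z : TopCat.{u}} : ∀ n : ℕ, (Z ⟶ (A.stratum n).X) → Prop
  | 0, _ => True
  | n + 1, c => ¬ ∃ c' : Z ⟶ (A.stratum n).X, c' ≫ A.step n = c

theorem isNew_attach (n k : ℕ) (s : (A.stratum n).cells k) :
    A.IsNew n ((A.stratum n).attach k s) := by
  cases n with
  | zero => exact True.intro
  | succ n => exact A.proper n k s

/-- By compactness the map factors through some stage; in the least such stage it is new. -/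
theorem exists_isNew {Z : TopCat.{u}} [CompactSpace Z] (f : Z ⟶ A.body) :
    ∃ (n : ℕ) (c : Z ⟶ (A.stratum n).X), A.IsNew n c ∧ c ≫ A.toBody n = f := by
  classical
  have hex := A.exists_toBody_factor f
  obtain ⟨c, hc⟩ := Nat.find_spec hex
  refine ⟨Nat.find hex, c, ?_, hc⟩
  have hmin := fun m => Nat.find_min hex (m := m)
  revert c hmin
  generalize Nat.find hex = N
  intro c hc hmin
  cases N with
  | zero => exact True.intro
  | succ n =>
    rintro ⟨c', rfl⟩
    exact hmin n (Nat.lt_succ_self n) ⟨c', by rw [← hc, Category.assoc, step_toBody]⟩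

/-- If `m < n`, then `d` moved up to the stage just before `n` would factor `c`, since the map from
stage `n` to the body is a monomorphism. -/
theorem IsNew.le {Z : TopCat.{u}} {A : CellCx.{u}} {n m : ℕ} {c : Z ⟶ (A.stratum n).X}
    (hc : A.IsNew n c) (d : Z ⟶ (A.stratum m).X) (h : c ≫ A.toBody n = d ≫ A.toBody m) :
    n ≤ m := by
  by_contra hlt
  obtain ⟨n, rfl⟩ : ∃ n', n = n' + 1 := Nat.exists_eq_succ_of_ne_zero (by omega)
  have hm : m ≤ n := by omega
  refine hc ⟨d ≫ A.stepMap hm, ?_⟩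
  rw [← cancel_mono (A.toBody (n + 1)), h, Category.assoc, step_toBody, Category.assoc,
    stepMap_toBody]

/-- With `exists_isNew`, a map from a compact space to the body is the same as a new map into a
unique stage. This makes the cells of a free complex correspond bijectively to squares over the
body. -/
theorem IsNew.unique {Z : TopCat.{u}} {A : CellCx.{u}} {n m : ℕ} {c : Z ⟶ (A.stratum n).X}
    {d : Z ⟶ (A.stratum m).X} (hc : A.IsNew n c) (hd : A.IsNew m d)
    (h : c ≫ A.toBody n = d ≫ A.toBody m) :
    (⟨n, c⟩ : Σ n, Z ⟶ (A.stratum n).X) = ⟨m, d⟩ := by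
  obtain rfl : n = m := le_antisymm (hc.le d h) (hd.le c h.symm)
  rw [(cancel_mono _).mp h]

end CellCx

/-! ### The free lifting structure on free cell complexes -/

/-- The generating maps, as a family. -/
noncomputable abbrev cellMap (k : ℕ) : Arrow TopCat.{u} := Arrow.mk (diskBoundaryInclusion.{u} k)

namespace CellCx

section

variable (A : CellCx.{u})

/-- A cell of a stratum, as a cell of the cell complex. -/
def mkCell {n k : ℕ} (s : (A.stratum n).cells k) : A.Cell k := ⟨n, s⟩

theorem char_mkCell {n k : ℕ} (s : (A.stratum n).cells k) : A.char (A.mkCell s) =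
    (A.stratum n).char k s ≫ (A.link n).hom ≫ A.toBody (n + 1) := rfl

theorem hom_char_mkCell {n k : ℕ} (s : (A.stratum n).cells k) :
    diskBoundaryInclusion.{u} k ≫ A.char (A.mkCell s) =
      (A.stratum n).attach k s ≫ A.toBody n := by
  rw [char_mkCell, ← Category.assoc, ← Stratum.attach_incl, ← A.step_toBody n, step]
  simp only [Category.assoc]

variable {A} in
/-- Maps out of the body are equal if they agree on the base and on every cell on whose boundary
they agree. -/
theorem body_hom_ext_cells {X : TopCat.{u}} {h h' : A.body ⟶ X} (h₀ : A.map ≫ h = A.map ≫ h')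
    (h₁ : ∀ (k : ℕ) (s : A.Cell k), diskBoundaryInclusion.{u} k ≫ A.char s ≫ h =
      diskBoundaryInclusion.{u} k ≫ A.char s ≫ h' → A.char s ≫ h = A.char s ≫ h') : h = h' := by
  refine body_hom_ext fun n => ?_
  induction n with
  | zero => exact h₀
  | succ n ih =>
    rw [← cancel_epi (A.link n).hom]
    apply Stratum.body_hom_ext
    · have e := ih
      rw [← A.step_toBody n, step] at e
      simpa only [Category.assoc] using e
    · intro k s
      have e := h₁ k (A.mkCell s) (by
        rw [← Category.assoc, ← Category.assoc, hom_char_mkCell, Category.assoc, Category.assoc, ih])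
      simpa only [char_mkCell, Category.assoc] using e

section

variable {X Y : TopCat.{u}} {p : X ⟶ Y} {q : A.body ⟶ Y} (a : A.base ⟶ X)
  (w : a ≫ p = A.map ≫ q)
  (op : ∀ (k : ℕ) (s : A.Cell k) (x : diskBoundary.{u} k ⟶ X),
    x ≫ p = diskBoundaryInclusion.{u} k ≫ A.char s ≫ q → (disk.{u} k ⟶ X))
  (hom_op : ∀ k s x e, diskBoundaryInclusion.{u} k ≫ op k s x e = x)
  (op_hom : ∀ k s x e, op k s x e ≫ p = A.char s ≫ q)

include op_hom in
/-- One step of the recursion in `exists_lift`. -/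
theorem exists_lift_succ (n : ℕ) (h : (A.stratum n).X ⟶ X) (hw : h ≫ p = A.toBody n ≫ q)
    (hop : ∀ k s x e, diskBoundaryInclusion.{u} k ≫ op k s x e = x) :
    ∃ h' : (A.stratum (n + 1)).X ⟶ X, A.step n ≫ h' = h ∧ h' ≫ p = A.toBody (n + 1) ≫ q ∧
      ∀ k (s : (A.stratum n).cells k) e, (A.stratum n).char k s ≫ (A.link n).hom ≫ h' =
        op k (A.mkCell s) ((A.stratum n).attach k s ≫ h) e := by
  have e : ∀ k (s : (A.stratum n).cells k), ((A.stratum n).attach k s ≫ h) ≫ p =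
      diskBoundaryInclusion.{u} k ≫ A.char (A.mkCell s) ≫ q := fun k s => by
    rw [← Category.assoc (diskBoundaryInclusion k), hom_char_mkCell, Category.assoc, hw, Category.assoc]
  have hd := fun k s => (hop k (A.mkCell s) _ (e k s)).symm
  refine ⟨(A.link n).inv ≫ (A.stratum n).desc h
    (fun k s => op k (A.mkCell s) ((A.stratum n).attach k s ≫ h) (e k s)) hd, ?_, ?_, ?_⟩
  · rw [step, Category.assoc, Iso.hom_inv_id_assoc, Stratum.incl_desc]
  · rw [Category.assoc, Iso.inv_comp_eq]
    apply Stratum.body_hom_ext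
    · rw [← Category.assoc, Stratum.incl_desc, hw, ← A.step_toBody n, step]
      simp only [Category.assoc]
    · intro k s
      rw [← Category.assoc, Stratum.char_desc, op_hom, char_mkCell]
      simp only [Category.assoc]
  · intro k s _
    rw [Iso.hom_inv_id_assoc, Stratum.char_desc]

include w hom_op op_hom in
/-- A map out of the body can be defined by recursion over the cells. -/
theorem exists_lift : ∃ h : A.body ⟶ X, A.map ≫ h = a ∧ h ≫ p = q ∧
    ∀ k s e, A.char s ≫ h = op k s (diskBoundaryInclusion.{u} k ≫ A.char s ≫ h) e := by
  choose next h₁ h₂ h₃ using fun n h hw => A.exists_lift_succ op op_hom n h hw hom_op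
  -- The recursion carries compatibility with `q`, without which `op` has no square to fill at the
  -- next stage.
  let st : ∀ n, {h : (A.stratum n).X ⟶ X // h ≫ p = A.toBody n ≫ q} := fun n =>
    Nat.rec ⟨a, w⟩ (fun n h => ⟨next n h.1 h.2, h₂ n h.1 h.2⟩) n
  have hst : ∀ n, A.step n ≫ (st (n + 1)).1 = (st n).1 := fun n => h₁ n _ _
  refine ⟨A.desc (fun n => (st n).1) hst, A.toBody_desc _ _ 0, body_hom_ext fun n => ?_, ?_⟩
  · rw [← Category.assoc, toBody_desc, (st n).2]
  · rintro k ⟨n, s⟩ e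
    change (_ ≫ A.char (A.mkCell s) ≫ _) ≫ _ = _ at e
    change A.char (A.mkCell s) ≫ _ = op k (A.mkCell s) (_ ≫ A.char (A.mkCell s) ≫ _) e
    have e₁ : A.char (A.mkCell s) ≫ A.desc (fun n => (st n).1) hst =
        (A.stratum n).char k s ≫ (A.link n).hom ≫ (st (n + 1)).1 := by
      rw [char_mkCell, Category.assoc, Category.assoc, toBody_desc]
    have e₂ : diskBoundaryInclusion.{u} k ≫ A.char (A.mkCell s) ≫ A.desc (fun n => (st n).1) hst =
        (A.stratum n).attach k s ≫ (st n).1 := by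
      rw [← Category.assoc, hom_char_mkCell, Category.assoc, toBody_desc]
    have e' := e
    rw [e₂] at e'
    refine (e₁.trans (h₃ n (st n).1 (st n).2 k s e')).trans ?_
    congr 1
    exact e₂.symm

end

theorem char_mkCell_bodyMap {A B : CellCx.{u}} (φ : A ⟶ B) {n k : ℕ}
    (s : (A.stratum n).cells k) :
    A.char (A.mkCell s) ≫ bodyMap φ = B.char (B.mkCell ((φ.strat n).cells k s)) := by
  rw [char_mkCell, char_mkCell, Category.assoc, Category.assoc, toBody_bodyMap,
    ← Category.assoc (A.link n).hom, φ.coherent, Category.assoc, ← Category.assoc,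
    Stratum.char_bodyMap]

theorem char_bodyMap {A B : CellCx.{u}} (φ : A ⟶ B) {k : ℕ} (s : A.Cell k) :
    A.char s ≫ bodyMap φ = B.char (B.mkCell ((φ.strat s.1).cells k s.2)) :=
  char_mkCell_bodyMap φ s.2

end

theorem free_step (f : Arrow TopCat.{u}) (n : ℕ) :
    (free f).step n = (freeStage f n).stratum.incl :=
  Category.comp_id _

theorem ok_of_isNew (f : Arrow TopCat.{u}) {n k : ℕ}
    {c : diskBoundary.{u} k ⟶ ((free f).stratum n).X} (hc : (free f).IsNew n c) :
    (freeStage f n).ok k c := by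
  cases n with
  | zero => exact True.intro
  | succ n =>
    rintro ⟨c', h⟩
    exact hc ⟨c', (congrArg (c' ≫ ·) (free_step f n)).trans h⟩

/-- The cell of the free cell complex given by a square. -/
noncomputable def freeCell (f : Arrow TopCat.{u}) {n k : ℕ}
    (c : diskBoundary.{u} k ⟶ ((free f).stratum n).X) (hc : (free f).IsNew n c)
    (v : disk.{u} k ⟶ f.right) (w : c ≫ (freeStage f n).e = diskBoundaryInclusion.{u} k ≫ v) :
    (free f).Cell k :=
  ⟨n, ⟨(Arrow.homMk c v w : cellMap k ⟶ Arrow.mk (freeStage f n).e), ok_of_isNew f hc⟩⟩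

/-- The square of a cell of the free cell complex. -/
def freeCellSquare {f : Arrow TopCat.{u}} {k : ℕ} (s : (free f).Cell k) :
    cellMap k ⟶ Arrow.mk (freeStage f s.1).e :=
  (show (freeStage f s.1).stratum.cells k from s.2).1

theorem char_E {f : Arrow TopCat.{u}} {k : ℕ} (s : (free f).Cell k) :
    (free f).char s ≫ E f = (freeCellSquare s).right := by
  rw [char, Category.assoc, Category.assoc, toBody_E]
  exact (congrArg (_ ≫ ·) (Category.id_comp _)).trans ((freeStage f s.1).char_ext k s.2)

theorem hom_char_free {f : Arrow TopCat.{u}} {k : ℕ} (s : (free f).Cell k) :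
    diskBoundaryInclusion.{u} k ≫ (free f).char s =
      (freeCellSquare s).left ≫ (free f).toBody s.1 :=
  (free f).hom_char_mkCell s.2

/-- A cell of the free cell complex is determined by its boundary and by its map to the
codomain. -/
theorem freeCell_ext {f : Arrow TopCat.{u}} {k : ℕ} {s t : (free f).Cell k}
    (h₁ : diskBoundaryInclusion.{u} k ≫ (free f).char s =
      diskBoundaryInclusion.{u} k ≫ (free f).char t)
    (h₂ : (free f).char s ≫ E f = (free f).char t ≫ E f) : s = t := by
  rw [char_E, char_E] at h₂
  rw [hom_char_free, hom_char_free] at h₁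
  have e := IsNew.unique ((free f).isNew_attach s.1 k s.2) ((free f).isNew_attach t.1 k t.2) h₁
  obtain ⟨n, s, hs⟩ := s
  obtain ⟨m, t, ht⟩ := t
  obtain rfl : n = m := congrArg Sigma.fst e
  have e' : s.left = t.left := eq_of_heq (Sigma.mk.inj e).2
  obtain rfl : s = t := Arrow.hom_ext _ _ e' h₂
  rfl

/-- In the stage where the boundary is new, the free complex has a cell for every square. Uniqueness
of the cell is `freeCell_ext`. -/
theorem exists_freeCell (f : Arrow TopCat.{u}) (k : ℕ) (x : diskBoundary.{u} k ⟶ (free f).body)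
    (v : disk.{u} k ⟶ f.right) (w : x ≫ E f = diskBoundaryInclusion.{u} k ≫ v) :
    ∃ s : (free f).Cell k, diskBoundaryInclusion.{u} k ≫ (free f).char s = x ∧
      (free f).char s ≫ E f = v := by
  obtain ⟨n, c, hc, rfl⟩ := (free f).exists_isNew x
  have w' : c ≫ (freeStage f n).e = diskBoundaryInclusion.{u} k ≫ v := by
    rw [← toBody_E, ← Category.assoc]
    exact w
  exact ⟨freeCell f c hc v w', hom_char_free _, char_E _⟩

/-- The lifting structure on the right part of the factorisation: the filler of a square is the
characteristic map of the corresponding cell. -/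
noncomputable def freeLiftingStructure (f : Arrow TopCat.{u}) : Lifting cellMap.{u} (E f) where
  fill k x v w := (free f).char (exists_freeCell f k x v w).choose
  hom_fill k x v w := (exists_freeCell f k x v w).choose_spec.1
  fill_hom k x v w := (exists_freeCell f k x v w).choose_spec.2

/-- The chosen cell is the only one with this boundary and this map to the codomain, so the choice
in `freeLiftingStructure` is immaterial and every cell is a filler. -/
theorem char_eq_fill {f : Arrow TopCat.{u}} {k : ℕ} (s : (free f).Cell k) {x v} (w)
    (hx : diskBoundaryInclusion.{u} k ≫ (free f).char s = x) (hv : (free f).char s ≫ E f = v) :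
    (free f).char s = (freeLiftingStructure f).fill k x v w := by
  have h := (exists_freeCell f k x v w).choose_spec
  exact congrArg (free f).char (freeCell_ext (hx.trans h.1.symm) (hv.trans h.2.symm))

/-- The body of a morphism to a free cell complex sends characteristic maps to fillers. -/
theorem char_bodyMap_eq_fill {A : CellCx.{u}} {f : Arrow TopCat.{u}} (φ : A ⟶ free f) {k : ℕ}
    (s : A.Cell k) {x v} (w) (hx : diskBoundaryInclusion.{u} k ≫ A.char s ≫ bodyMap φ = x)
    (hv : A.char s ≫ bodyMap φ ≫ E f = v) :
    A.char s ≫ bodyMap φ = (freeLiftingStructure f).fill k x v w := by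
  rw [char_bodyMap] at hx ⊢
  refine char_eq_fill _ w hx ?_
  rw [← hv, ← Category.assoc, char_bodyMap]

/-- The free lifting structure on `f = Ef ∘ UKf`. -/
noncomputable def freeLifting : FreeLifting cellMap.{u} factorization.{u} where
  lifting := freeLiftingStructure
  fill_map {f g} φ k x v w w' := by
    refine char_bodyMap_eq_fill (K.map φ) _ w' ?_ ?_
    · rw [← Category.assoc]
      exact congrArg (· ≫ bodyMap (K.map φ)) ((freeLiftingStructure f).hom_fill k x v w)
    · refine (congrArg (_ ≫ ·) (factorization.R_naturality φ)).trans ?_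
      exact (Category.assoc _ _ _).symm.trans
        (congrArg (· ≫ φ.right) ((freeLiftingStructure f).fill_hom k x v w))
  exists_desc {f X Y g} Γ a b w := by
    -- Recursion over the cells of `Kf`: a cell is sent to the filler that `Γ` chooses for its
    -- boundary and for its map to the codomain followed by `b`.
    obtain ⟨h, h₁, h₂, h₃⟩ := (free f).exists_lift (p := g) (q := E f ≫ b) a
      (w.trans ((congrArg (· ≫ b) (toBody_E f 0).symm).trans (Category.assoc _ _ _)))
      (fun k s x e' => Γ.fill k x ((free f).char s ≫ E f ≫ b) e')
      (fun k s x e' => Γ.hom_fill k x _ e') (fun k s x e' => Γ.fill_hom k x _ e')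
    refine ⟨h, h₁, h₂, fun k x v w₁ w₂ => ?_⟩
    obtain ⟨hx, hv⟩ := (exists_freeCell f k x v w₁).choose_spec
    have e₁ : diskBoundaryInclusion k ≫ (free f).char (exists_freeCell f k x v w₁).choose ≫ h =
        x ≫ h := (Category.assoc _ _ _).symm.trans (congrArg (· ≫ h) hx)
    have e₂ : (free f).char (exists_freeCell f k x v w₁).choose ≫ E f ≫ b = v ≫ b := by
      rw [← Category.assoc, hv]
    refine (h₃ k (exists_freeCell f k x v w₁).choose ?_).trans (Γ.fill_congr e₁ e₂ _ _)
    rw [e₁, e₂]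
    exact w₂
  hom_ext {f X h h'} h₀ h₁ := by
    refine body_hom_ext_cells h₀ fun k s hs => ?_
    have w : (diskBoundaryInclusion k ≫ (free f).char s) ≫ E f =
        diskBoundaryInclusion k ≫ (free f).char s ≫ E f := Category.assoc _ _ _
    have e := char_eq_fill s w rfl rfl
    rw [e]
    refine h₁ k _ _ w ?_
    exact (Category.assoc _ _ _).trans (hs.trans (Category.assoc _ _ _).symm)

end CellCx

/-! ### Identification of the structure maps with the adjunction and with composites. -/

namespace CellCx

theorem map_homEquiv_freeCounit {A : CellCx.{u}} {f : Arrow TopCat.{u}} (h : U.obj A ⟶ f) :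
    U.map (adj.homEquiv A f h) ≫ freeCounit f = h := by
  have e : adj.homEquiv A f h = freeEquiv A f h :=
    congrFun (congrArg DFunLike.coe
      (congrFun (congrFun (Adjunction.mkOfHomEquiv_homEquiv _) A) f)) h
  rw [e]
  exact (freeEquiv A f).symm_apply_apply h

theorem homEquiv_base {A : CellCx.{u}} {f : Arrow TopCat.{u}} (h : U.obj A ⟶ f) :
    (CellCx.Hom.strat (B := free f) (adj.homEquiv A f h) 0).base = h.left :=
  (map_freeCounit_left (f := f) (adj.homEquiv A f h)).symm.trans
    (congrArg Arrow.Hom.left (map_homEquiv_freeCounit h))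

theorem bodyMap_homEquiv_E {A : CellCx.{u}} {f : Arrow TopCat.{u}} (h : U.obj A ⟶ f) :
    bodyMap (B := free f) (adj.homEquiv A f h) ≫ E f = h.right :=
  (map_freeCounit_right (f := f) (adj.homEquiv A f h)).symm.trans
    (congrArg Arrow.Hom.right (map_homEquiv_freeCounit h))

theorem map_bodyMap_homEquiv {A : CellCx.{u}} {f : Arrow TopCat.{u}} (h : U.obj A ⟶ f) :
    A.map ≫ bodyMap (B := free f) (adj.homEquiv A f h) = h.left ≫ (free f).map :=
  (toBody_bodyMap (B := free f) (adj.homEquiv A f h) 0).trans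
    (congrArg (· ≫ (free f).map) (homEquiv_base h))

/-- The body of any morphism into a free complex sends characteristic maps to fillers
(`char_bodyMap_eq_fill`). Induction over the cells of `A` makes this a recognition criterion for
adjoint transposes. -/
theorem bodyMap_homEquiv_eq {A : CellCx.{u}} {f : Arrow TopCat.{u}} (h : U.obj A ⟶ f)
    (m : A.body ⟶ (free f).body) (h₀ : A.map ≫ m = h.left ≫ (free f).map)
    (h₁ : ∀ (k : ℕ) (s : A.Cell k) w, A.char s ≫ m = (freeLiftingStructure f).fill k
      (diskBoundaryInclusion.{u} k ≫ A.char s ≫ m) (A.char s ≫ h.right) w) :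
    bodyMap (B := free f) (adj.homEquiv A f h) = m := by
  refine body_hom_ext_cells ((map_bodyMap_homEquiv h).trans h₀.symm) fun k s hs => ?_
  have hv : A.char s ≫ bodyMap (B := free f) (adj.homEquiv A f h) ≫ E f =
      A.char s ≫ h.right := congrArg (A.char s ≫ ·) (bodyMap_homEquiv_E h)
  have w : (diskBoundaryInclusion.{u} k ≫ A.char s ≫ m) ≫ E f =
      diskBoundaryInclusion.{u} k ≫ A.char s ≫ h.right := by
    rw [← hs, ← hv]
    simp only [Category.assoc]
  exact (char_bodyMap_eq_fill _ s w hs hv).trans (h₁ k s w).symm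

theorem freeLifting_comul (f : Arrow TopCat.{u}) :
    freeLifting.comul f = (adj.toComonad.δ.app f).right := by
  -- The comultiplication of the adjunction is `U` of the unit at `Kf`, and the unit is the
  -- transpose of the identity; this puts it within reach of the recognition criterion.
  have e : (adj.toComonad.δ.app f).right =
      bodyMap (B := free (U.obj (free f))) (adj.homEquiv (free f) (U.obj (free f)) (𝟙 _)) := by
    rw [Adjunction.homEquiv_id]
    rfl
  rw [e]
  refine (bodyMap_homEquiv_eq _ _ ?_ fun k s w => ?_).symm
  · exact (freeLifting.L_comul f).trans (Category.id_comp _).symm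
  · have w₀ : (diskBoundaryInclusion k ≫ (free f).char s) ≫ E f =
        diskBoundaryInclusion k ≫ (free f).char s ≫ E f := Category.assoc _ _ _
    have e₁ := char_eq_fill s w₀ rfl rfl
    refine (congrArg (· ≫ freeLifting.comul f) e₁).trans ?_
    refine (freeLifting.fill_comul f k _ _ w₀ (freeLifting.fill_comul_w f k _ _ w₀)).trans ?_
    exact Lifting.fill_congr (freeLiftingStructure (U.obj (free f))) (Category.assoc _ _ _)
      (e₁.symm.trans (Category.comp_id ((free f).char s)).symm) _ _

/-- Proved for an arbitrary composite by the recognition criterion, so no comparison between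
different composites is needed. -/
theorem freeLifting_mul {f : Arrow TopCat.{u}}
    (c : Composite (free f) (free (Arrow.mk (E f))) (baseEIso f)) :
    freeLifting.mul f = c.mul := by
  obtain ⟨m, hm⟩ : ∃ m : (free (Arrow.mk (E f))).body ⟶ (free f).body, m = freeLifting.mul f :=
    ⟨_, rfl⟩
  have h : (baseEIso f).hom ≫ (free (Arrow.mk (E f))).map ≫ m = 𝟙 _ := by
    rw [hm]
    exact (Category.id_comp _).trans (freeLifting.L_mul f)
  rw [← hm, Composite.mul, ← Iso.inv_hom_id_assoc c.bodyIso m]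
  refine congrArg (c.bodyIso.inv ≫ ·) (bodyMap_homEquiv_eq _ _ ?_ fun k s w => ?_).symm
  · rw [← Category.assoc, c.w]
    simp only [Category.assoc]
    refine (congrArg (fun t => c.baseIso.hom ≫ (free f).map ≫ t) h).trans ?_
    rw [Category.comp_id]
    rfl
  · have hE : (baseEIso f).hom ≫ (free (Arrow.mk (E f))).map ≫ E (Arrow.mk (E f)) = E f :=
      (Category.id_comp _).trans (toBody_E (Arrow.mk (E f)) 0)
    obtain ⟨s, rfl⟩ := (c.cells k).surjective s
    rcases s with s | t
    -- A cell of `Kf` lies in the base of `KEf`, where the multiplication is the identity by the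
    -- unit law.
    · have e : c.cx.char (c.cells k (Sum.inl s)) ≫ c.bodyIso.hom ≫ m =
          (free f).char s := by
        rw [← Category.assoc, c.char_inl]
        simp only [Category.assoc]
        exact (congrArg ((free f).char s ≫ ·) h).trans (Category.comp_id _)
      have e' : c.cx.char (c.cells k (Sum.inl s)) ≫ c.bodyIso.hom ≫ E (Arrow.mk (E f)) =
          (free f).char s ≫ E f := by
        rw [← Category.assoc, c.char_inl]
        simp only [Category.assoc]
        exact congrArg ((free f).char s ≫ ·) hE
      exact e.trans (char_eq_fill s w (congrArg (diskBoundaryInclusion k ≫ ·) e.symm) e'.symm)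
    -- A cell of `KEf` is a filler over `EEf`, and the multiplication preserves fillers.
    · have e : ∀ {Z : TopCat.{u}} (m : (free (Arrow.mk (E f))).body ⟶ Z),
          c.cx.char (c.cells k (Sum.inr t)) ≫ c.bodyIso.hom ≫ m =
            (free (Arrow.mk (E f))).char t ≫ m := fun m => by
        rw [← Category.assoc, c.char_inr]
      have w₀ : (diskBoundaryInclusion k ≫ (free (Arrow.mk (E f))).char t) ≫ E (Arrow.mk (E f)) =
        diskBoundaryInclusion k ≫ (free (Arrow.mk (E f))).char t ≫ E (Arrow.mk (E f)) :=
          Category.assoc _ _ _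
      have e₁ := char_eq_fill t w₀ rfl rfl
      refine (e m).trans
        ((congrArg (· ≫ m) e₁).trans ?_)
      subst hm
      refine (freeLifting.fill_mul f k _ _ w₀ (freeLifting.fill_mul_w f w₀)).trans ?_
      refine Lifting.fill_congr (freeLiftingStructure f) ?_ (e _).symm _ _
      exact (Category.assoc _ _ _).trans (congrArg (diskBoundaryInclusion k ≫ ·)
        (e (freeLifting.mul f)).symm)

theorem genStructure_right (k : ℕ) :
    (genStructure.{u} k).right = freeLifting.generator k := by
  have w₀ := (factorization.fac (cellMap.{u} k)).trans (Category.comp_id _).symm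
  refine char_eq_fill (f := cellMap k) _ w₀ ?_ (char_E (f := cellMap k) _)
  exact (hom_char_free (f := cellMap k) _).trans (Category.id_comp _)

/-! ### Existence of composites -/

section

variable {Z : TopCat.{u}} {I : ℕ → Type u} (r : ∀ k, I k → (disk.{u} k ⟶ Z))

/-- The stratum with one cell for each given map from a disk to `Z` with an allowed lift of its
boundary. -/
noncomputable abbrev FreeStage.restricted (T : FreeStage Z) : Stratum.{u} where
  X := T.X
  cells k := {p : I k × (diskBoundary.{u} k ⟶ T.X) //
    p.2 ≫ T.e = diskBoundaryInclusion.{u} k ≫ r k p.1 ∧ T.ok k p.2}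
  attach _ p := p.1.2

/-- The map from the body to `Z`. -/
noncomputable def FreeStage.restrictedExt (T : FreeStage Z) : (T.restricted r).body ⟶ Z :=
  (T.restricted r).desc T.e (fun k p => r k p.1.1) (fun _ p => p.2.1)

/-- The next stage of the restricted free cell complex. -/
noncomputable abbrev FreeStage.restrictedNext (T : FreeStage Z) : FreeStage Z where
  X := (T.restricted r).body
  e := T.restrictedExt r
  ok k b := ¬ ∃ c : diskBoundary.{u} k ⟶ T.X, c ≫ (T.restricted r).incl = b

/-- The stages of the restricted free cell complex. -/
noncomputable def restrictedStage {X : TopCat.{u}} (g : X ⟶ Z) : ℕ → FreeStage Z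
  | 0 => ⟨X, g, fun _ _ => True⟩
  | n + 1 => (restrictedStage g n).restrictedNext r

/-- The cell complex on `X` over `Z` that is free subject to the condition that the cells map to
`Z` by the given maps. -/
noncomputable abbrev restricted {X : TopCat.{u}} (g : X ⟶ Z) : CellCx.{u} where
  stratum n := (restrictedStage r g n).restricted r
  link _ := Iso.refl _
  proper n k s h := s.2.2 (by
    obtain ⟨c, hc⟩ := h
    exact ⟨c, (Category.comp_id _).symm.trans ((Category.assoc _ _ _).trans hc)⟩)

variable {X : TopCat.{u}} (g : X ⟶ Z)

theorem restricted_step (n : ℕ) :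
    (restricted r g).step n = ((restrictedStage r g n).restricted r).incl :=
  Category.comp_id _

theorem restricted_step_e (n : ℕ) :
    (restricted r g).step n ≫ (restrictedStage r g (n + 1)).e = (restrictedStage r g n).e := by
  rw [restricted_step]
  exact Stratum.incl_desc _ _ _ _

/-- The map from the body of the restricted free cell complex to `Z`. -/
noncomputable def restrictedE : (restricted r g).body ⟶ Z :=
  (restricted r g).desc (fun n => (restrictedStage r g n).e) (restricted_step_e r g)

theorem toBody_restrictedE (n : ℕ) :
    (restricted r g).toBody n ≫ restrictedE r g = (restrictedStage r g n).e :=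
  toBody_desc (restricted r g) (fun n => (restrictedStage r g n).e) (restricted_step_e r g) n

/-- The label of a cell. -/
def restrictedLabel {k : ℕ} (s : (restricted r g).Cell k) : I k :=
  (show ((restrictedStage r g s.1).restricted r).cells k from s.2).1.1

/-- The attaching map of a cell. -/
def restrictedAttach {k : ℕ} (s : (restricted r g).Cell k) :
    diskBoundary.{u} k ⟶ ((restricted r g).stratum s.1).X :=
  (show ((restrictedStage r g s.1).restricted r).cells k from s.2).1.2

theorem char_restrictedE {k : ℕ} (s : (restricted r g).Cell k) :
    (restricted r g).char s ≫ restrictedE r g = r k (restrictedLabel r g s) := by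
  rw [char, Category.assoc, Category.assoc, toBody_restrictedE]
  exact (congrArg (_ ≫ ·) (Category.id_comp _)).trans (Stratum.char_desc _ _ _ _ k s.2)

theorem hom_char_restricted {k : ℕ} (s : (restricted r g).Cell k) :
    diskBoundaryInclusion.{u} k ≫ (restricted r g).char s =
      restrictedAttach r g s ≫ (restricted r g).toBody s.1 :=
  (restricted r g).hom_char_mkCell s.2

/-- The boundary in the body fixes the stage and the attaching map by `IsNew.unique`; the label is
the only other datum of a cell. -/
theorem restrictedCell_ext {k : ℕ} {s t : (restricted r g).Cell k}
    (h₁ : diskBoundaryInclusion.{u} k ≫ (restricted r g).char s =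
      diskBoundaryInclusion.{u} k ≫ (restricted r g).char t)
    (h₂ : restrictedLabel r g s = restrictedLabel r g t) : s = t := by
  rw [hom_char_restricted, hom_char_restricted] at h₁
  have e := IsNew.unique ((restricted r g).isNew_attach s.1 k s.2)
    ((restricted r g).isNew_attach t.1 k t.2) h₁
  obtain ⟨n, ⟨i, c⟩, hs⟩ := s
  obtain ⟨m, ⟨i', c'⟩, ht⟩ := t
  obtain rfl : n = m := congrArg Sigma.fst e
  have e' : c = c' := eq_of_heq (Sigma.mk.inj e).2
  have h₂' : i = i' := h₂
  subst e' h₂'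
  rfl

theorem exists_restrictedCell (k : ℕ) (x : diskBoundary.{u} k ⟶ (restricted r g).body)
    (i : I k) (w : x ≫ restrictedE r g = diskBoundaryInclusion.{u} k ≫ r k i) :
    ∃ s : (restricted r g).Cell k, diskBoundaryInclusion.{u} k ≫ (restricted r g).char s = x ∧
      restrictedLabel r g s = i := by
  obtain ⟨n, c, hc, rfl⟩ := (restricted r g).exists_isNew x
  have w' : c ≫ (restrictedStage r g n).e = diskBoundaryInclusion.{u} k ≫ r k i := by
    rw [← toBody_restrictedE, ← Category.assoc]
    exact w
  have hok : (restrictedStage r g n).ok k c := by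
    cases n with
    | zero => exact True.intro
    | succ n =>
      rintro ⟨c', h⟩
      exact hc ⟨c', (congrArg (c' ≫ ·) (restricted_step r g n)).trans h⟩
  exact ⟨⟨n, ⟨(i, c), w', hok⟩⟩, hom_char_restricted r g _, rfl⟩

/-- The filler of a square into the restricted free cell complex. -/
noncomputable def restrictedFill (k : ℕ) (x : diskBoundary.{u} k ⟶ (restricted r g).body)
    (i : I k) (w : x ≫ restrictedE r g = diskBoundaryInclusion.{u} k ≫ r k i) :
    (restricted r g).Cell k :=
  (exists_restrictedCell r g k x i w).choose

theorem hom_restrictedFill (k : ℕ) (x i w) : diskBoundaryInclusion.{u} k ≫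
    (restricted r g).char (restrictedFill r g k x i w) = x :=
  (exists_restrictedCell r g k x i w).choose_spec.1

theorem label_restrictedFill (k : ℕ) (x i w) :
    restrictedLabel r g (restrictedFill r g k x i w) = i :=
  (exists_restrictedCell r g k x i w).choose_spec.2

theorem restrictedFill_E (k : ℕ) (x i w) :
    (restricted r g).char (restrictedFill r g k x i w) ≫ restrictedE r g = r k i := by
  rw [char_restrictedE, label_restrictedFill]

/-- If the restricted free cell complex has a section that sends the given maps to characteristic
maps, then its body is `Z` and its cells are the given maps. -/
theorem restricted_isIso (t : Z ⟶ (restricted r g).body) (h₀ : g ≫ t = (restricted r g).map)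
    (hE : t ≫ restrictedE r g = 𝟙 Z)
    (h₁ : ∀ k i w, r k i ≫ t = (restricted r g).char
      (restrictedFill r g k (diskBoundaryInclusion.{u} k ≫ r k i ≫ t) i w)) :
    restrictedE r g ≫ t = 𝟙 _ := by
  refine body_hom_ext_cells ?_ fun k s hs => ?_
  · have h : (restricted r g).map ≫ restrictedE r g = g := toBody_restrictedE r g 0
    rw [← Category.assoc, h, Category.comp_id]
    exact h₀
  · have e : (restricted r g).char s ≫ restrictedE r g ≫ t =
        r k (restrictedLabel r g s) ≫ t := by rw [← Category.assoc, char_restrictedE]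
    rw [e, Category.comp_id] at hs
    rw [e, Category.comp_id, h₁ k _ (by
      rw [Category.assoc, Category.assoc, hE, Category.comp_id])]
    -- The cell chosen by `h₁` has the same label as `s`, and by `hs` the same boundary, so it is
    -- `s`.
    refine congrArg (restricted r g).char (restrictedCell_ext r g ?_ ?_)
    · rw [hom_restrictedFill, hs]
    · rw [label_restrictedFill]

/-- There is one cell for each label and each lift of its boundary to the body; if the body is `Z`,
the lift exists and is unique. -/
theorem restrictedLabel_bijective (t : Z ⟶ (restricted r g).body)
    (hE : t ≫ restrictedE r g = 𝟙 Z) (ht : restrictedE r g ≫ t = 𝟙 _) (k : ℕ) :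
    Function.Bijective (restrictedLabel r g (k := k)) := by
  constructor
  · intro s s' h
    refine restrictedCell_ext r g ?_ h
    have e : ∀ s : (restricted r g).Cell k,
        (restricted r g).char s = r k (restrictedLabel r g s) ≫ t := fun s => by
      rw [← char_restrictedE r g, Category.assoc, ht, Category.comp_id]
    rw [e, e, h]
  · intro i
    exact ⟨restrictedFill r g k (diskBoundaryInclusion.{u} k ≫ r k i ≫ t) i (by
      rw [Category.assoc, Category.assoc, hE, Category.comp_id]), label_restrictedFill r g _ _ _ _⟩

end

/-- Cell complexes can be composed. -/
theorem nonempty_composite (A B : CellCx.{u}) (e : A.body ≅ B.base) :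
    Nonempty (Composite A B e) := by
  -- Labels are the cells of both complexes, with their characteristic maps in the body of `B`. The
  -- restricted free complex over that body attaches each at the earliest possible stage, which
  -- performs the moving down of the cells of `B`.
  let r : ∀ k, A.Cell k ⊕ B.Cell k → (disk.{u} k ⟶ B.body) := fun k =>
    Sum.elim (fun s => A.char s ≫ e.hom ≫ B.map) (fun t => B.char t)
  let g : A.base ⟶ B.body := A.map ≫ e.hom ≫ B.map
  -- The section `t` of `restrictedE` is built by recursion over the cells: first over those of `A`,
  -- giving `a`, then over those of `B`, starting from `a`.
  obtain ⟨a, ha₀, ha₁, ha₂⟩ := A.exists_lift (p := restrictedE r g) (q := e.hom ≫ B.map)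
    (restricted r g).map (toBody_restrictedE r g 0)
    (fun k s x w => (restricted r g).char (restrictedFill r g k x (Sum.inl s) w))
    (fun k s x w => hom_restrictedFill r g k x (Sum.inl s) w)
    (fun k s x w => restrictedFill_E r g k x (Sum.inl s) w)
  obtain ⟨t, ht₀, ht₁, ht₂⟩ := B.exists_lift (p := restrictedE r g) (q := 𝟙 B.body)
    (e.inv ≫ a) (by rw [Category.assoc, ha₁, Iso.inv_hom_id_assoc, Category.comp_id])
    (fun k s x w => (restricted r g).char (restrictedFill r g k x (Sum.inr s)
      (w.trans (congrArg (_ ≫ ·) (Category.comp_id _)))))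
    (fun k s x w => hom_restrictedFill r g k x _ _)
    (fun k s x w => (restrictedFill_E r g k x (Sum.inr s) _).trans (Category.comp_id _).symm)
  have hat : e.hom ≫ B.map ≫ t = a := by rw [ht₀, Iso.hom_inv_id_assoc]
  have h₀ : g ≫ t = (restricted r g).map := by
    rw [← ha₀, ← hat]
    simp only [g, Category.assoc]
  have hi := restricted_isIso r g t h₀ ht₁ (by
    rintro k (s | s) w
    · have e₁ : r k (Sum.inl s) ≫ t = A.char s ≫ a := by
        rw [← hat]
        simp only [r, Sum.elim_inl, Category.assoc]
      have w' := w
      rw [e₁] at w'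
      refine e₁.trans ((ha₂ k s w').trans ?_)
      simp only [e₁]
    · exact ht₂ k s (w.trans (congrArg (_ ≫ ·) (Category.comp_id _).symm)))
  let cells := fun k => Equiv.ofBijective _ (restrictedLabel_bijective r g t ht₁ hi k)
  have hchar : ∀ k i, (restricted r g).char ((cells k).symm i) ≫ restrictedE r g = r k i :=
    fun k i => (char_restrictedE r g _).trans
      (congrArg (r k) ((cells k).apply_symm_apply i))
  exact ⟨{
    cx := restricted r g
    baseIso := Iso.refl _
    bodyIso := ⟨restrictedE r g, t, hi, ht₁⟩
    w := (toBody_restrictedE r g 0).trans (Category.id_comp _).symm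
    cells := fun k => (cells k).symm
    char_inl := fun k s => hchar k (Sum.inl s)
    char_inr := fun k s => hchar k (Sum.inr s) }⟩

theorem isCellStructure : IsCellStructure freeLifting.{u}.awfsStructure where
  comul f := freeLifting_comul f
  mul f := by
    obtain ⟨c⟩ := nonempty_composite (free f) (free (Arrow.mk (E f))) (baseEIso f)
    exact ⟨c, freeLifting_mul c⟩

end CellCx

/-! ### The free monoid sequence -/

namespace FreeLifting

universe t

variable {C : Type u} [Category.{v} C] {ι : Type t} {j : ι → Arrow C}
  {F F' : FunctorialFactorization C}

/-- Transport of a free lifting structure along an isomorphism of functorial factorisations. -/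
def ofIso (Ψ : FreeLifting j F) (P : FunctorialFactorization.Hom F' F)
    (K : ∀ f, F.M.obj f ⟶ F'.M.obj f) (hKP : ∀ f, K f ≫ P.χ.app f = 𝟙 _)
    (hPK : ∀ f, P.χ.app f ≫ K f = 𝟙 _) : FreeLifting j F' :=
  have hw : ∀ {f : Arrow C} {k : ι} {u : (j k).left ⟶ F'.M.obj f} {v : (j k).right ⟶ f.right},
      u ≫ F'.R f = (j k).hom ≫ v → (u ≫ P.χ.app f) ≫ F.R f = (j k).hom ≫ v := fun {f} _ _ _ w => by
    rw [Category.assoc, P.comp_right, w]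
  have hKL : ∀ f, F.L f ≫ K f = F'.L f := fun f => by
    rw [← P.left_comp, Category.assoc, hPK, Category.comp_id]
  have hKR : ∀ f, K f ≫ F'.R f = F.R f := fun f => by
    rw [← P.comp_right, ← Category.assoc, hKP, Category.id_comp]
  -- The inverse is given only componentwise; its naturality follows from that of `P`.
  have hK : ∀ {f g : Arrow C} (φ : f ⟶ g), K f ≫ F'.M.map φ = F.M.map φ ≫ K g := fun {f g} φ => by
    rw [← Category.comp_id (F'.M.map φ), ← hPK, ← Category.assoc (F'.M.map φ), P.χ.naturality,
      Category.assoc, ← Category.assoc, hKP, Category.id_comp]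
  { lifting := fun f =>
      { fill := fun k u v w => (Ψ.lifting f).fill k (u ≫ P.χ.app f) v (hw w) ≫ K f
        hom_fill := fun k u v w => by
          rw [← Category.assoc, Lifting.hom_fill, Category.assoc, hPK, Category.comp_id]
        fill_hom := fun k u v w => by rw [Category.assoc, hKR, Lifting.fill_hom] }
    fill_map := fun {f g} φ k u v w w' => by
      dsimp only
      rw [Category.assoc, hK, ← Category.assoc, Ψ.fill_map φ k _ _ _ (fill_map_w φ (hw w))]
      refine congrArg (· ≫ K g) ((Ψ.lifting g).fill_congr ?_ rfl _ _)
      rw [Category.assoc, Category.assoc, P.χ.naturality]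
    exists_desc := fun {f X Y g} Γ a b w => by
      obtain ⟨h, h₁, h₂, h₃⟩ := Ψ.exists_desc Γ a b w
      refine ⟨P.χ.app f ≫ h, ?_, ?_, fun k u v w₁ w₂ => ?_⟩
      · rw [← Category.assoc, P.left_comp, h₁]
      · rw [Category.assoc, h₂, ← Category.assoc, P.comp_right]
      · dsimp only
        rw [Category.assoc, ← Category.assoc (K f), hKP, Category.id_comp,
          h₃ k _ _ _ (fill_w k _ v (hw w₁) h₂)]
        exact Γ.fill_congr (Category.assoc _ _ _) rfl _ _
    hom_ext := fun {f X h h'} h₀ h₁ => by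
      have e : K f ≫ h = K f ≫ h' := by
        refine Ψ.hom_ext ?_ fun k u v w hu => ?_
        · rw [← Category.assoc, ← Category.assoc, hKL, h₀]
        · have w' : (u ≫ K f) ≫ F'.R f = (j k).hom ≫ v := by rw [Category.assoc, hKR, w]
          have e := h₁ k (u ≫ K f) v w' (by simpa only [Category.assoc] using hu)
          have e' : (Ψ.lifting f).fill k u v w =
              (Ψ.lifting f).fill k ((u ≫ K f) ≫ P.χ.app f) v (hw w') :=
            (Ψ.lifting f).fill_congr (by rw [Category.assoc, hKP, Category.comp_id]) rfl _ _
          rw [e']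
          simpa only [Category.assoc] using e
      rw [← Category.id_comp h, ← Category.id_comp h', ← hPK, Category.assoc, e, Category.assoc] }

end FreeLifting

namespace FunctorialFactorization

variable {C : Type u} [Category.{v} C] {T F : FunctorialFactorization C}

/-- A map from a stage of the free monoid sequence to a factorisation with an action of `T`. -/
structure ActStage (act : Hom (T.comp F) F) (S : MonoidStage T) where
  p : Hom S.X F
  q : Hom S.Y F
  x_q : ∀ f, S.x.χ.app f ≫ q.χ.app f = p.χ.app f
  σ_q : ∀ f, S.σ.χ.app f ≫ q.χ.app f = T.M.map (p.rightTrans.app f) ≫ act.χ.app f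

/-- Naturality of the point of `T` and the unit law of the action. -/
theorem L_map_act {act : Hom (T.comp F) F}
    (hact : ∀ f, T.L (Arrow.mk (F.R f)) ≫ act.χ.app f = 𝟙 _) {G : FunctorialFactorization C}
    (q : Hom G F) (f : Arrow C) :
    T.L (Arrow.mk (G.R f)) ≫ T.M.map (q.rightTrans.app f) ≫ act.χ.app f = q.χ.app f := by
  refine (Category.assoc _ _ _).symm.trans ?_
  refine (congrArg (· ≫ act.χ.app f) (T.L_naturality (q.rightTrans.app f)).symm).trans ?_
  exact (Category.assoc _ _ _).trans
    ((congrArg (q.χ.app f ≫ ·) (hact f)).trans (Category.comp_id _))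

/-- Both legs equal `T` of the earlier map `p` followed by the action: one by functoriality, the
other by `σ_q` and the unit law. No associativity of the action is involved, since `T` acts here
only as a pointed object. -/
theorem ActStage.condition {act : Hom (T.comp F) F}
    (hact : ∀ f, T.L (Arrow.mk (F.R f)) ≫ act.χ.app f = 𝟙 _) {S : MonoidStage T}
    (Q : ActStage act S) : (T.compMap S.x).χ ≫ ((T.compMap Q.q).comp act).χ =
      (S.σ.comp (T.point S.Y)).χ ≫ ((T.compMap Q.q).comp act).χ := by
  ext f
  have h₁ : T.M.map (S.x.rightTrans.app f) ≫ T.M.map (Q.q.rightTrans.app f) =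
      T.M.map (Q.p.rightTrans.app f) := by
    rw [← T.M.map_comp]
    exact congrArg T.M.map (Arrow.hom_ext _ _ (Q.x_q f) (Category.comp_id _))
  refine Eq.trans (b := T.M.map (Q.p.rightTrans.app f) ≫ act.χ.app f) ?_ ?_
  · exact (Category.assoc _ _ _).symm.trans (congrArg (· ≫ act.χ.app f) h₁)
  · refine (Q.σ_q f).symm.trans ?_
    exact (congrArg (S.σ.χ.app f ≫ ·) (L_map_act hact Q.q f).symm).trans (Category.assoc _ _ _).symm

variable [HasCoequalizers C] (act : Hom (T.comp F) F)
  (hact : ∀ f, T.L (Arrow.mk (F.R f)) ≫ act.χ.app f = 𝟙 _)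

/-- The first stage. -/
noncomputable def actStageZero : ActStage act (monoidStage T 0) where
  p :=
    { χ := { app := F.L, naturality := fun _ _ φ => F.L_naturality φ }
      left_comp := fun _ => Category.id_comp _
      comp_right := F.fac }
  q :=
    { χ :=
        { app := fun f => T.M.map (F.unit.app f) ≫ act.χ.app f
          naturality := fun f g φ => by
            refine Eq.trans ?_ (Category.assoc _ _ _).symm
            refine Eq.trans ?_ (congrArg (T.M.map (F.unit.app f) ≫ ·) (act.χ.naturality φ))
            refine (Category.assoc _ _ _).symm.trans
              (Eq.trans ?_ (Category.assoc _ _ _))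
            refine congrArg (· ≫ act.χ.app g) ?_
            refine (T.M.map_comp _ _).symm.trans
              (Eq.trans ?_ (T.M.map_comp (F.unit.app f) (F.right.map φ)))
            exact congrArg T.M.map (F.unit.naturality φ) }
      left_comp := fun f => by
        refine (Category.assoc _ _ _).symm.trans ?_
        refine (congrArg (· ≫ act.χ.app f) (T.L_naturality (F.unit.app f)).symm).trans ?_
        refine (Category.assoc _ _ _).trans ?_
        exact (congrArg (F.L f ≫ ·) (hact f)).trans (Category.comp_id _)
      comp_right := fun f => by
        refine (Category.assoc _ _ _).trans ?_
        refine (congrArg (T.M.map (F.unit.app f) ≫ ·) (act.comp_right f)).trans ?_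
        exact (T.R_naturality (F.unit.app f)).trans (Category.comp_id _) }
  x_q f := by
    refine (Category.assoc _ _ _).symm.trans ?_
    refine (congrArg (· ≫ act.χ.app f) (T.L_naturality (F.unit.app f)).symm).trans ?_
    refine (Category.assoc _ _ _).trans ?_
    exact (congrArg (F.L f ≫ ·) (hact f)).trans (Category.comp_id _)
  σ_q f := Category.id_comp _

/-- The stages of the map from the free monoid sequence. -/
noncomputable def actStage : ∀ n, ActStage act (monoidStage T n)
  | 0 => actStageZero act hact
  | n + 1 =>
    let S := monoidStage T n
    let Q := actStage n
    -- The defining equation of the map out of the coequaliser is precisely the compatibility `σ_q`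
    -- required of the next stage.
    have hπ : ∀ f, (coequalizer.π (T.compMap S.x).χ (S.σ.comp (T.point S.Y)).χ).app f ≫
        (coequalizer.desc _ (Q.condition hact)).app f =
          T.M.map (Q.q.rightTrans.app f) ≫ act.χ.app f := fun f =>
      NatTrans.congr_app (coequalizer.π_desc _ (Q.condition hact)) f
    have h₂ := L_map_act hact Q.q
    { p := Q.q
      q :=
        { χ := coequalizer.desc _ (Q.condition hact)
          left_comp := fun f => by
            refine (Category.assoc _ _ _).trans ?_
            refine (congrArg (_ ≫ ·) (hπ f)).trans ?_
            refine (Category.assoc _ _ _).trans ?_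
            exact (congrArg (S.Y.L f ≫ ·) (h₂ f)).trans (Q.q.left_comp f)
          comp_right := fun f => by
            have e : coequalizer.desc _ (Q.condition hact) ≫ F.trans =
                (coeq (T.compMap S.x) (S.σ.comp (T.point S.Y))).trans := by
              refine coequalizer.hom_ext ?_
              rw [← Category.assoc, coequalizer.π_desc]
              ext f
              refine ((T.compMap Q.q).comp act).comp_right f |>.trans ?_
              exact ((coeqProj (T.compMap S.x) (S.σ.comp (T.point S.Y))).comp_right f).symm
            exact NatTrans.congr_app e f }
      x_q := fun f => by
        refine (Category.assoc _ _ _).trans ?_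
        exact (congrArg (_ ≫ ·) (hπ f)).trans (h₂ f)
      σ_q := hπ }

/-- The map from the `n`-th term of the free monoid sequence. -/
noncomputable def actMap (n : ℕ) : Hom (T.term n) F := (actStage act hact n).p

theorem termMap_actMap (n : ℕ) (f : Arrow C) : (T.termMap n).χ.app f ≫
    (actMap act hact (n + 1)).χ.app f = (actMap act hact n).χ.app f :=
  (actStage act hact n).x_q f

theorem termAct_actMap (n : ℕ) (f : Arrow C) : (T.termAct n).χ.app f ≫
    (actMap act hact (n + 1)).χ.app f =
      T.M.map ((actMap act hact n).rightTrans.app f) ≫ act.χ.app f :=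
  (actStage act hact n).σ_q f

variable (T) in
-- For `n > 0` the connecting map is defined this way; for `n = 0` the action is the identity and
-- the connecting map is the point of `T`.
theorem L_termAct (n : ℕ) (f : Arrow C) :
    T.L (Arrow.mk ((T.term n).R f)) ≫ (T.termAct n).χ.app f = (T.termMap n).χ.app f := by
  cases n with
  | zero => exact Category.comp_id _
  | succ n => rfl

variable (T) in
theorem map_termMap_termAct (n : ℕ) (f : Arrow C) :
    T.M.map ((T.termMap n).rightTrans.app f) ≫ (T.termAct (n + 1)).χ.app f =
      (T.termAct n).χ.app f ≫ (T.termMap (n + 1)).χ.app f := by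
  have h := NatTrans.congr_app (coequalizer.condition (T.compMap (monoidStage T n).x).χ
    ((monoidStage T n).σ.comp (T.point (monoidStage T n).Y)).χ) f
  exact h.trans (Category.assoc _ _ _)

variable (T) in
-- Coequaliser projections are epimorphisms of functors, and pushouts make these pointwise. Hence
-- each term is covered by one-step cells over the previous one.
theorem epi_termAct [HasPushouts C] (n : ℕ) (f : Arrow C) : Epi ((T.termAct n).χ.app f) := by
  cases n with
  | zero => exact inferInstanceAs (Epi (𝟙 (T.M.obj f)))
  | succ n =>
    exact inferInstanceAs (Epi ((coequalizer.π (T.compMap (monoidStage T n).x).χ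
      ((monoidStage T n).σ.comp (T.point (monoidStage T n).Y)).χ).app f))

variable [HasColimitsOfShape ℕ C]

/-- The map from the colimit of the free monoid sequence to a factorisation with an action. -/
noncomputable def fromColim : Hom T.colim F where
  χ := colimit.desc T.termSeq
    { pt := F.M
      ι := NatTrans.ofSequence (G := (Functor.const ℕ).obj F.M)
        (fun n => (actMap act hact n).χ) (fun n => by
          rw [termSeq_map]
          refine Eq.trans ?_ (Category.comp_id _).symm
          ext f
          exact termMap_actMap act hact n f) }
  left_comp f := NatTrans.congr_app (colimit.ι_desc _ 0) f
  comp_right f := by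
    have e : colimit.desc T.termSeq
        { pt := F.M
          ι := NatTrans.ofSequence (G := (Functor.const ℕ).obj F.M)
            (fun n => (actMap act hact n).χ) (fun n => by
              rw [termSeq_map]
              refine Eq.trans ?_ (Category.comp_id _).symm
              ext f
              exact termMap_actMap act hact n f) } ≫ F.trans = T.colimTrans := by
      refine colimit.hom_ext fun n => ?_
      rw [← Category.assoc, colimit.ι_desc]
      refine Eq.trans ?_ (T.toColim_colimTrans n).symm
      ext f
      exact (actMap act hact n).comp_right f
    exact NatTrans.congr_app e f

theorem ι_fromColim (n : ℕ) (f : Arrow C) :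
    (T.ι n).χ.app f ≫ (fromColim act hact).χ.app f = (actMap act hact n).χ.app f :=
  NatTrans.congr_app (colimit.ι_desc _ n) f

variable (T) in
theorem termMap_ι (n : ℕ) (f : Arrow C) :
    (T.termMap n).χ.app f ≫ (T.ι (n + 1)).χ.app f = (T.ι n).χ.app f :=
  NatTrans.congr_app (T.termMap_toColim n) f

variable {f : Arrow C} {Z : C} in
theorem colim_hom_ext {a b : T.colim.M.obj f ⟶ Z}
    (h : ∀ n, (T.ι n).χ.app f ≫ a = (T.ι n).χ.app f ≫ b) : a = b :=
  (isColimitOfPreserves ((evaluation _ _).obj f) (colimit.isColimit T.termSeq)).hom_ext h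

end FunctorialFactorization

/-! ### The action of the one-step factorisation on a free lifting structure. -/

namespace Garner

open FunctorialFactorization

theorem char_oneStep_map {f g : Arrow TopCat.{u}} (φ : f ⟶ g) (k : ℕ) (s : cellMap k ⟶ f) :
    (oneStratum f).char k s ≫ oneStep.{u}.M.map φ = (oneStratum g).char k (s ≫ φ) :=
  Stratum.char_bodyMap (oneStratumMap φ) k s

theorem char_oneExt (f : Arrow TopCat.{u}) (k : ℕ) (s : cellMap k ⟶ f) :
    (oneStratum f).char k s ≫ oneExt f = s.right :=
  Stratum.char_desc (oneStratum f) _ _ _ k s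

section

variable {F : FunctorialFactorization TopCat.{u}} (Ψ : FreeLifting cellMap.{u} F)

/-- The action of the one-step factorisation given by a lifting structure. -/
noncomputable def oneActMap (f : Arrow TopCat.{u}) :
    (oneStratum (Arrow.mk (F.R f))).body ⟶ F.M.obj f :=
  (oneStratum (Arrow.mk (F.R f))).desc (𝟙 _)
    (fun k s => (Ψ.lifting f).fill k s.left s.right s.w)
    (fun k _ => (Category.comp_id _).trans ((Ψ.lifting f).hom_fill k _ _ _).symm)

theorem incl_oneActMap (f : Arrow TopCat.{u}) :
    (oneStratum (Arrow.mk (F.R f))).incl ≫ oneActMap Ψ f = 𝟙 _ :=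
  Stratum.incl_desc _ _ _ _

theorem char_oneActMap (f : Arrow TopCat.{u}) (k : ℕ) (s : cellMap k ⟶ Arrow.mk (F.R f)) :
    (oneStratum (Arrow.mk (F.R f))).char k s ≫ oneActMap Ψ f =
      (Ψ.lifting f).fill k s.left s.right s.w :=
  Stratum.char_desc _ _ _ _ _ _

/-- The action as a morphism of functorial factorisations. -/
noncomputable def oneAct : FunctorialFactorization.Hom (oneStep.{u}.comp F) F where
  χ :=
    { app := oneActMap Ψ
      naturality := fun f g φ => by
        apply Stratum.body_hom_ext
        · refine (Category.assoc _ _ _).symm.trans ?_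
          refine (congrArg (· ≫ oneActMap Ψ g)
            (oneStep.{u}.L_naturality (F.right.map φ)).symm).trans ?_
          refine (Category.assoc _ _ _).trans ?_
          refine (congrArg (F.M.map φ ≫ ·) (incl_oneActMap Ψ g)).trans ?_
          refine (Category.comp_id _).trans ?_
          refine Eq.trans ?_ (Category.assoc _ _ _)
          exact (Category.id_comp _).symm.trans
            (congrArg (· ≫ F.M.map φ) (incl_oneActMap Ψ f).symm)
        · intro k s
          refine (Category.assoc _ _ _).symm.trans ?_
          refine (congrArg (· ≫ oneActMap Ψ g)
            (char_oneStep_map (F.right.map φ) k s)).trans ?_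
          refine (char_oneActMap Ψ g k _).trans ?_
          refine Eq.trans ?_ (Category.assoc _ _ _)
          refine Eq.trans ?_ (congrArg (· ≫ F.M.map φ) (char_oneActMap Ψ f k s).symm)
          exact (Ψ.fill_map φ k _ _ _ (s ≫ F.right.map φ).w).symm }
  left_comp f := by
    refine (Category.assoc _ _ _).trans ?_
    exact (congrArg (F.L f ≫ ·) (incl_oneActMap Ψ f)).trans (Category.comp_id _)
  comp_right f := by
    apply Stratum.body_hom_ext
    · refine (Category.assoc _ _ _).symm.trans ?_
      refine (congrArg (· ≫ F.R f) (incl_oneActMap Ψ f)).trans ?_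
      exact (Category.id_comp _).trans (oneStep.{u}.fac (Arrow.mk (F.R f))).symm
    · intro k s
      refine (Category.assoc _ _ _).symm.trans ?_
      refine (congrArg (· ≫ F.R f) (char_oneActMap Ψ f k s)).trans ?_
      exact ((Ψ.lifting f).fill_hom k _ _ _).trans (char_oneExt (Arrow.mk (F.R f)) k s).symm

/-- The map from the `n`-th term of the free monoid sequence to a free lifting structure. -/
noncomputable def termTo (n : ℕ) : FunctorialFactorization.Hom (oneStep.{u}.term n) F :=
  actMap (oneAct Ψ) (incl_oneActMap Ψ) n

/-- The action attaches a cell for each square, and the comparison sends that cell to the filler of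
the image square. -/
theorem char_termAct_termTo (n : ℕ) (f : Arrow TopCat.{u}) (k : ℕ)
    (s : cellMap k ⟶ Arrow.mk ((oneStep.{u}.term n).R f)) (w) :
    (oneStratum (Arrow.mk ((oneStep.{u}.term n).R f))).char k s ≫
      (oneStep.{u}.termAct n).χ.app f ≫ (termTo Ψ (n + 1)).χ.app f =
        (Ψ.lifting f).fill k (s.left ≫ (termTo Ψ n).χ.app f) s.right w := by
  refine (congrArg (_ ≫ ·) (termAct_actMap (oneAct Ψ) (incl_oneActMap Ψ) n f)).trans ?_
  refine (Category.assoc _ _ _).symm.trans ?_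
  refine (congrArg (· ≫ oneActMap Ψ f)
    (char_oneStep_map ((termTo Ψ n).rightTrans.app f) k s)).trans ?_
  refine (char_oneActMap Ψ f k _).trans ?_
  exact (Ψ.lifting f).fill_congr rfl (Category.comp_id _) _ _

theorem termMap_termTo (n : ℕ) (f : Arrow TopCat.{u}) :
    (oneStep.{u}.termMap n).χ.app f ≫ (termTo Ψ (n + 1)).χ.app f = (termTo Ψ n).χ.app f :=
  termMap_actMap _ _ n f

/-- The comparison map from the colimit of the free monoid sequence. -/
noncomputable def colimTo : FunctorialFactorization.Hom factorization F :=
  fromColim (oneAct Ψ) (incl_oneActMap Ψ)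

theorem ι_colimTo (n : ℕ) (f : Arrow TopCat.{u}) :
    (oneStep.{u}.ι n).χ.app f ≫ (colimTo Ψ).χ.app f = (termTo Ψ n).χ.app f :=
  ι_fromColim (oneAct Ψ) (incl_oneActMap Ψ) n f

end

/-! ### The stages of the free cell complex and the free monoid sequence -/

open CellCx

variable (f : Arrow TopCat.{u})

/-- The cell of the `n`-th action given by a square. -/
noncomputable def actCell (n : ℕ) {k : ℕ} (x : diskBoundary.{u} k ⟶ (oneStep.{u}.term n).M.obj f)
    (v : disk.{u} k ⟶ f.right)
    (w : x ≫ (oneStep.{u}.term n).R f = diskBoundaryInclusion.{u} k ≫ v) :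
    disk.{u} k ⟶ (oneStep.{u}.term (n + 1)).M.obj f :=
  (oneStratum (Arrow.mk ((oneStep.{u}.term n).R f))).char k
    (Arrow.homMk x v w : cellMap k ⟶ Arrow.mk ((oneStep.{u}.term n).R f)) ≫
      (oneStep.{u}.termAct n).χ.app f

theorem actCell_congr (n : ℕ) {k : ℕ} {x x' : diskBoundary.{u} k ⟶ (oneStep.{u}.term n).M.obj f}
    (hx : x = x') (v w w') : actCell f n x v w = actCell f n x' v w' := by
  subst hx
  rfl

theorem hom_actCell (n : ℕ) {k : ℕ} (x : diskBoundary.{u} k ⟶ (oneStep.{u}.term n).M.obj f) (v w) :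
    diskBoundaryInclusion.{u} k ≫ actCell f n x v w = x ≫ (oneStep.{u}.termMap n).χ.app f := by
  rw [← L_termAct oneStep.{u} n f]
  refine (Category.assoc _ _ _).symm.trans (Eq.trans ?_ (Category.assoc _ _ _))
  exact congrArg (· ≫ (oneStep.{u}.termAct n).χ.app f) (Stratum.attach_incl
    (oneStratum (Arrow.mk ((oneStep.{u}.term n).R f))) k _).symm

theorem actCell_R (n : ℕ) {k : ℕ} (x : diskBoundary.{u} k ⟶ (oneStep.{u}.term n).M.obj f) (v w) :
    actCell f n x v w ≫ (oneStep.{u}.term (n + 1)).R f = v := by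
  refine (Category.assoc _ _ _).trans ?_
  refine (congrArg (_ ≫ ·) ((oneStep.{u}.termAct n).comp_right f)).trans ?_
  exact char_oneExt _ k _

/-- The coequaliser relation on cells: attaching a square at stage `n` and again at stage `n + 1`
gives the same cell. Properness of the free complex has the same effect by omitting the second cell.
-/
theorem actCell_termMap (n : ℕ) {k : ℕ} (x : diskBoundary.{u} k ⟶ (oneStep.{u}.term n).M.obj f)
    (v w w') : actCell f n x v w ≫ (oneStep.{u}.termMap (n + 1)).χ.app f =
      actCell f (n + 1) (x ≫ (oneStep.{u}.termMap n).χ.app f) v w' := by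
  refine (Category.assoc _ _ _).trans ?_
  refine (congrArg (_ ≫ ·) (map_termMap_termAct oneStep.{u} n f).symm).trans ?_
  refine (Category.assoc _ _ _).symm.trans ?_
  refine congrArg (· ≫ (oneStep.{u}.termAct (n + 1)).χ.app f) ?_
  refine (char_oneStep_map ((oneStep.{u}.termMap n).rightTrans.app f) k _).trans ?_
  refine congrArg (Stratum.char _ k) ?_
  exact Arrow.hom_ext _ _ rfl (Category.comp_id _)

theorem term_hom_ext (n : ℕ) {Z : TopCat.{u}} {a b : (oneStep.{u}.term (n + 1)).M.obj f ⟶ Z}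
    (h₀ : (oneStep.{u}.termMap n).χ.app f ≫ a = (oneStep.{u}.termMap n).χ.app f ≫ b)
    (h₁ : ∀ k (x : diskBoundary.{u} k ⟶ (oneStep.{u}.term n).M.obj f) v w,
      actCell f n x v w ≫ a = actCell f n x v w ≫ b) : a = b := by
  have := epi_termAct oneStep.{u} n f
  rw [← cancel_epi ((oneStep.{u}.termAct n).χ.app f)]
  apply Stratum.body_hom_ext
  · rw [← L_termAct oneStep.{u} n f] at h₀
    exact (Category.assoc _ _ _).symm.trans (h₀.trans (Category.assoc _ _ _))
  · intro k s
    exact (Category.assoc _ _ _).symm.trans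
      ((h₁ k s.left s.right s.w).trans (Category.assoc _ _ _))

/-- A map from a stage of the free cell complex to the free monoid sequence. -/
structure StageTo (n : ℕ) where
  κ : (freeStage f n).X ⟶ (oneStep.{u}.term n).M.obj f
  w : κ ≫ (oneStep.{u}.term n).R f = (freeStage f n).e

variable {f} in
theorem StageTo.cell_w {n : ℕ} (S : StageTo f n) {k : ℕ}
    (s : (freeStage f n).stratum.cells k) : (s.1.left ≫ S.κ) ≫ (oneStep.{u}.term n).R f =
      diskBoundaryInclusion.{u} k ≫ s.1.right := by
  rw [Category.assoc, S.w]
  exact s.1.w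

/-- The next stage. -/
noncomputable def StageTo.next {f : Arrow TopCat.{u}} {n : ℕ} (S : StageTo f n) :
    StageTo f (n + 1) where
  κ := (freeStage f n).stratum.desc (S.κ ≫ (oneStep.{u}.termMap n).χ.app f)
    (fun k s => actCell f n (s.1.left ≫ S.κ) s.1.right (S.cell_w s))
    (fun k s => (Category.assoc _ _ _).symm.trans (hom_actCell f n _ _ _).symm)
  w := by
    apply Stratum.body_hom_ext
    · refine (Category.assoc _ _ _).symm.trans ?_
      refine (congrArg (· ≫ (oneStep.{u}.term (n + 1)).R f) (Stratum.incl_desc _ _ _ _)).trans ?_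
      refine (Category.assoc _ _ _).trans ?_
      refine (congrArg (S.κ ≫ ·) ((oneStep.{u}.termMap n).comp_right f)).trans ?_
      exact S.w.trans (freeStage f n).incl_ext.symm
    · intro k s
      refine (Category.assoc _ _ _).symm.trans ?_
      refine (congrArg (· ≫ (oneStep.{u}.term (n + 1)).R f)
        (Stratum.char_desc _ _ _ _ k s)).trans ?_
      exact (actCell_R f n _ _ _).trans ((freeStage f n).char_ext k s).symm

/-- The maps from the stages of the free cell complex to the free monoid sequence. -/
noncomputable def stageTo : ∀ n, StageTo f n
  | 0 => ⟨𝟙 f.left, Category.id_comp _⟩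
  | n + 1 => (stageTo n).next

/-- The map from the `n`-th stage of the free cell complex to the `n`-th term of the free monoid
sequence. -/
noncomputable def stageMap (n : ℕ) : ((free f).stratum n).X ⟶ (oneStep.{u}.term n).M.obj f :=
  (stageTo f n).κ

theorem step_stageMap (n : ℕ) : (free f).step n ≫ stageMap f (n + 1) =
    stageMap f n ≫ (oneStep.{u}.termMap n).χ.app f :=
  (congrArg (· ≫ stageMap f (n + 1)) (free_step f n)).trans (Stratum.incl_desc _ _ _ _)

theorem char_stageMap (n k : ℕ) (s : (freeStage f n).stratum.cells k) (w) :
    (freeStage f n).stratum.char k s ≫ stageMap f (n + 1) =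
      actCell f n (s.1.left ≫ stageMap f n) s.1.right w :=
  Stratum.char_desc _ _ _ _ _ _

/-- The sequence of terms attaches the square of a cell again at each later stage; by
`actCell_termMap`, applied once per stage, the copy at stage `n` is the image of the cell attached
at stage `m`. -/
theorem char_stepMap_stageMap {m n : ℕ} (h : m ≤ n) (k : ℕ)
    (s : (freeStage f m).stratum.cells k) (w) :
    (freeStage f m).stratum.char k s ≫ (free f).stepMap (Nat.succ_le_succ h) ≫
      stageMap f (n + 1) =
        actCell f n (s.1.left ≫ (free f).stepMap h ≫ stageMap f n) s.1.right w := by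
  induction n, h using Nat.le_induction with
  | base =>
    have e : s.1.left ≫ (free f).stepMap (le_refl m) ≫ stageMap f m = s.1.left ≫ stageMap f m := by
      rw [stepMap_self]
      exact congrArg (s.1.left ≫ ·) (Category.id_comp _)
    have e' : (free f).stepMap (le_refl (m + 1)) ≫ stageMap f (m + 1) = stageMap f (m + 1) := by
      rw [stepMap_self]
      exact Category.id_comp _
    have w' := w
    rw [e] at w'
    exact (congrArg ((freeStage f m).stratum.char k s ≫ ·) e').trans
      ((char_stageMap f m k s w').trans (actCell_congr f m e.symm _ _ _))
  | succ n h ih =>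
    have e : s.1.left ≫ (free f).stepMap (Nat.le_succ_of_le h) ≫ stageMap f (n + 1) =
        (s.1.left ≫ (free f).stepMap h ≫ stageMap f n) ≫ (oneStep.{u}.termMap n).χ.app f := by
      rw [stepMap_succ (free f) h, Category.assoc ((free f).stepMap h), step_stageMap]
      simp only [Category.assoc]
    have e' : (free f).stepMap (Nat.succ_le_succ (Nat.le_succ_of_le h)) ≫ stageMap f (n + 1 + 1) =
        ((free f).stepMap (Nat.succ_le_succ h) ≫ stageMap f (n + 1)) ≫
          (oneStep.{u}.termMap (n + 1)).χ.app f := by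
      rw [stepMap_succ (free f) (Nat.succ_le_succ h), Category.assoc, step_stageMap,
        Category.assoc]
    have w₁ : (s.1.left ≫ (free f).stepMap h ≫ stageMap f n) ≫ (oneStep.{u}.term n).R f =
        diskBoundaryInclusion.{u} k ≫ s.1.right := by
      rw [← w, e]
      refine Eq.trans ?_ (Category.assoc _ _ _).symm
      exact congrArg (_ ≫ ·) ((oneStep.{u}.termMap n).comp_right f).symm
    have w₂ := w
    rw [e] at w₂
    refine (congrArg ((freeStage f m).stratum.char k s ≫ ·) e').trans ?_
    refine (Category.assoc _ _ _).symm.trans ?_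
    refine (congrArg (· ≫ (oneStep.{u}.termMap (n + 1)).χ.app f) (ih w₁)).trans ?_
    exact (actCell_termMap f n _ _ w₁ w₂).trans (actCell_congr f _ e.symm _ _ _)

/-- The map from the `n`-th term of the free monoid sequence to the body of the free cell
complex. -/
noncomputable def termBody (n : ℕ) : (oneStep.{u}.term n).M.obj f ⟶ (free f).body :=
  (termTo freeLifting n).χ.app f

theorem termMap_termBody (n : ℕ) :
    (oneStep.{u}.termMap n).χ.app f ≫ termBody f (n + 1) = termBody f n :=
  termMap_termTo freeLifting n f

theorem actCell_termBody (n : ℕ) {k : ℕ}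
    (x : diskBoundary.{u} k ⟶ (oneStep.{u}.term n).M.obj f) (v w w') :
    actCell f n x v w ≫ termBody f (n + 1) =
      (freeLiftingStructure f).fill k (x ≫ termBody f n) v w' :=
  (Category.assoc _ _ _).trans (char_termAct_termTo freeLifting n f k _ w')

theorem termBody_E (n : ℕ) : termBody f n ≫ E f = (oneStep.{u}.term n).R f :=
  (termTo freeLifting n).comp_right f

/-- Cell by cell: a cell goes to its copy in the sequence of terms, then to the filler of its square
in the body, which is the cell itself by `char_eq_fill`. -/
theorem stageMap_termBody (n : ℕ) : stageMap f n ≫ termBody f n = (free f).toBody n := by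
  induction n with
  | zero => exact Category.id_comp _
  | succ n ih =>
    apply Stratum.body_hom_ext
    · have h : (free f).step n ≫ stageMap f (n + 1) ≫ termBody f (n + 1) =
          (free f).step n ≫ (free f).toBody (n + 1) := by
        rw [← Category.assoc, step_stageMap, Category.assoc, termMap_termBody, ih, step_toBody]
      rw [free_step] at h
      exact h
    · intro k s
      have w := (stageTo f n).cell_w s
      have e : (s.1.left ≫ stageMap f n) ≫ termBody f n =
          diskBoundaryInclusion k ≫ (free f).char ((free f).mkCell s) := by
        rw [hom_char_mkCell, Category.assoc, ih]
      have hE : (free f).char ((free f).mkCell s) ≫ E f = s.1.right := char_E _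
      have w' : ((s.1.left ≫ stageMap f n) ≫ termBody f n) ≫ E f =
          diskBoundaryInclusion k ≫ s.1.right := by
        rw [e, ← hE]
        exact Category.assoc _ _ _
      refine (Category.assoc _ _ _).symm.trans ?_
      refine (congrArg (· ≫ termBody f (n + 1)) (char_stageMap f n k s w)).trans ?_
      refine (actCell_termBody f n _ _ w w').trans ?_
      refine (char_eq_fill ((free f).mkCell s) w' e.symm hE).symm.trans ?_
      exact congrArg (_ ≫ ·) (Category.id_comp _)

/-- The cells of the `n`-th action lie in the `(n + 1)`-st stage of the free cell complex. -/
theorem exists_actCell_termBody {n : ℕ} (q : (oneStep.{u}.term n).M.obj f ⟶ ((free f).stratum n).X)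
    (hq : q ≫ (free f).toBody n = termBody f n) (hq' : q ≫ stageMap f n = 𝟙 _) {k : ℕ}
    (x : diskBoundary.{u} k ⟶ (oneStep.{u}.term n).M.obj f) (v w) :
    ∃ d : disk.{u} k ⟶ ((free f).stratum (n + 1)).X,
      d ≫ (free f).toBody (n + 1) = actCell f n x v w ≫ termBody f (n + 1) ∧
      d ≫ stageMap f (n + 1) = actCell f n x v w := by
  have w' : (x ≫ termBody f n) ≫ E f = diskBoundaryInclusion k ≫ v := by
    rw [Category.assoc, termBody_E, w]
  -- Push the square into the body, where a unique cell fills it; its stage `m` is determined by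
  -- newness and may well be earlier than `n`.
  obtain ⟨⟨m, s⟩, hs, hv⟩ := exists_freeCell f k (x ≫ termBody f n) v w'
  have hs' : s.1.left ≫ (free f).toBody m = (x ≫ q) ≫ (free f).toBody n := by
    rw [Category.assoc, hq, ← hs]
    exact (hom_char_free ⟨m, s⟩).symm
  -- The boundary factors through stage `n` via `q`, and a new attaching map occurs no later than
  -- any such factorisation.
  have hm : m ≤ n := ((free f).isNew_attach m k s).le (x ≫ q) hs'
  have e : s.1.left ≫ (free f).stepMap hm = x ≫ q := by
    rw [← cancel_mono ((free f).toBody n), ← hs', Category.assoc]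
    exact congrArg (s.1.left ≫ ·) ((free f).stepMap_toBody hm)
  have e' : s.1.left ≫ (free f).stepMap hm ≫ stageMap f n = x := by
    refine (Category.assoc _ _ _).symm.trans ?_
    refine (congrArg (· ≫ stageMap f n) e).trans ?_
    rw [Category.assoc, hq', Category.comp_id]
  have hv' : s.1.right = v := (char_E ⟨m, s⟩).symm.trans hv
  refine ⟨(freeStage f m).stratum.char k s ≫ (free f).stepMap (Nat.succ_le_succ hm), ?_, ?_⟩
  · rw [actCell_termBody f n x v w w', ← char_eq_fill ⟨m, s⟩ w' hs hv]
    refine (Category.assoc _ _ _).trans ?_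
    refine (congrArg (_ ≫ ·) ((free f).stepMap_toBody (Nat.succ_le_succ hm))).trans ?_
    exact congrArg (_ ≫ ·) (Category.id_comp _).symm
  · subst hv'
    refine (Category.assoc _ _ _).trans ?_
    refine (char_stepMap_stageMap f hm k s (e' ▸ w)).trans (actCell_congr f n e' _ _ _)

/-- The terms of the free monoid sequence are the stages of the free cell complex. -/
theorem exists_stage_inverse (n : ℕ) :
    ∃ q : (oneStep.{u}.term n).M.obj f ⟶ ((free f).stratum n).X,
      q ≫ (free f).toBody n = termBody f n ∧ q ≫ stageMap f n = 𝟙 _ := by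
  induction n with
  | zero => exact ⟨𝟙 f.left, Category.id_comp _, Category.id_comp _⟩
  | succ n ih =>
    obtain ⟨q, hq, hq'⟩ := ih
    have hsurj : Function.Surjective ((oneStep.{u}.termAct n).χ.app f) :=
      (TopCat.epi_iff_surjective _).mp (epi_termAct oneStep.{u} n f)
    -- The stage is embedded in the body, so the inverse exists and is continuous as soon as the
    -- term lands in it. This is checked on points, using that the action is onto.
    have hrange : Set.range (termBody f (n + 1)) ⊆ Set.range ((free f).toBody (n + 1)) := by
      rintro _ ⟨y, rfl⟩
      obtain ⟨y, rfl⟩ := hsurj y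
      rcases (oneStratum (Arrow.mk ((oneStep.{u}.term n).R f))).exists_incl_or_char y with
        ⟨z, rfl⟩ | ⟨k, s, d, rfl⟩
      · have e : (oneStratum (Arrow.mk ((oneStep.{u}.term n).R f))).incl ≫
            (oneStep.{u}.termAct n).χ.app f ≫ termBody f (n + 1) = q ≫ (free f).toBody n := by
          refine Eq.trans ?_ ((termMap_termBody f n).trans hq.symm)
          rw [← L_termAct oneStep.{u} n f]
          exact (Category.assoc _ _ _).symm
        have h : termBody f (n + 1) ((oneStep.{u}.termAct n).χ.app f
            ((oneStratum (Arrow.mk ((oneStep.{u}.term n).R f))).incl z)) =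
              (free f).toBody n (q z) :=
          congrArg (fun t : (oneStep.{u}.term n).M.obj f ⟶ (free f).body => t z) e
        rw [h]
        exact (free f).range_toBody_mono (Nat.le_succ n) ⟨q z, rfl⟩
      · obtain ⟨c, hc, -⟩ := exists_actCell_termBody f q hq hq' s.left s.right s.w
        exact ⟨c d, congrArg (fun t : disk.{u} k ⟶ (free f).body => t d) hc⟩
    obtain ⟨q', h₁⟩ := exists_factor_of_range_subset
      ((free f).isClosedEmbedding_toBody (n + 1)).isInducing (termBody f (n + 1)) hrange
    refine ⟨q', h₁, term_hom_ext f n ?_ fun k x v w => ?_⟩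
    · have e : (oneStep.{u}.termMap n).χ.app f ≫ q' = q ≫ (free f).step n := by
        rw [← cancel_mono ((free f).toBody (n + 1)), Category.assoc, h₁, termMap_termBody,
          Category.assoc, step_toBody, hq]
      rw [← Category.assoc, e, Category.assoc, step_stageMap, ← Category.assoc, hq',
        Category.id_comp, Category.comp_id]
    · obtain ⟨d, hd, hd'⟩ := exists_actCell_termBody f q hq hq' x v w
      have e : actCell f n x v w ≫ q' = d := by
        rw [← cancel_mono ((free f).toBody (n + 1)), Category.assoc, h₁, hd]
      rw [← Category.assoc, e, hd', Category.comp_id]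

/-! ### Passage to the colimit and the structure of the small object argument. -/

/-- The map from the body of the free cell complex to the colimit of the free monoid sequence. -/
noncomputable def bodyTo : (free f).body ⟶ factorization.M.obj f :=
  (free f).desc (fun n => stageMap f n ≫ (oneStep.{u}.ι n).χ.app f) (fun n =>
    (Category.assoc _ _ _).symm.trans
      ((congrArg (· ≫ (oneStep.{u}.ι (n + 1)).χ.app f) (step_stageMap f n)).trans
        ((Category.assoc _ _ _).trans
          (congrArg (stageMap f n ≫ ·) (termMap_ι oneStep.{u} n f)))))

theorem toBody_bodyTo (n : ℕ) :
    (free f).toBody n ≫ bodyTo f = stageMap f n ≫ (oneStep.{u}.ι n).χ.app f :=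
  (free f).toBody_desc _ _ n

theorem bodyTo_colimTo : bodyTo f ≫ (colimTo freeLifting).χ.app f = 𝟙 (free f).body := by
  refine CellCx.body_hom_ext fun n => ?_
  refine (Category.assoc _ _ _).symm.trans ?_
  refine (congrArg (· ≫ (colimTo freeLifting).χ.app f) (toBody_bodyTo f n)).trans ?_
  refine (Category.assoc _ _ _).trans ?_
  refine (congrArg (stageMap f n ≫ ·) (ι_colimTo freeLifting n f)).trans ?_
  exact (stageMap_termBody f n).trans (Category.comp_id _).symm

/-- On the `n`-th term, the map into the body factors through the `n`-th stage by `q`, and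
`stageMap` undoes `q`. -/
theorem colimTo_bodyTo : (colimTo freeLifting).χ.app f ≫ bodyTo f = 𝟙 _ := by
  refine colim_hom_ext fun n => ?_
  obtain ⟨q, hq, hq'⟩ := exists_stage_inverse f n
  refine (Category.assoc _ _ _).symm.trans ?_
  refine (congrArg (· ≫ bodyTo f) (ι_colimTo freeLifting n f)).trans ?_
  refine (congrArg (· ≫ bodyTo f) hq.symm).trans ?_
  refine (Category.assoc _ _ _).trans ?_
  refine (congrArg (q ≫ ·) (toBody_bodyTo f n)).trans ?_
  refine (Category.assoc _ _ _).symm.trans ?_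
  refine (congrArg (· ≫ (oneStep.{u}.ι n).χ.app f) hq').trans ?_
  exact (Category.id_comp _).trans (Category.comp_id _).symm

/-- The free lifting structure on the factorisation of the small object argument. -/
noncomputable def freeLifting : FreeLifting cellMap.{u} factorization.{u} :=
  CellCx.freeLifting.ofIso (colimTo CellCx.freeLifting) bodyTo bodyTo_colimTo colimTo_bodyTo

/-- Fillers on the colimit are defined by transport, so the identity is checked in the body of the
free complex by `char_termAct_termTo` and brought back along `bodyTo`. -/
theorem char_termAct_ι (n : ℕ) (k : ℕ)
    (s : cellMap k ⟶ Arrow.mk ((oneStep.{u}.term n).R f)) (w) :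
    (oneStratum (Arrow.mk ((oneStep.{u}.term n).R f))).char k s ≫
      (oneStep.{u}.termAct n).χ.app f ≫ (oneStep.{u}.ι (n + 1)).χ.app f =
        (freeLifting.lifting f).fill k (s.left ≫ (oneStep.{u}.ι n).χ.app f) s.right w := by
  have w' : (s.left ≫ (termTo CellCx.freeLifting n).χ.app f) ≫ CellCx.factorization.R f =
      (cellMap k).hom ≫ s.right := by
    refine (Category.assoc _ _ _).trans ?_
    exact (congrArg (s.left ≫ ·) ((termTo CellCx.freeLifting n).comp_right f)).trans s.w
  have h := char_termAct_termTo CellCx.freeLifting n f k s w'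
  have e : (s.left ≫ (oneStep.{u}.ι n).χ.app f) ≫ (colimTo CellCx.freeLifting).χ.app f =
      s.left ≫ (termTo CellCx.freeLifting n).χ.app f :=
    (Category.assoc _ _ _).trans (congrArg (s.left ≫ ·) (ι_colimTo CellCx.freeLifting n f))
  have w'' := w'
  rw [← e] at w''
  refine Eq.trans ?_ (congrArg (· ≫ bodyTo f)
    (h.trans ((CellCx.freeLifting.lifting f).fill_congr e.symm rfl w' w'')))
  refine Eq.trans ?_ (Category.assoc _ _ _).symm
  refine congrArg (_ ≫ ·) ?_
  refine Eq.trans ?_ (Category.assoc _ _ _).symm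
  refine congrArg (_ ≫ ·) ?_
  refine Eq.trans ?_ (congrArg (· ≫ bodyTo f) (ι_colimTo CellCx.freeLifting (n + 1) f))
  refine Eq.trans ?_ (Category.assoc _ _ _).symm
  exact (Category.comp_id _).symm.trans (congrArg (_ ≫ ·) (colimTo_bodyTo f).symm)

/-- The case `n = 0`, where the term is the trivial factorisation and the action is the identity. -/
theorem char_ιOne (k : ℕ) (s : cellMap k ⟶ f) (w) :
    (oneStratum f).char k s ≫ oneStep.{u}.ιOne.χ.app f =
      (freeLifting.lifting f).fill k (s.left ≫ factorization.L f) s.right w :=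
  (congrArg ((oneStratum f).char k s ≫ ·) (Category.id_comp _).symm).trans
    (char_termAct_ι f 0 k s w)

theorem fill_unit_w {k : ℕ} (s : cellMap.{u} k ⟶ f) :
    (s.left ≫ factorization.L f) ≫ factorization.R f = (cellMap k).hom ≫ s.right := by
  rw [Category.assoc, factorization.fac, s.w]

theorem isFreeMonoidStructure : IsFreeMonoidStructure freeLifting.{u}.awfsStructure where
  comul f := by
    let φ : oneStep.{u}.left.obj f ⟶ factorization.left.obj f := oneStep.{u}.ιOne.leftTrans.app f
    apply Stratum.body_hom_ext
    · have h₁ : (oneStratum f).incl ≫ oneComul f =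
          (oneStratum (Arrow.mk (oneStratum f).incl)).incl :=
        (Stratum.incl_bodyMap _).trans (Category.id_comp _)
      have h₂ : (oneStratum f).incl ≫ oneStep.{u}.ιOne.χ.app f = factorization.L f :=
        oneStep.{u}.ιOne.left_comp f
      have h₃ : (oneStratum (Arrow.mk (oneStratum f).incl)).incl ≫
          oneStep.{u}.ιOne.χ.app (oneStep.{u}.left.obj f) =
            factorization.L (oneStep.{u}.left.obj f) :=
        oneStep.{u}.ιOne.left_comp (oneStep.{u}.left.obj f)
      refine (Category.assoc _ _ _).symm.trans ?_
      refine (congrArg (· ≫ freeLifting.comul f) h₂).trans ?_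
      refine (freeLifting.L_comul f).trans ?_
      refine Eq.trans ?_ (Category.assoc _ _ _)
      refine Eq.trans ?_ (congrArg
        (· ≫ oneStep.{u}.ιOne.χ.app (oneStep.{u}.left.obj f) ≫ factorization.M.map φ) h₁.symm)
      refine Eq.trans ?_ (Category.assoc _ _ _)
      refine Eq.trans ?_ (congrArg (· ≫ factorization.M.map φ) h₃.symm)
      refine Eq.trans ?_ (factorization.L_naturality φ)
      exact (Category.id_comp _).symm
    -- On cells, both composites yield the filler over `Lf` whose lower edge is the image of the
    -- cell: one by `fill_comul`, the other by the definition of `oneComul` and naturality of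
    -- fillers.
    · intro k s
      have w₀ := fill_unit_w f s
      let s' : cellMap k ⟶ oneStep.{u}.left.obj f :=
        Arrow.homMk s.left ((oneStratum f).char k s) ((oneStratum f).attach_incl k s)
      have w₁ := fill_unit_w (oneStep.{u}.left.obj f) s'
      have h₁ : (oneStratum f).char k s ≫ oneComul f =
          (oneStratum (oneStep.{u}.left.obj f)).char k s' :=
        Stratum.char_bodyMap _ k s
      have h₂ := char_ιOne (oneStep.{u}.left.obj f) k s' w₁
      have w₂ := FreeLifting.fill_map_w φ w₁
      have w₃ := freeLifting.fill_comul_w f k _ _ w₀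
      refine (Category.assoc _ _ _).symm.trans ?_
      refine (congrArg (· ≫ freeLifting.comul f) (char_ιOne f k s w₀)).trans ?_
      refine (freeLifting.fill_comul f k _ _ w₀ w₃).trans ?_
      refine Eq.trans ?_ (Category.assoc _ _ _)
      refine Eq.trans ?_ (congrArg
        (· ≫ oneStep.{u}.ιOne.χ.app (oneStep.{u}.left.obj f) ≫ factorization.M.map φ) h₁.symm)
      refine Eq.trans ?_ (Category.assoc _ _ _)
      refine Eq.trans ?_ (congrArg (· ≫ factorization.M.map φ) h₂.symm)
      refine Eq.trans ?_ (freeLifting.fill_map φ k _ _ w₁ w₂).symm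
      refine (freeLifting.lifting (factorization.left.obj f)).fill_congr ?_
        (char_ιOne f k s w₀).symm _ _
      refine (Category.assoc _ _ _).trans ?_
      refine Eq.trans ?_ (Category.assoc _ _ _).symm
      refine congrArg (s.left ≫ ·) ?_
      refine (freeLifting.L_comul f).trans ?_
      exact (Category.id_comp _).symm.trans (factorization.L_naturality φ)
  mul n f := by
    let g := (oneStep.{u}.term n).right.obj f
    let φ : g ⟶ factorization.right.obj f := (oneStep.{u}.ι n).rightTrans.app f
    apply Stratum.body_hom_ext
    · have h₂ : (oneStratum g).incl ≫ oneStep.{u}.ιOne.χ.app g = factorization.L g :=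
        oneStep.{u}.ιOne.left_comp g
      refine (Category.assoc _ _ _).symm.trans ?_
      refine (congrArg (· ≫ freeLifting.mul f) ((Category.assoc _ _ _).symm.trans
        (congrArg (· ≫ factorization.M.map φ) h₂))).trans ?_
      refine (congrArg (· ≫ freeLifting.mul f) (factorization.L_naturality φ).symm).trans ?_
      refine (Category.assoc _ _ _).trans ?_
      refine (congrArg (φ.left ≫ ·) (freeLifting.L_mul f)).trans ?_
      refine (Category.comp_id _).trans ?_
      refine (termMap_ι oneStep.{u} n f).symm.trans ?_
      refine (congrArg (· ≫ (oneStep.{u}.ι (n + 1)).χ.app f)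
        (L_termAct oneStep.{u} n f).symm).trans ?_
      exact Category.assoc _ _ _
    -- The cell is a filler of a square with boundary in the base; `M` and `μ` preserve it, and by
    -- the unit law `e` the boundary becomes that of the cell in the `n`-th action.
    · intro k s
      have w₀ := fill_unit_w g s
      have w₁ := FreeLifting.fill_map_w φ w₀
      have w₂ := freeLifting.fill_mul_w f w₁
      have e : ((s.left ≫ factorization.L g) ≫ factorization.M.map φ) ≫ freeLifting.mul f =
          s.left ≫ (oneStep.{u}.ι n).χ.app f := by
        refine (congrArg (· ≫ freeLifting.mul f) ((Category.assoc _ _ _).trans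
          (congrArg (s.left ≫ ·) (factorization.L_naturality φ).symm))).trans ?_
        refine (Category.assoc _ _ _).trans (congrArg (s.left ≫ ·) ?_)
        refine (Category.assoc _ _ _).trans ?_
        exact (congrArg (φ.left ≫ ·) (freeLifting.L_mul f)).trans (Category.comp_id _)
      have w₃ : (s.left ≫ (oneStep.{u}.ι n).χ.app f) ≫ factorization.R f =
          (cellMap k).hom ≫ s.right := by
        refine (Category.assoc _ _ _).trans ?_
        exact (congrArg (s.left ≫ ·) ((oneStep.{u}.ι n).comp_right f)).trans s.w
      refine (Category.assoc _ _ _).symm.trans ?_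
      refine (congrArg (· ≫ freeLifting.mul f) ((Category.assoc _ _ _).symm.trans
        (congrArg (· ≫ factorization.M.map φ) (char_ιOne g k s w₀)))).trans ?_
      refine (congrArg (· ≫ freeLifting.mul f) (freeLifting.fill_map φ k _ _ w₀ w₁)).trans ?_
      refine (freeLifting.fill_mul f k _ _ w₁ w₂).trans ?_
      refine ((freeLifting.lifting f).fill_congr e (Category.comp_id _) w₂ w₃).trans ?_
      exact (char_termAct_ι f n k s w₃).symm

end Garner

/-- `(UK, E)` is an algebraic weak factorisation system, it is free on the set of inclusions
`S^{n-1} ⟶ D^n` (via the canonical one-cell structures), and it is isomorphic to the algebraic weak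
factorisation system produced by Garner's small object argument. -/
theorem mainTheorem2 :
    ∃ A : AWFSStructure CellCx.factorization.{u}, CellCx.IsCellStructure A ∧
      (∃ η : Discrete ℕ ⥤ (AWFS.mk CellCx.factorization A).LMap,
        (∀ k : ℕ, ∃ h₁ h₂, η.obj ⟨k⟩ =
          { A := cellInclusions.{u}.obj ⟨k⟩
            a := CellCx.genStructure k
            counit := h₁
            coassoc := h₂ }) ∧
        (AWFS.mk CellCx.factorization A).IsFreeVia cellInclusions.{u} η) ∧
      ∃ G : AWFSStructure Garner.factorization.{u}, Garner.IsFreeMonoidStructure G ∧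
        Nonempty (AWFS.mk CellCx.factorization A ≅ AWFS.mk Garner.factorization G) := by
  refine ⟨CellCx.freeLifting.awfsStructure, CellCx.isCellStructure,
    ⟨CellCx.freeLifting.generatorFamily.functor, fun k => ?_, CellCx.freeLifting.isFreeVia⟩,
    Garner.freeLifting.awfsStructure, Garner.isFreeMonoidStructure,
    CellCx.freeLifting.nonempty_iso Garner.freeLifting⟩
  -- The characteristic map of the identity square is the filler of that square, so the prescribed
  -- structure maps are the generators of the free lifting structure.
  have e : CellCx.genStructure k = CellCx.freeLifting.generatorFamily.a k :=
    Arrow.hom_ext _ _ rfl (CellCx.genStructure_right k)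
  rw [e]
  exact ⟨CellCx.freeLifting.generatorFamily.counit k,
    CellCx.freeLifting.generatorFamily.coassoc k, rfl⟩
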